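/- Let $k$ be a commutative ring. For oriented compact $0$-manifolds $Y_0,Y_1$ let $\mathbf{Cob}(Y_0,Y_1)$ be the additive closure of the $k$-linear category whose objects are the oriented compact $1$-dimensional cobordisms $Y_0\to Y_1$ and whose morphisms are the $k$-linear combinations of diffeomorphism classes (relative to the boundary) of oriented compact $2$-bordisms between them, with $(Y_0\sqcup Y_1)\times[0,1]$ as the vertical boundary, modulo the relations $S$ (a bordism with a sphere component is $0$), $T$ (a torus component may be replaced by the factor $2$) and $4Tu$. Let $D$ be a tangle diagram with a checkerboard colouring $\chi$, which orients all the smoothings of $D$ as $1$-cobordisms $\partial^-\to\partial^+$. At each crossing one has the smoothing along the orientation, $V={)(}$, and the other one, $H=\asymp$. For a negative crossing the $0$-smoothing is $H$ and the $1$-smoothing is $V$; for a positive crossing the $0$-smoothing is $V$ and the $1$-smoothing is $H$. For a set $s$ of crossings of $D$ let $D_s$ be the result of $1$-smoothing the crossings in $s$ and $0$-smoothing the others, and let $E_s$ be the top exterior power of $k^s$. The universal bracket complex $[\![D^\chi]\!]$ in $\mathbf{Cob}(\partial^-,\partial^+)$ has $[\![D^\chi]\!]^i=\bigoplus_{|s|=i}D_s\otimes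 E_s$ and the differential $\sum_{a\notin s}\delta_a\otimes(\wedge a)$ on the summand $s$, where $\delta_a:D_s\to D_{s\cup\{a\}}$ is the saddle at $a$ (it is indeed a complex). For a complex $W$, $W[1]$ is the complex with $W[1]^i=W^{i-1}$ and differential $-d_W$. Let $D_-$ and $D_+$ be oriented tangle diagrams which are the same except at a crossing $c$, which is negative in $D_-$ and positive in $D_+$. Let $D_V$ and $D_H$ be obtained from them by replacing $c$ with the smoothing $V$ and $H$ respectively; all four carry the same colouring $\chi$. Let $\delta_-:[\![D_H^\chi]\!]\to[\![D_V^\chi]\!]$ and $\delta_+:[\![D_V^\chi]\!]\to[\![D_H^\chi]\!]$ be given on each summand by the saddle at $c$. Let $\Phi:[\![D_V^\chi]\!]\to[\![D_V^\chi]\!]$ be given on each summand by $\Phi_1-\Phi_2$, where $\Phi_1$ is $D_{V,s}\times[0,1]$ with the two vertical sheets at $c$ joined by a tube, and $\Phi_2$ is $D_{V,s}\times[0,1]$ with a $1$-handle (adding genus one) attached to the left of the two sheets. Then $\delta_-$, $\Phi$ and $\delta_+$ are chain maps, and $$\Phi\,\delta_-=0,\qquad \delta_+\,\Phi=0 .$$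 Consequently the sequence $[\![D_H^\chi]\!]\xrightarrow{-\delta_-}[\![D_V^\chi]\!]\xrightarrow{\Phi}[\![D_V^\chi]\!]\xrightarrow{-\delta_+}[\![D_H^\chi]\!]$ induces a chain map, the genus-one morphism, $$\widehat\Phi=\Phi_1\otimes\check c-\Phi_2\otimes\check c:\ [\![D_-^\chi]\!]\longrightarrow[\![D_+^\chi]\!][1].$$ Here $\check c:E_s\to E_{s\setminus\{c\}}$ is the inverse of $\wedge c$, so that $\widehat\Phi$ maps the summand $s\ni c$ of $[\![D_-^\chi]\!]$ to the summand $s\setminus\{c\}$ of $[\![D_+^\chi]\!]$, and it is zero on the summands $s\not\ni c$. It is induced by $\Phi$ in the sense that the composite $$[\![D_V^\chi]\!][1]\xrightarrow{\mathrm{id}\otimes(\wedge c)}[\![D_-^\chi]\!]\xrightarrow{\widehat\Phi}[\![D_+^\chi]\!][1]\to[\![D_V^\chi]\!][1]$$ is $\Phi[1]$, where the first map is the inclusion of the summands $s\ni c$ and the last one is the projection to the summands $s\not\ni c$ (both are chain maps). Moreover $\widehat\Phi$ has bidegree $(0,0)$: let $n_\pm$ be the number of positive (negative) crossings of the diagram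 in question, let the summand $D_s\otimes E_s$ have homological degree $|s|-n_-$ and quantum shift $|s|+n_+-2n_-$, and let a $2$-bordism $S$ have Euler degree $\chi(S)-\tfrac12|Y_0\sqcup Y_1|$. Then $\widehat\Phi$ preserves the homological degree, and each of its components is a linear combination of bordisms whose Euler degree plus the change of the quantum shift is $0$. -/

import Mathlib

open CategoryTheory

namespace GenusOne

/-! ### Oriented 0-manifolds and oriented 1-dimensional cobordisms -/

/-- A closed oriented `0`-manifold: a finite set with a sign on each point (`true` is `+`). -/
structure OrientedPoints where
  pt : Type
  [fin : Finite pt]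
  sign : pt → Bool

attribute [instance] OrientedPoints.fin

/-- `(e, b)` is one of the two ends of the oriented edge `e`; this says that it is its head,
where `head e : Bool` names the end of `e` that is its head. -/
def IsHead {E : Type} (head : E → Bool) (a : E × Bool) : Prop := a.2 = head a.1

instance {E : Type} (head : E → Bool) (a : E × Bool) : Decidable (IsHead head a) :=
  inferInstanceAs (Decidable (a.2 = head a.1))

/-- A way to glue the ends of a set `E` of oriented edges into a compact oriented `1`-manifold
with boundary `Ȳ₀ ⊔ Y₁`.  Each end is either linked to the opposite kind of end of an edge, or is
a boundary point; `att y` is the edge end sitting at the boundary point `y`.  A positive point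
of `Y₁` is a head, a positive point of `Y₀` is a tail. -/
structure Linking (Y₀ Y₁ : OrientedPoints) (E : Type) (head : E → Bool) where
  link : E × Bool → (E × Bool) ⊕ (Y₀.pt ⊕ Y₁.pt)
  att : Y₀.pt ⊕ Y₁.pt → E × Bool
  link_att : ∀ y, link (att y) = Sum.inr y
  att_link : ∀ a y, link a = Sum.inr y → att y = a
  link_symm : ∀ a b, link a = Sum.inl b → link b = Sum.inl a
  orient : ∀ a b, link a = Sum.inl b → (IsHead head b ↔ ¬ IsHead head a)
  orient_bot : ∀ y, IsHead head (att (Sum.inl y)) ↔ Y₀.sign y = false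
  orient_top : ∀ y, IsHead head (att (Sum.inr y)) ↔ Y₁.sign y = true

/-- A cobordism `Y₀ → Y₁`: a compact oriented `1`-manifold with boundary `Ȳ₀ ⊔ Y₁`, presented
as a finite union of oriented edges. -/
structure OneCob (Y₀ Y₁ : OrientedPoints) where
  Edge : Type
  [fin : Finite Edge]
  head : Edge → Bool
  linking : Linking Y₀ Y₁ Edge head

attribute [instance] OneCob.fin

lemma Linking.isHead_att_iff {Y₀ Y₁ : OrientedPoints} {E E' : Type} {h : E → Bool}
    {h' : E' → Bool} (L : Linking Y₀ Y₁ E h) (L' : Linking Y₀ Y₁ E' h') (y : Y₀.pt ⊕ Y₁.pt) :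
    IsHead h (L.att y) ↔ IsHead h' (L'.att y) := by
  cases y with
  | inl y => rw [L.orient_bot, L'.orient_bot]
  | inr y => rw [L.orient_top, L'.orient_top]

lemma eq_head_of_isHead {E : Type} {h : E → Bool} {a : E × Bool} (ha : IsHead h a) :
    (a.1, h a.1) = a := by
  obtain ⟨e, b⟩ := a
  simp only [IsHead] at ha
  simp [ha]

lemma eq_tail_of_not_isHead {E : Type} {h : E → Bool} {a : E × Bool} (ha : ¬ IsHead h a) :
    (a.1, !(h a.1)) = a := by
  obtain ⟨e, b⟩ := a
  simp only [IsHead] at ha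
  cases b <;> cases hh : h e <;> simp_all

/-! ### 2-bordisms: oriented surfaces glued from polygons -/

/-- Rotation around a vertex of a polygonal surface.  The sides of the polygons are the elements
of `D`, `face` sends a side to the next side of the same polygon (counterclockwise, the polygon
lying to the left of its sides), and `glue` sends a side either to the side it is glued to (with
the opposite direction), or to the label of the boundary edge it is.
`Turn face glue d l` says that, rotating around the initial vertex of the side `d`,
starting at `d` and moving away from its polygon, one meets the boundary of the surface at `l`. -/
inductive Turn {D L : Type} (face : D → D) (glue : D → D ⊕ L) : D → L → Prop
  | here (d : D) (l : L) : glue d = Sum.inr l → Turn face glue d l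
  | step (d d' : D) (l : L) : glue d = Sum.inl d' → Turn face glue (face d') l →
      Turn face glue d l

/-- The boundary of a `2`-bordism `W₀ → W₁` is the closed oriented curve made of `W₁` and of `W₀`
with the reversed orientation, joined at the points `y ∈ Y₀ ⊔ Y₁` (the sides `y × [0,1]` are
collapsed to points).  This is the edge following a given edge along this curve. -/
def bnext {Y₀ Y₁ : OrientedPoints} (W₀ W₁ : OneCob Y₀ Y₁) :
    W₀.Edge ⊕ W₁.Edge → W₀.Edge ⊕ W₁.Edge
  | Sum.inl e =>
    match W₀.linking.link (e, !(W₀.head e)) with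
    | Sum.inl a => Sum.inl a.1
    | Sum.inr y => Sum.inr (W₁.linking.att y).1
  | Sum.inr e =>
    match W₁.linking.link (e, W₁.head e) with
    | Sum.inl a => Sum.inr a.1
    | Sum.inr y => Sum.inl (W₀.linking.att y).1

/-- A `2`-bordism `W₀ → W₁`: a compact oriented surface, presented by finitely many oriented
polygons some of whose sides are glued in pairs, reversing directions, together with an
identification of the remaining sides with the edges of `W̄₀ ⊔ W₁`, such that the boundary
curves of the surface are those prescribed by `W₀` and `W₁` (`corner`). The polygons are the cycles
of the permutation `face` of the set `Dart` of all sides. -/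
structure Bord {Y₀ Y₁ : OrientedPoints} (W₀ W₁ : OneCob Y₀ Y₁) where
  Dart : Type
  [fin : Finite Dart]
  face : Equiv.Perm Dart
  glue : Dart → Dart ⊕ (W₀.Edge ⊕ W₁.Edge)
  side : W₀.Edge ⊕ W₁.Edge → Dart
  glue_side : ∀ l, glue (side l) = Sum.inr l
  side_glue : ∀ d l, glue d = Sum.inr l → side l = d
  glue_symm : ∀ d d', glue d = Sum.inl d' → glue d' = Sum.inl d
  glue_ne : ∀ d, glue d ≠ Sum.inl d
  corner : ∀ l, Turn face glue (face (side l)) (bnext W₀ W₁ l)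

attribute [instance] Bord.fin

namespace Bord

variable {Y₀ Y₁ : OrientedPoints} {W₀ W₁ W₂ W₃ : OneCob Y₀ Y₁}

/-- The gluing map of the union of two surfaces along `W₁`. -/
def compGlue (S : Bord W₀ W₁) (T : Bord W₁ W₂) :
    S.Dart ⊕ T.Dart → (S.Dart ⊕ T.Dart) ⊕ (W₀.Edge ⊕ W₂.Edge)
  | Sum.inl a =>
    match S.glue a with
    | Sum.inl a' => Sum.inl (Sum.inl a')
    | Sum.inr (Sum.inl e) => Sum.inr (Sum.inl e)
    | Sum.inr (Sum.inr e) => Sum.inl (Sum.inr (T.side (Sum.inl e)))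
  | Sum.inr b =>
    match T.glue b with
    | Sum.inl b' => Sum.inl (Sum.inr b')
    | Sum.inr (Sum.inl e) => Sum.inl (Sum.inl (S.side (Sum.inr e)))
    | Sum.inr (Sum.inr e) => Sum.inr (Sum.inr e)

/-- The boundary sides of the union of two surfaces along `W₁`. -/
def compSide (S : Bord W₀ W₁) (T : Bord W₁ W₂) : W₀.Edge ⊕ W₂.Edge → S.Dart ⊕ T.Dart
  | Sum.inl e => Sum.inl (S.side (Sum.inl e))
  | Sum.inr e => Sum.inr (T.side (Sum.inr e))

lemma comp_turn_left (S : Bord W₀ W₁) (T : Bord W₁ W₂) {d : S.Dart} {l : W₀.Edge ⊕ W₁.Edge}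
    (h : Turn S.face S.glue d l) (m : W₀.Edge ⊕ W₂.Edge)
    (h₀ : ∀ e, l = Sum.inl e → m = Sum.inl e)
    (h₁ : ∀ e, l = Sum.inr e →
      Turn (Equiv.sumCongr S.face T.face) (compGlue S T)
        (Sum.inr (T.face (T.side (Sum.inl e)))) m) :
    Turn (Equiv.sumCongr S.face T.face) (compGlue S T) (Sum.inl d) m := by
  induction h with
  | here d l hd =>
    rcases l with e | e
    · obtain rfl := h₀ e rfl
      exact Turn.here _ _ (by simp [compGlue, hd])
    · exact Turn.step _ (Sum.inr (T.side (Sum.inl e))) _ (by simp [compGlue, hd]) (h₁ e rfl)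
  | step d d' l hd _ ih =>
    exact Turn.step _ (Sum.inl d') _ (by simp [compGlue, hd]) (ih h₀ h₁)

lemma comp_turn_right (S : Bord W₀ W₁) (T : Bord W₁ W₂) {d : T.Dart} {l : W₁.Edge ⊕ W₂.Edge}
    (h : Turn T.face T.glue d l) (m : W₀.Edge ⊕ W₂.Edge)
    (h₀ : ∀ e, l = Sum.inr e → m = Sum.inr e)
    (h₁ : ∀ e, l = Sum.inl e →
      Turn (Equiv.sumCongr S.face T.face) (compGlue S T)
        (Sum.inl (S.face (S.side (Sum.inr e)))) m) :
    Turn (Equiv.sumCongr S.face T.face) (compGlue S T) (Sum.inr d) m := by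
  induction h with
  | here d l hd =>
    rcases l with e | e
    · exact Turn.step _ (Sum.inl (S.side (Sum.inr e))) _ (by simp [compGlue, hd]) (h₁ e rfl)
    · obtain rfl := h₀ e rfl
      exact Turn.here _ _ (by simp [compGlue, hd])
  | step d d' l hd _ ih =>
    exact Turn.step _ (Sum.inr d') _ (by simp [compGlue, hd]) (ih h₀ h₁)

/-- Gluing of `2`-bordisms along `W₁`. -/
def comp (S : Bord W₀ W₁) (T : Bord W₁ W₂) : Bord W₀ W₂ where
  Dart := S.Dart ⊕ T.Dart
  face := Equiv.sumCongr S.face T.face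
  glue := compGlue S T
  side := compSide S T
  glue_side := by
    rintro (e | e) <;> simp [compGlue, compSide, glue_side]
  side_glue := by
    rintro (d | d) l h
    · rcases hd : S.glue d with d' | e | e <;> simp [compGlue, hd] at h
      subst h
      simp [compSide, S.side_glue _ _ hd]
    · rcases hd : T.glue d with d' | e | e <;> simp [compGlue, hd] at h
      subst h
      simp [compSide, T.side_glue _ _ hd]
  glue_symm := by
    rintro (d | d) d' h
    · rcases hd : S.glue d with a | e | e <;> simp [compGlue, hd] at h
      · subst h
        simp [compGlue, S.glue_symm _ _ hd]
      · subst h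
        simp [compGlue, glue_side, S.side_glue _ _ hd]
    · rcases hd : T.glue d with a | e | e <;> simp [compGlue, hd] at h
      · subst h
        simp [compGlue, T.glue_symm _ _ hd]
      · subst h
        simp [compGlue, glue_side, T.side_glue _ _ hd]
  glue_ne := by
    rintro (d | d) h
    · rcases hd : S.glue d with a | e | e <;> simp [compGlue, hd] at h
      subst h
      exact S.glue_ne _ hd
    · rcases hd : T.glue d with a | e | e <;> simp [compGlue, hd] at h
      subst h
      exact T.glue_ne _ hd
  corner := by
    rintro (e | e)
    · refine comp_turn_left S T (S.corner (Sum.inl e)) _ ?_ ?_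
      · intro e' he'
        rcases hl : W₀.linking.link (e, !(W₀.head e)) with a | y <;>
          simp [bnext, hl] at he' ⊢
        exact he'
      · intro e' he'
        rcases hl : W₀.linking.link (e, !(W₀.head e)) with a | y <;>
          simp [bnext, hl] at he' ⊢
        subst he'
        have hy : ¬ IsHead W₁.head (W₁.linking.att y) := by
          rw [W₁.linking.isHead_att_iff W₀.linking, W₀.linking.att_link _ _ hl]
          simp [IsHead]
        have h2 := T.corner (Sum.inl (W₁.linking.att y).1)
        simp only [bnext, eq_tail_of_not_isHead hy, W₁.linking.link_att] at h2
        exact comp_turn_right S T h2 _ (by simp) (by simp)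
    · refine comp_turn_right S T (T.corner (Sum.inr e)) _ ?_ ?_
      · intro e' he'
        rcases hl : W₂.linking.link (e, W₂.head e) with a | y <;>
          simp [bnext, hl] at he' ⊢
        exact he'
      · intro e' he'
        rcases hl : W₂.linking.link (e, W₂.head e) with a | y <;>
          simp [bnext, hl] at he' ⊢
        subst he'
        have hy : IsHead W₁.head (W₁.linking.att y) := by
          rw [W₁.linking.isHead_att_iff W₂.linking, W₂.linking.att_link _ _ hl]
          simp [IsHead]
        have h2 := S.corner (Sum.inr (W₁.linking.att y).1)
        simp only [bnext, eq_head_of_isHead hy, W₁.linking.link_att] at h2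
        exact comp_turn_left S T h2 _ (by simp) (by simp)

open Classical in
/-- The face map of `addEdge`. -/
noncomputable def addEdgeFun {D : Type} (face : D → D) (u v : D) : D ⊕ Bool → D ⊕ Bool
  | Sum.inl d => if d = u then Sum.inr false else if d = v then Sum.inr true
      else Sum.inl (face d)
  | Sum.inr false => Sum.inl (face v)
  | Sum.inr true => if u = v then Sum.inr true else Sum.inl (face u)

lemma addEdgeFun_bijective {D : Type} [Finite D] (face : Equiv.Perm D) (u v : D) :
    Function.Bijective (addEdgeFun face u v) := by
  classical
  rw [← Finite.injective_iff_bijective]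
  have inj : ∀ x y, face x = face y → x = y := fun x y hxy => face.injective hxy
  rintro (a | _ | _) (b | _ | _) h <;> simp only [addEdgeFun] at h <;> grind

/-- Add to a polygonal surface a new edge from the corner following the side `u` to the corner
following the side `v`; its two sides are `inr false` (following `u`) and `inr true`
(following `v`, or closing up to a polygon with one side if `u = v`).
If `u` and `v` are sides of the same polygon, this cuts the polygon into two along a chord, which
does not change the surface.  If they are sides of different polygons, the two polygons, which
are discs, are replaced by an annulus (cut open along the new edge):
an open disc is removed from each of the two polygons and a tube is attached in their place. -/
noncomputable def addEdge (S : Bord W₀ W₁) (u v : S.Dart) : Bord W₀ W₁ where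
  Dart := S.Dart ⊕ Bool
  face := Equiv.ofBijective _ (addEdgeFun_bijective S.face u v)
  glue
    | Sum.inl d => (S.glue d).map Sum.inl id
    | Sum.inr b => Sum.inl (Sum.inr (!b))
  side l := Sum.inl (S.side l)
  glue_side l := by simp [S.glue_side]
  side_glue := by
    rintro (d | b) l h
    · rcases hd : S.glue d with d' | l' <;> simp [hd] at h
      subst h
      simp [S.side_glue _ _ hd]
    · simp at h
  glue_symm := by
    rintro (d | b) d' h
    · rcases hd : S.glue d with a | l' <;> simp [hd] at h
      subst h
      simp [S.glue_symm _ _ hd]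
    · simp at h
      subst h
      simp
  glue_ne := by
    rintro (d | b) h
    · rcases hd : S.glue d with a | l' <;> simp [hd] at h
      subst h
      exact S.glue_ne _ hd
    · simp at h
  corner l := by
    classical
    set g : S.Dart ⊕ Bool → (S.Dart ⊕ Bool) ⊕ (W₀.Edge ⊕ W₁.Edge) := fun
      | Sum.inl d => (S.glue d).map Sum.inl id
      | Sum.inr b => Sum.inl (Sum.inr (!b)) with hg
    have key : ∀ (d : S.Dart) (m : W₀.Edge ⊕ W₁.Edge),
        Turn (addEdgeFun S.face u v) g (Sum.inl (S.face d)) m →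
        Turn (addEdgeFun S.face u v) g (addEdgeFun S.face u v (Sum.inl d)) m := by
      intro d m h
      by_cases hu : d = u
      · subst hu
        have e1 : addEdgeFun S.face d v (Sum.inl d) = Sum.inr false := by simp [addEdgeFun]
        rw [e1]
        refine Turn.step _ (Sum.inr true) _ (by simp [hg]) ?_
        by_cases hv : d = v
        · subst hv
          have e2 : addEdgeFun S.face d d (Sum.inr true) = Sum.inr true := by simp [addEdgeFun]
          rw [e2]
          refine Turn.step _ (Sum.inr false) _ (by simp [hg]) ?_
          simpa [addEdgeFun] using h
        · have e2 : addEdgeFun S.face d v (Sum.inr true) = Sum.inl (S.face d) := by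
            simp [addEdgeFun, hv]
          rwa [e2]
      · by_cases hv : d = v
        · subst hv
          have e1 : addEdgeFun S.face u d (Sum.inl d) = Sum.inr true := by
            simp [addEdgeFun, hu]
          rw [e1]
          refine Turn.step _ (Sum.inr false) _ (by simp [hg]) ?_
          simpa [addEdgeFun] using h
        · have e1 : addEdgeFun S.face u v (Sum.inl d) = Sum.inl (S.face d) := by
            simp [addEdgeFun, hu, hv]
          rwa [e1]
    have main : ∀ (d : S.Dart) (m : W₀.Edge ⊕ W₁.Edge), Turn S.face S.glue d m →
        Turn (addEdgeFun S.face u v) g (Sum.inl d) m := by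
      intro d m h
      induction h with
      | here d l hd => exact Turn.here _ _ (by simp [hg, hd])
      | step d d' l hd _ ih =>
        exact Turn.step _ (Sum.inl d') _ (by simp [hg, hd]) (key _ _ ih)
    exact key _ _ (main _ _ (S.corner l))

open Classical in
/-- The face map of `subdivide`. -/
noncomputable def subdivideFun {D : Type} (face : D → D) (d d' : D) : D ⊕ Bool → D ⊕ Bool
  | Sum.inl a => if a = d then Sum.inr false else if a = d' then Sum.inr true
      else Sum.inl (face a)
  | Sum.inr false => Sum.inl (face d)
  | Sum.inr true => Sum.inl (face d')

lemma subdivideFun_bijective {D : Type} [Finite D] (face : Equiv.Perm D) (d d' : D)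
    (h : d ≠ d') : Function.Bijective (subdivideFun face d d') := by
  classical
  rw [← Finite.injective_iff_bijective]
  have inj : ∀ x y, face x = face y → x = y := fun x y hxy => face.injective hxy
  rintro (a | _ | _) (b | _ | _) h <;> simp only [subdivideFun] at h <;> grind

open Classical in
/-- The gluing map of `subdivide`. -/
noncomputable def subdivideGlue (S : Bord W₀ W₁) (d d' : S.Dart) :
    S.Dart ⊕ Bool → (S.Dart ⊕ Bool) ⊕ (W₀.Edge ⊕ W₁.Edge)
  | Sum.inl a => if a = d then Sum.inl (Sum.inr true) else
      if a = d' then Sum.inl (Sum.inr false) else (S.glue a).map Sum.inl id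
  | Sum.inr false => Sum.inl (Sum.inl d')
  | Sum.inr true => Sum.inl (Sum.inl d)

/-- Subdivide an interior edge, with the two sides `d` and `d'`, by a new vertex.  The side `d`
becomes `d` followed by `inr false`, the side `d'` becomes `d'` followed by `inr true`. -/
noncomputable def subdivide (S : Bord W₀ W₁) (d d' : S.Dart) (h : S.glue d = Sum.inl d') :
    Bord W₀ W₁ where
  Dart := S.Dart ⊕ Bool
  face := Equiv.ofBijective _ (subdivideFun_bijective S.face d d'
    (fun hd => S.glue_ne d (by rw [h, hd])))
  glue := subdivideGlue S d d'
  side l := Sum.inl (S.side l)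
  glue_side l := by
    have h' := S.glue_symm _ _ h
    have h1 : S.side l ≠ d := fun hh => by simpa [hh, h] using S.glue_side l
    have h2 : S.side l ≠ d' := fun hh => by simpa [hh, h'] using S.glue_side l
    simp [subdivideGlue, h1, h2, S.glue_side]
  side_glue := by
    rintro (a | _ | _) l ha
    · by_cases h1 : a = d
      · simp [subdivideGlue, h1] at ha
      · by_cases h2 : a = d'
        · subst h2
          simp [subdivideGlue, h1] at ha
        · rcases hd : S.glue a with b | l' <;> simp [subdivideGlue, h1, h2, hd] at ha
          subst ha
          simp [S.side_glue _ _ hd]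
    · simp [subdivideGlue] at ha
    · simp [subdivideGlue] at ha
  glue_symm := by
    have h' := S.glue_symm _ _ h
    have hne : d' ≠ d := fun hd => S.glue_ne d (by rw [h, hd])
    rintro (a | _ | _) b ha
    · by_cases h1 : a = d
      · subst h1
        simp [subdivideGlue] at ha
        subst ha
        simp [subdivideGlue]
      · by_cases h2 : a = d'
        · subst h2
          simp [subdivideGlue, h1] at ha
          subst ha
          simp [subdivideGlue]
        · rcases hd : S.glue a with c | l' <;> simp [subdivideGlue, h1, h2, hd] at ha
          subst ha
          have hc := S.glue_symm _ _ hd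
          have h3 : c ≠ d := fun hh => h2 (by
            subst hh; rw [h] at hc; exact (Sum.inl.inj hc).symm)
          have h4 : c ≠ d' := fun hh => h1 (by
            subst hh; rw [h'] at hc; exact (Sum.inl.inj hc).symm)
          simp [subdivideGlue, h3, h4, hc]
    · simp [subdivideGlue] at ha
      subst ha
      simp [subdivideGlue, hne]
    · simp [subdivideGlue] at ha
      subst ha
      simp [subdivideGlue]
  glue_ne := by
    rintro (a | _ | _) ha
    · by_cases h1 : a = d
      · simp [subdivideGlue, h1] at ha
      · by_cases h2 : a = d'
        · subst h2
          simp [subdivideGlue, h1] at ha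
        · rcases hd : S.glue a with b | l' <;> simp [subdivideGlue, h1, h2, hd] at ha
          subst ha
          exact S.glue_ne _ hd
    · simp [subdivideGlue] at ha
    · simp [subdivideGlue] at ha
  corner l := by
    have h' := S.glue_symm _ _ h
    have hne : d' ≠ d := fun hd => S.glue_ne d (by rw [h, hd])
    have main : ∀ (a : S.Dart) (m : W₀.Edge ⊕ W₁.Edge), Turn S.face S.glue a m →
        Turn (subdivideFun S.face d d') (subdivideGlue S d d') (Sum.inl a) m := by
      intro a m hh
      induction hh with
      | here a l hd =>
        have h1 : a ≠ d := fun hh => by simp [hh, h] at hd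
        have h2 : a ≠ d' := fun hh => by simp [hh, h'] at hd
        exact Turn.here _ _ (by simp [subdivideGlue, h1, h2, hd])
      | step a b l hd _ ih =>
        by_cases h1 : a = d
        · subst h1
          obtain rfl : d' = b := Sum.inl.inj (h.symm.trans hd)
          exact Turn.step _ (Sum.inr true) _ (by simp [subdivideGlue]) ih
        · by_cases h2 : a = d'
          · subst h2
            obtain rfl : d = b := Sum.inl.inj (h'.symm.trans hd)
            exact Turn.step _ (Sum.inr false) _ (by simp [subdivideGlue, h1]) ih
          · have hc := S.glue_symm _ _ hd
            have h3 : b ≠ d := fun hh => h2 (by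
              subst hh; rw [h] at hc; exact (Sum.inl.inj hc).symm)
            have h4 : b ≠ d' := fun hh => h1 (by
              subst hh; rw [h'] at hc; exact (Sum.inl.inj hc).symm)
            refine Turn.step _ (Sum.inl b) _ (by simp [subdivideGlue, h1, h2, hd]) ?_
            simpa [subdivideFun, h3, h4] using ih
    have h1 : S.side l ≠ d := fun hh => by simpa [hh, h] using S.glue_side l
    have h2 : S.side l ≠ d' := fun hh => by simpa [hh, h'] using S.glue_side l
    have := main _ _ (S.corner l)
    simpa [subdivideFun, h1, h2] using this

end Bord

/-- A closed oriented surface glued from polygons. -/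
structure ClosedSurface where
  Dart : Type
  [fin : Finite Dart]
  face : Equiv.Perm Dart
  mate : Dart → Dart
  mate_mate : ∀ d, mate (mate d) = d
  mate_ne : ∀ d, mate d ≠ d

attribute [instance] ClosedSurface.fin

/-- The sphere `S²`, glued from one polygon with boundary word `a a⁻¹`. -/
def sphere : ClosedSurface where
  Dart := ZMod 2
  face := Equiv.addRight 1
  mate d := d + 1
  mate_mate := by decide
  mate_ne := by decide

/-- The torus `T²`, glued from one polygon with boundary word `a b a⁻¹ b⁻¹`. -/
def torus : ClosedSurface where
  Dart := ZMod 4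
  face := Equiv.addRight 1
  mate d := d + 2
  mate_mate := by decide
  mate_ne := by decide

namespace Bord

variable {Y₀ Y₁ : OrientedPoints} {W₀ W₁ W₂ W₃ : OneCob Y₀ Y₁}

/-- The disjoint union of a `2`-bordism and a closed surface. -/
def addClosed (S : Bord W₀ W₁) (Z : ClosedSurface) : Bord W₀ W₁ where
  Dart := S.Dart ⊕ Z.Dart
  face := Equiv.sumCongr S.face Z.face
  glue
    | Sum.inl d => (S.glue d).map Sum.inl id
    | Sum.inr z => Sum.inl (Sum.inr (Z.mate z))
  side l := Sum.inl (S.side l)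
  glue_side l := by simp [S.glue_side]
  side_glue := by
    rintro (d | z) l h
    · rcases hd : S.glue d with d' | l' <;> simp [hd] at h
      subst h
      simp [S.side_glue _ _ hd]
    · simp at h
  glue_symm := by
    rintro (d | z) d' h
    · rcases hd : S.glue d with a | l' <;> simp [hd] at h
      subst h
      simp [S.glue_symm _ _ hd]
    · simp at h
      subst h
      simp [Z.mate_mate]
  glue_ne := by
    rintro (d | z) h
    · rcases hd : S.glue d with a | l' <;> simp [hd] at h
      subst h
      exact S.glue_ne _ hd
    · simp at h
      exact Z.mate_ne _ h
  corner l := by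
    set g : S.Dart ⊕ Z.Dart → (S.Dart ⊕ Z.Dart) ⊕ (W₀.Edge ⊕ W₁.Edge) := fun
      | Sum.inl d => (S.glue d).map Sum.inl id
      | Sum.inr z => Sum.inl (Sum.inr (Z.mate z)) with hg
    have main : ∀ (d : S.Dart) (m : W₀.Edge ⊕ W₁.Edge), Turn S.face S.glue d m →
        Turn (Equiv.sumCongr S.face Z.face) g (Sum.inl d) m := by
      intro d m h
      induction h with
      | here d l hd => exact Turn.here _ _ (by simp [hg, hd])
      | step d d' l hd _ ih => exact Turn.step _ (Sum.inl d') _ (by simp [hg, hd]) ih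
    exact main _ _ (S.corner l)

/-- The number of vertices of the polygonal surface. -/
noncomputable def numVertices (S : Bord W₀ W₁) : ℕ :=
  Nat.card (Quot fun d d' : S.Dart => ∃ m, S.glue d = Sum.inl m ∧ S.face m = d')

/-- The number of edges of the polygonal surface (pairs of glued sides, and boundary sides). -/
noncomputable def numEdges (S : Bord W₀ W₁) : ℕ :=
  Nat.card (Quot fun d d' : S.Dart => S.glue d = Sum.inl d')

/-- The number of polygons. -/
noncomputable def numFaces (S : Bord W₀ W₁) : ℕ :=
  Nat.card (Quot fun d d' : S.Dart => S.face d = d')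

/-- The Euler characteristic of a `2`-bordism. -/
noncomputable def eulerChar (S : Bord W₀ W₁) : ℤ :=
  (S.numVertices : ℤ) - (S.numEdges : ℤ) + (S.numFaces : ℤ)

/-- The Euler degree `χ(S) - |Y₀ ⊔ Y₁| / 2` of a `2`-bordism. -/
noncomputable def degree (S : Bord W₀ W₁) : ℚ :=
  (S.eulerChar : ℚ) - (Nat.card (Y₀.pt ⊕ Y₁.pt) : ℚ) / 2

end Bord

/-! ### Products and saddles -/

/-- The sides of the polygons of the surfaces `elementary`. -/
inductive ElemDart (E : Type) : Type
  | bot (e : E)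
  | top (e : E)
  | wall (a : E × Bool)
  | post (a : E × Bool)

instance {E : Type} [Finite E] : Finite (ElemDart E) :=
  Finite.of_injective
    (fun d : ElemDart E => match d with
      | .bot e => (Sum.inl (Sum.inl e) : (E ⊕ E) ⊕ ((E × Bool) ⊕ (E × Bool)))
      | .top e => Sum.inl (Sum.inr e)
      | .wall a => Sum.inr (Sum.inl a)
      | .post a => Sum.inr (Sum.inr a))
    (by rintro (_ | _ | _ | _) (_ | _ | _ | _) h <;> simp_all)

section Elementary

variable {Y₀ Y₁ : OrientedPoints} {E : Type} {head : E → Bool}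

/-- Go from the head of an edge to the following edge according to `L₁`, and from the tail of an
edge to the preceding edge according to `L₀`; at a boundary point, pass from one to the other. -/
def around (L₀ L₁ : Linking Y₀ Y₁ E head) (a : E × Bool) : E × Bool :=
  if IsHead head a then
    match L₁.link a with
    | Sum.inl b => b
    | Sum.inr y => L₀.att y
  else
    match L₀.link a with
    | Sum.inl b => b
    | Sum.inr y => L₁.att y

lemma around_around (L₀ L₁ : Linking Y₀ Y₁ E head) (a : E × Bool) :
    around L₁ L₀ (around L₀ L₁ a) = a := by
  by_cases ha : IsHead head a
  · rcases hl : L₁.link a with b | y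
    · have hb : ¬ IsHead head b := fun h => (L₁.orient a b hl).1 h ha
      simp [around, ha, hl, hb, L₁.link_symm _ _ hl]
    · have hb : IsHead head (L₀.att y) := by
        rw [L₀.isHead_att_iff L₁, L₁.att_link _ _ hl]; exact ha
      simp [around, ha, hl, hb, L₀.link_att, L₁.att_link _ _ hl]
  · rcases hl : L₀.link a with b | y
    · have hb : IsHead head b := (L₀.orient a b hl).2 ha
      simp [around, ha, hl, hb, L₀.link_symm _ _ hl]
    · have hb : ¬ IsHead head (L₁.att y) := by
        rw [L₁.isHead_att_iff L₀, L₀.att_link _ _ hl]; exact ha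
      simp [around, ha, hl, hb, L₁.link_att, L₀.att_link _ _ hl]

/-- The polygons of `elementary`. -/
def elemFace (L₀ L₁ : Linking Y₀ Y₁ E head) : ElemDart E → ElemDart E
  | .top e => .wall (e, head e)
  | .bot e => .wall (e, !(head e))
  | .wall a => if IsHead head a then .bot a.1 else .top a.1
  | .post a => .post (around L₀ L₁ a)

/-- The gluing of `elementary`. -/
def elemGlue : ElemDart E → ElemDart E ⊕ (E ⊕ E)
  | .top e => Sum.inr (Sum.inr e)
  | .bot e => Sum.inr (Sum.inl e)
  | .wall a => Sum.inl (.post a)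
  | .post a => Sum.inl (.wall a)

/-- The elementary `2`-bordism between two `1`-manifolds glued in two ways from the same edges.
It has one square `e × [0,1]` for each edge `e`, with sides `top e = e × {1}`, `bot e = e × {0}`,
`wall (e, b)`, `b : Bool`; the other polygons have sides `post a` glued to `wall a`.
Where `L₀` and `L₁` both link the end `a` to `b`, they have a bigon with the sides
`post a` and `post b`, which merely glues the two squares side by side; where both attach `a` to a
boundary point there is a monogon, which collapses the vertical side `wall a` to a point; where
`L₀` links `a - a'`, `b - b'` and `L₁` links `a - b'`, `b - a'`, there is a quadrilateral, which is
the saddle.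
In particular the product `W × [0,1]` is the case `L₀ = L₁`. -/
def elementary [Finite E] (L₀ L₁ : Linking Y₀ Y₁ E head) :
    Bord (OneCob.mk E head L₀) (OneCob.mk E head L₁) where
  Dart := ElemDart E
  face :=
    { toFun := elemFace L₀ L₁
      invFun := fun d => match d with
        | .top e => .wall (e, !(head e))
        | .bot e => .wall (e, head e)
        | .wall a => if IsHead head a then .top a.1 else .bot a.1
        | .post a => .post (around L₁ L₀ a)
      left_inv := by
        rintro (e | e | a | a)
        · simp [elemFace, IsHead]
        · simp [elemFace, IsHead]
        · by_cases h : IsHead head a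
          · simp [elemFace, h, eq_head_of_isHead h]
          · simp [elemFace, h, eq_tail_of_not_isHead h]
        · simp [elemFace, around_around]
      right_inv := by
        rintro (e | e | a | a)
        · simp [elemFace, IsHead]
        · simp [elemFace, IsHead]
        · by_cases h : IsHead head a
          · simp [elemFace, h, eq_head_of_isHead h]
          · simp [elemFace, h, eq_tail_of_not_isHead h]
        · simp [elemFace, around_around] }
  glue := elemGlue
  side
    | Sum.inl e => .bot e
    | Sum.inr e => .top e
  glue_side := by rintro (e | e) <;> rfl
  side_glue := by
    rintro (e | e | a | a) l h <;> simp [elemGlue] at h <;> subst h <;> rfl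
  glue_symm := by
    rintro (e | e | a | a) d' h <;> simp [elemGlue] at h <;> subst h <;> rfl
  glue_ne := by
    rintro (e | e | a | a) h <;> simp [elemGlue] at h
  corner := by
    have key : ∀ (a : E × Bool) (m : E ⊕ E),
        (if IsHead head (around L₀ L₁ a) then (Sum.inl (around L₀ L₁ a).1 : E ⊕ E)
          else Sum.inr (around L₀ L₁ a).1) = m →
        Turn (elemFace L₀ L₁) (elemGlue (E := E)) (.wall a) m := by
      intro a m hm
      refine Turn.step _ (.post a) _ rfl (Turn.step _ (.wall (around L₀ L₁ a)) _ rfl ?_)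
      subst hm
      by_cases h : IsHead head (around L₀ L₁ a)
      · exact Turn.here _ _ (by simp [elemFace, h, elemGlue])
      · exact Turn.here _ _ (by simp [elemFace, h, elemGlue])
    rintro (e | e)
    · refine key (e, !(head e)) _ ?_
      have he : ¬ IsHead head (e, !(head e)) := by simp [IsHead]
      rcases hl : L₀.link (e, !(head e)) with b | y
      · have hb : IsHead head b := (L₀.orient _ b hl).2 he
        simp [around, he, hl, hb, bnext]
      · have hb : ¬ IsHead head (L₁.att y) := by
          rw [L₁.isHead_att_iff L₀, L₀.att_link _ _ hl]; exact he
        simp [around, he, hl, hb, bnext]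
    · refine key (e, head e) _ ?_
      have he : IsHead head (e, head e) := by simp [IsHead]
      rcases hl : L₁.link (e, head e) with b | y
      · have hb : ¬ IsHead head b := fun h => (L₁.orient _ b hl).1 h he
        simp [around, he, hl, hb, bnext]
      · have hb : IsHead head (L₀.att y) := by
          rw [L₀.isHead_att_iff L₁, L₁.att_link _ _ hl]; exact he
        simp [around, he, hl, hb, bnext]

end Elementary

/-- The product `W × [0,1]`. -/
def cylinder {Y₀ Y₁ : OrientedPoints} (W : OneCob Y₀ Y₁) : Bord W W :=
  elementary W.linking W.linking

/-! ### The category of cobordisms -/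

/-- Elementary diffeomorphisms of `2`-bordisms relative to the boundary: relabelling of the
sides, subdivision of an interior edge, cutting a polygon into two along a chord, attaching a
collar, and what these induce on glued surfaces.  Two polygonal surfaces are diffeomorphic
relative to the boundary if and only if they are related by finitely many such steps and
their inverses. -/
inductive Bord.Step {Y₀ Y₁ : OrientedPoints} :
    ∀ {W₀ W₁ : OneCob Y₀ Y₁}, Bord W₀ W₁ → Bord W₀ W₁ → Prop
  | relabel {W₀ W₁ : OneCob Y₀ Y₁} (S T : Bord W₀ W₁) (e : S.Dart ≃ T.Dart)
      (hface : ∀ d, T.face (e d) = e (S.face d))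
      (hglue : ∀ d, T.glue (e d) = (S.glue d).map e id) : Bord.Step S T
  | subdivide {W₀ W₁ : OneCob Y₀ Y₁} (S : Bord W₀ W₁) (d d' : S.Dart)
      (h : S.glue d = Sum.inl d') : Bord.Step S (S.subdivide d d' h)
  | cut {W₀ W₁ : OneCob Y₀ Y₁} (S : Bord W₀ W₁) (u v : S.Dart)
      (h : S.face.SameCycle u v) : Bord.Step S (S.addEdge u v)
  | collar_left {W₀ W₁ : OneCob Y₀ Y₁} (S : Bord W₀ W₁) : Bord.Step ((cylinder W₀).comp S) S
  | collar_right {W₀ W₁ : OneCob Y₀ Y₁} (S : Bord W₀ W₁) : Bord.Step (S.comp (cylinder W₁)) S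
  | comp_left {W₀ W₁ W₂ : OneCob Y₀ Y₁} (S : Bord W₀ W₁) (T T' : Bord W₁ W₂)
      (h : Bord.Step T T') : Bord.Step (S.comp T) (S.comp T')
  | comp_right {W₀ W₁ W₂ : OneCob Y₀ Y₁} (S S' : Bord W₀ W₁) (T : Bord W₁ W₂)
      (h : Bord.Step S S') : Bord.Step (S.comp T) (S'.comp T)

/-- The diffeomorphism classes of `2`-bordisms: classes for the equivalence relation generated by
`Bord.Step`. -/
def BordClass {Y₀ Y₁ : OrientedPoints} (W₀ W₁ : OneCob Y₀ Y₁) : Type 1 :=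
  Quot (Bord.Step (W₀ := W₀) (W₁ := W₁))

/-- The diffeomorphism class of a `2`-bordism. -/
def Bord.cls {Y₀ Y₁ : OrientedPoints} {W₀ W₁ : OneCob Y₀ Y₁} (S : Bord W₀ W₁) :
    BordClass W₀ W₁ := Quot.mk _ S

lemma Bord.compGlue_assoc {Y₀ Y₁ : OrientedPoints} {W₀ W₁ W₂ W₃ : OneCob Y₀ Y₁}
    (S : Bord W₀ W₁) (T : Bord W₁ W₂) (U : Bord W₂ W₃) (d : (S.Dart ⊕ T.Dart) ⊕ U.Dart) :
    (S.comp (T.comp U)).glue (Equiv.sumAssoc S.Dart T.Dart U.Dart d) =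
      (((S.comp T).comp U).glue d).map (Equiv.sumAssoc S.Dart T.Dart U.Dart) id := by
  rcases d with (d | d) | d
  · change Bord.compGlue S (T.comp U) (Sum.inl d) = Sum.map _ id
      (Bord.compGlue (S.comp T) U (Sum.inl (Sum.inl d)))
    rcases h : S.glue d with a | e | e <;>
      simp only [Bord.comp, Bord.compGlue, Bord.compSide, h] <;> rfl
  · change Bord.compGlue S (T.comp U) (Sum.inr (Sum.inl d)) = Sum.map _ id
      (Bord.compGlue (S.comp T) U (Sum.inl (Sum.inr d)))
    rcases h : T.glue d with a | e | e <;>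
      simp only [Bord.comp, Bord.compGlue, h] <;> rfl
  · change Bord.compGlue S (T.comp U) (Sum.inr (Sum.inr d)) = Sum.map _ id
      (Bord.compGlue (S.comp T) U (Sum.inr d))
    rcases h : U.glue d with a | e | e <;>
      simp only [Bord.comp, Bord.compGlue, Bord.compSide, h] <;> rfl

/-- The category `Cob₂(Y₀, Y₁)`: cobordisms `Y₀ → Y₁` and diffeomorphism classes of
`2`-bordisms, with gluing as composition. -/
instance oneCobCategory (Y₀ Y₁ : OrientedPoints) : Category.{1, 1} (OneCob Y₀ Y₁) where
  Hom W₀ W₁ := BordClass W₀ W₁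
  id W := (cylinder W).cls
  comp f g := Quot.map₂ Bord.comp (fun S _ _ h => Bord.Step.comp_left S _ _ h)
    (fun _ _ T h => Bord.Step.comp_right _ _ T h) f g
  id_comp := by
    rintro W₀ W₁ ⟨S⟩
    exact Quot.sound (Bord.Step.collar_left S)
  comp_id := by
    rintro W₀ W₁ ⟨S⟩
    exact Quot.sound (Bord.Step.collar_right S)
  assoc := by
    rintro W₀ W₁ W₂ W₃ ⟨S⟩ ⟨T⟩ ⟨U⟩
    refine Quot.sound (Bord.Step.relabel _ _ (Equiv.sumAssoc _ _ _) ?_ ?_)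
    · rintro ((d | d) | d) <;> rfl
    · exact Bord.compGlue_assoc S T U

/-- A `2`-bordism as a morphism of the `k`-linear category `kCob₂(Y₀, Y₁)`. -/
noncomputable def Bord.lin (k : Type*) [CommRing k] {Y₀ Y₁ : OrientedPoints}
    {W₀ W₁ : OneCob Y₀ Y₁} (S : Bord W₀ W₁) : Free.of k W₀ ⟶ Free.of k W₁ :=
  Finsupp.single S.cls 1

/-- The two-sided ideal of the category `kCob₂(Y₀, Y₁)` generated by the relations
`(S)`: `S ⊔ S² = 0`, `(T)`: `S ⊔ T² = 2 S`, and `(4Tu)`: if `u₁, u₂, u₃, u₄` are sides of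
four different polygons of `S`, and `Sᵢⱼ` is `S` with a tube joining the polygons (discs) of
`uᵢ` and `uⱼ`, then `S₁₂ + S₃₄ = S₁₃ + S₂₄`. -/
inductive Ideal4Tu (k : Type*) [CommRing k] {Y₀ Y₁ : OrientedPoints} :
    ∀ {W₀ W₁ : Free k (OneCob Y₀ Y₁)}, (W₀ ⟶ W₁) → Prop
  | sphere {W₀ W₁ : OneCob Y₀ Y₁} (S : Bord W₀ W₁) : Ideal4Tu k ((S.addClosed sphere).lin k)
  | torus {W₀ W₁ : OneCob Y₀ Y₁} (S : Bord W₀ W₁) :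
      Ideal4Tu k ((S.addClosed torus).lin k - (2 : k) • S.lin k)
  | tubes {W₀ W₁ : OneCob Y₀ Y₁} (S : Bord W₀ W₁) (u : Fin 4 → S.Dart)
      (h : ∀ i j, i ≠ j → ¬ S.face.SameCycle (u i) (u j)) :
      Ideal4Tu k ((S.addEdge (u 0) (u 1)).lin k + (S.addEdge (u 2) (u 3)).lin k
        - (S.addEdge (u 0) (u 2)).lin k - (S.addEdge (u 1) (u 3)).lin k)
  | zero {W₀ W₁ : Free k (OneCob Y₀ Y₁)} : Ideal4Tu k (0 : W₀ ⟶ W₁)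
  | add {W₀ W₁ : Free k (OneCob Y₀ Y₁)} (f g : W₀ ⟶ W₁) :
      Ideal4Tu k f → Ideal4Tu k g → Ideal4Tu k (f + g)
  | smul {W₀ W₁ : Free k (OneCob Y₀ Y₁)} (a : k) (f : W₀ ⟶ W₁) :
      Ideal4Tu k f → Ideal4Tu k (a • f)
  | comp_left {W₀ W₁ W₂ : Free k (OneCob Y₀ Y₁)} (f : W₀ ⟶ W₁) (g : W₁ ⟶ W₂) :
      Ideal4Tu k g → Ideal4Tu k (f ≫ g)
  | comp_right {W₀ W₁ W₂ : Free k (OneCob Y₀ Y₁)} (f : W₀ ⟶ W₁) (g : W₁ ⟶ W₂) :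
      Ideal4Tu k f → Ideal4Tu k (f ≫ g)

/-- Congruence modulo the relations `(S)`, `(T)` and `(4Tu)`. -/
def rel4Tu (k : Type*) [CommRing k] (Y₀ Y₁ : OrientedPoints) :
    HomRel (Free k (OneCob Y₀ Y₁)) :=
  fun _ _ f g => Ideal4Tu k (f - g)

instance (k : Type*) [CommRing k] (Y₀ Y₁ : OrientedPoints) : Congruence (rel4Tu k Y₀ Y₁) where
  comp_left f g g' h := by
    have := Ideal4Tu.comp_left f _ h
    rwa [Preadditive.comp_sub] at this
  comp_right g h := by
    have := Ideal4Tu.comp_right _ g h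
    rwa [Preadditive.sub_comp] at this
  equivalence :=
    { refl := fun f => by
        simp only [rel4Tu, sub_self]
        exact Ideal4Tu.zero
      symm := fun {f g} h => by
        have := Ideal4Tu.smul (-1 : k) _ h
        simpa [rel4Tu] using this
      trans := fun {f g h} h₁ h₂ => by
        have := Ideal4Tu.add _ _ h₁ h₂
        simpa [rel4Tu] using this }

/-- The `k`-linear category `kCob₂(Y₀, Y₁) / (S, T, 4Tu)`; its additive closure is
`Mat_ (KCob k Y₀ Y₁)`. -/
abbrev KCob (k : Type*) [CommRing k] (Y₀ Y₁ : OrientedPoints) :=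
  Quotient (rel4Tu k Y₀ Y₁)

lemma rel4Tu_add (k : Type*) [CommRing k] (Y₀ Y₁ : OrientedPoints)
    ⦃X Y : Free k (OneCob Y₀ Y₁)⦄ (f₁ f₂ g₁ g₂ : X ⟶ Y) (h₁ : rel4Tu k Y₀ Y₁ f₁ f₂)
    (h₂ : rel4Tu k Y₀ Y₁ g₁ g₂) : rel4Tu k Y₀ Y₁ (f₁ + g₁) (f₂ + g₂) := by
  have := Ideal4Tu.add _ _ h₁ h₂
  simp only [rel4Tu]
  rwa [add_sub_add_comm]

lemma rel4Tu_smul (k : Type*) [CommRing k] (Y₀ Y₁ : OrientedPoints) (a : k)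
    ⦃X Y : Free k (OneCob Y₀ Y₁)⦄ (f₁ f₂ : X ⟶ Y) (h : rel4Tu k Y₀ Y₁ f₁ f₂) :
    rel4Tu k Y₀ Y₁ (a • f₁) (a • f₂) := by
  have := Ideal4Tu.smul a _ h
  simp only [rel4Tu]
  rwa [← smul_sub]

noncomputable instance (k : Type*) [CommRing k] (Y₀ Y₁ : OrientedPoints) :
    Preadditive (KCob k Y₀ Y₁) :=
  Quotient.preadditive _ (rel4Tu_add k Y₀ Y₁)

instance (k : Type*) [CommRing k] (Y₀ Y₁ : OrientedPoints) :
    (Quotient.functor (rel4Tu k Y₀ Y₁)).Additive :=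
  Quotient.functor_additive _ (rel4Tu_add k Y₀ Y₁)

noncomputable instance (k : Type*) [CommRing k] (Y₀ Y₁ : OrientedPoints) :
    Linear k (KCob k Y₀ Y₁) :=
  Quotient.linear k _ (rel4Tu_smul k Y₀ Y₁)

/-- A cobordism as an object of `kCob₂(Y₀, Y₁) / (S, T, 4Tu)`. -/
noncomputable def OneCob.obj (k : Type*) [CommRing k] {Y₀ Y₁ : OrientedPoints} (W : OneCob Y₀ Y₁) :
    KCob k Y₀ Y₁ :=
  (Quotient.functor (rel4Tu k Y₀ Y₁)).obj (Free.of k W)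

/-- A `2`-bordism as a morphism of `kCob₂(Y₀, Y₁) / (S, T, 4Tu)`. -/
noncomputable def Bord.mor (k : Type*) [CommRing k] {Y₀ Y₁ : OrientedPoints}
    {W₀ W₁ : OneCob Y₀ Y₁} (S : Bord W₀ W₁) : W₀.obj k ⟶ W₁.obj k :=
  (Quotient.functor (rel4Tu k Y₀ Y₁)).map (S.lin k)

/-- A morphism is homogeneous of Euler degree `q` if it is represented by a linear combination of
`2`-bordisms of degree `q`. -/
def IsHomogeneous {k : Type*} [CommRing k] {Y₀ Y₁ : OrientedPoints} {W₀ W₁ : OneCob Y₀ Y₁}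
    (f : W₀.obj k ⟶ W₁.obj k) (q : ℚ) : Prop :=
  f ∈ Submodule.span k {g | ∃ S : Bord W₀ W₁, S.degree = q ∧ g = S.mor k}

/-- Attach a `1`-handle to the polygon of the side `u`: cut off a one-sided polygon at the corner
following `u`, and join it by a tube to the polygon from which it was cut. -/
noncomputable def Bord.addHandle {Y₀ Y₁ : OrientedPoints} {W₀ W₁ : OneCob Y₀ Y₁}
    (S : Bord W₀ W₁) (u : S.Dart) : Bord W₀ W₁ :=
  (S.addEdge u u).addEdge (Sum.inr true) (Sum.inr false)

/-! ### Tangle diagrams -/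

/-- The four corners at a crossing, drawn so that both strands go up. -/
inductive Corner : Type
  | SW
  | SE
  | NE
  | NW

/-- The four sectors at a crossing, drawn so that both strands go up. -/
inductive Sector : Type
  | south
  | east
  | north
  | west

/-- The strands come in at the two lower corners. -/
def Corner.isIn : Corner → Bool
  | SW => true
  | SE => true
  | NE => false
  | NW => false

/-- The sector to the left of the strand passing through a corner. -/
def Corner.left : Corner → Sector
  | SW => .west
  | SE => .south
  | NE => .north
  | NW => .west

/-- The sector to the right of the strand passing through a corner. -/
def Corner.right : Corner → Sector
  | SW => .south
  | SE => .east
  | NE => .east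
  | NW => .north

/-- The two smoothings of a crossing drawn with both strands going up: `V` consists of the two
vertical arcs `)(`, and `H` of the two horizontal arcs. -/
inductive Smoothing : Type
  | V
  | H

/-- The corner joined to a given corner by a smoothing. -/
def Smoothing.partner : Smoothing → Corner → Corner
  | V, .SW => .NW
  | V, .NW => .SW
  | V, .SE => .NE
  | V, .NE => .SE
  | H, .SW => .SE
  | H, .SE => .SW
  | H, .NW => .NE
  | H, .NE => .NW

/-- The plane graph underlying an oriented tangle diagram, recorded by the data of a planar diagram
code: its oriented edges (`(e, true)` is the target of the edge `e`, and `(e, false)`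
its source), its four-valent vertices (double points of the projection), bivalent vertices
`Joint` (for instance on components without crossings), its end points on the lower and on
the upper boundary line, and the regions of the complement with their adjacencies.
(No use is made of planarity itself, which is therefore not required.) -/
structure TangleShadow where
  Edge : Type
  Crossing : Type
  Joint : Type
  Bot : Type
  Top : Type
  Region : Type
  [finEdge : Finite Edge]
  [fintypeCrossing : Fintype Crossing]
  [orderCrossing : LinearOrder Crossing]
  [finBot : Finite Bot]
  [finTop : Finite Top]
  ends : Edge × Bool ≃ (Crossing × Corner) ⊕ ((Joint × Bool) ⊕ (Bot ⊕ Top))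
  dir_crossing : ∀ x q, (ends.symm (Sum.inl (x, q))).2 = q.isIn
  dir_joint : ∀ j b, (ends.symm (Sum.inr (Sum.inl (j, b)))).2 = b
  left : Edge → Region
  right : Edge → Region
  sector : Crossing → Sector → Region
  left_crossing : ∀ x q, left (ends.symm (Sum.inl (x, q))).1 = sector x q.left
  right_crossing : ∀ x q, right (ends.symm (Sum.inl (x, q))).1 = sector x q.right
  left_joint : ∀ j, left (ends.symm (Sum.inr (Sum.inl (j, true)))).1 =
    left (ends.symm (Sum.inr (Sum.inl (j, false)))).1
  right_joint : ∀ j, right (ends.symm (Sum.inr (Sum.inl (j, true)))).1 =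
    right (ends.symm (Sum.inr (Sum.inl (j, false)))).1

attribute [instance] TangleShadow.finEdge TangleShadow.fintypeCrossing
  TangleShadow.orderCrossing TangleShadow.finBot TangleShadow.finTop

/-- A checkerboard colouring of the regions; adjacent regions have different colours. -/
structure Coloring (P : TangleShadow) where
  black : P.Region → Bool
  proper : ∀ e, black (P.left e) ≠ black (P.right e)

/-- What is drawn at a double point: a positive crossing, a negative crossing, or (in a diagram
some crossings of which have been smoothed) a smoothing. -/
inductive Kind : Type
  | pos
  | neg
  | smooth (r : Smoothing)

/-- Whether there is a crossing. -/
def Kind.isCrossing : Kind → Bool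
  | pos => true
  | neg => true
  | smooth _ => false

/-- The smoothing at a double point for a state `s`, where `b` says whether the point lies in `s`.
The `0`-smoothing of a negative crossing is `H` and its `1`-smoothing is `V`; it is the other way
round for a positive crossing. -/
def Kind.resolve : Kind → Bool → Smoothing
  | pos, b => if b then .H else .V
  | neg, b => if b then .V else .H
  | smooth r, _ => r

/-- The sign of `(∧ a) : E_A → E_{A ∪ {a}}`. -/
def wedgeSign {C : Type} [LinearOrder C] (A : Finset C) (a : C) : ℤ :=
  if a ∈ A then 0 else (-1) ^ (A.filter (fun b => b < a)).card

/-- The sign of `ǎ : E_A → E_{A \ {a}}`. -/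
def checkSign {C : Type} [LinearOrder C] (A : Finset C) (a : C) : ℤ :=
  if a ∈ A then (-1) ^ (A.filter (fun b => b < a)).card else 0

namespace TangleShadow

variable (P : TangleShadow) (χ : Coloring P)

/-- The smoothings `D_s` are oriented as boundaries of the black regions, that is with the black
regions on the left: the head of `e` is its target if the region to its left is black. -/
def head (e : P.Edge) : Bool := χ.black (P.left e)

/-- The oriented `0`-manifold `∂⁻D`. -/
def bottom : OrientedPoints where
  pt := P.Bot
  sign y := !decide (IsHead (P.head χ) (P.ends.symm (Sum.inr (Sum.inr (Sum.inl y)))))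

/-- The oriented `0`-manifold `∂⁺D`. -/
def top : OrientedPoints where
  pt := P.Top
  sign y := decide (IsHead (P.head χ) (P.ends.symm (Sum.inr (Sum.inr (Sum.inr y)))))

/-- How the ends of the edges are joined after smoothing. -/
def opposite (σ : P.Crossing → Smoothing) :
    (P.Crossing × Corner) ⊕ ((P.Joint × Bool) ⊕ (P.Bot ⊕ P.Top)) →
    ((P.Crossing × Corner) ⊕ ((P.Joint × Bool) ⊕ (P.Bot ⊕ P.Top))) ⊕ (P.Bot ⊕ P.Top)
  | Sum.inl (x, q) => Sum.inl (Sum.inl (x, (σ x).partner q))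
  | Sum.inr (Sum.inl (j, b)) => Sum.inl (Sum.inr (Sum.inl (j, !b)))
  | Sum.inr (Sum.inr y) => Sum.inr y

lemma isHead_crossing (x : P.Crossing) (q : Corner) :
    IsHead (P.head χ) (P.ends.symm (Sum.inl (x, q))) ↔
      q.isIn = χ.black (P.sector x q.left) := by
  simp only [IsHead, head, P.dir_crossing, P.left_crossing]

lemma isHead_partner (x : P.Crossing) (r : Smoothing) (q : Corner) :
    IsHead (P.head χ) (P.ends.symm (Sum.inl (x, r.partner q))) ↔
      ¬ IsHead (P.head χ) (P.ends.symm (Sum.inl (x, q))) := by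
  have h : ∀ q : Corner, χ.black (P.sector x q.left) ≠ χ.black (P.sector x q.right) := by
    intro q
    have := χ.proper (P.ends.symm (Sum.inl (x, q))).1
    rwa [P.left_crossing, P.right_crossing] at this
  have h1 := h .SW
  have h2 := h .SE
  have h3 := h .NE
  have h4 := h .NW
  simp only [isHead_crossing]
  cases r <;> cases q <;>
    simp only [Corner.left, Corner.right, Corner.isIn, Smoothing.partner] at h1 h2 h3 h4 ⊢ <;>
    grind

/-- The end joined to an end of an edge after smoothing, or the boundary point it is. -/
def link (σ : P.Crossing → Smoothing) (a : P.Edge × Bool) :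
    (P.Edge × Bool) ⊕ (P.Bot ⊕ P.Top) :=
  (P.opposite σ (P.ends a)).map P.ends.symm id

lemma link_crossing (σ : P.Crossing → Smoothing) (x : P.Crossing) (q : Corner) :
    P.link σ (P.ends.symm (Sum.inl (x, q))) =
      Sum.inl (P.ends.symm (Sum.inl (x, (σ x).partner q))) := by
  simp [link, opposite]

lemma link_joint (σ : P.Crossing → Smoothing) (j : P.Joint) (b : Bool) :
    P.link σ (P.ends.symm (Sum.inr (Sum.inl (j, b)))) =
      Sum.inl (P.ends.symm (Sum.inr (Sum.inl (j, !b)))) := by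
  simp [link, opposite]

lemma link_boundary (σ : P.Crossing → Smoothing) (y : P.Bot ⊕ P.Top) :
    P.link σ (P.ends.symm (Sum.inr (Sum.inr y))) = Sum.inr y := by
  simp [link, opposite]

lemma link_att (σ : P.Crossing → Smoothing) (a : P.Edge × Bool) (y : P.Bot ⊕ P.Top)
    (h : P.link σ a = Sum.inr y) : P.ends.symm (Sum.inr (Sum.inr y)) = a := by
  obtain ⟨v, rfl⟩ := P.ends.symm.surjective a
  rcases v with ⟨x, q⟩ | ⟨j, b⟩ | z
  · simp [link_crossing] at h
  · simp [link_joint] at h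
  · rw [link_boundary] at h
    rw [Sum.inr.inj h]

lemma link_link (σ : P.Crossing → Smoothing) (a b : P.Edge × Bool)
    (h : P.link σ a = Sum.inl b) : P.link σ b = Sum.inl a := by
  obtain ⟨v, rfl⟩ := P.ends.symm.surjective a
  rcases v with ⟨x, q⟩ | ⟨j, b⟩ | z
  · rw [link_crossing] at h
    rw [← Sum.inl.inj h, link_crossing]
    cases σ x <;> cases q <;> rfl
  · rw [link_joint] at h
    rw [← Sum.inl.inj h, link_joint, Bool.not_not]
  · simp [link_boundary] at h

lemma link_orient (σ : P.Crossing → Smoothing) (a b : P.Edge × Bool)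
    (h : P.link σ a = Sum.inl b) : IsHead (P.head χ) b ↔ ¬ IsHead (P.head χ) a := by
  obtain ⟨v, rfl⟩ := P.ends.symm.surjective a
  rcases v with ⟨x, q⟩ | ⟨j, b⟩ | z
  · rw [link_crossing] at h
    rw [← Sum.inl.inj h]
    exact P.isHead_partner χ x (σ x) q
  · rw [link_joint] at h
    rw [← Sum.inl.inj h]
    have := P.left_joint j
    simp only [IsHead, head, P.dir_joint]
    cases b <;> simp [this]
  · simp [link_boundary] at h

/-- The smoothed diagram, as a `1`-manifold glued from the edges. -/
def linking (σ : P.Crossing → Smoothing) :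
    Linking (P.bottom χ) (P.top χ) P.Edge (P.head χ) where
  link := P.link σ
  att y := P.ends.symm (Sum.inr (Sum.inr y))
  link_att y := P.link_boundary σ y
  att_link a y h := P.link_att σ a y h
  link_symm a b h := P.link_link σ a b h
  orient a b h := P.link_orient χ σ a b h
  orient_bot y := by
    change _ ↔ (!decide (IsHead (P.head χ) (P.ends.symm (Sum.inr (Sum.inr (Sum.inl y)))))) = false
    rw [Bool.not_eq_false', decide_eq_true_eq]
    exact Iff.rfl
  orient_top y := by
    change _ ↔ (decide (IsHead (P.head χ) (P.ends.symm (Sum.inr (Sum.inr (Sum.inr y)))))) = true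
    rw [decide_eq_true_eq]
    exact Iff.rfl

/-- The object `D_s` of `Cob₂(∂⁻D, ∂⁺D)` for the smoothings `σ` of the crossings. -/
abbrev smoothed (σ : P.Crossing → Smoothing) : OneCob (P.bottom χ) (P.top χ) :=
  OneCob.mk P.Edge (P.head χ) (P.linking χ σ)

/-- The `2`-bordism between two smoothings which is a saddle at the crossings where they differ and
the product with `[0,1]` elsewhere. -/
abbrev saddle (σ τ : P.Crossing → Smoothing) : Bord (P.smoothed χ σ) (P.smoothed χ τ) :=
  elementary (P.linking χ σ) (P.linking χ τ)

/-- The side of the bigon lying over the left arc (through `SW`) or the right arc (through `SE`)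
of the smoothing `V` of a crossing. -/
def post (c : P.Crossing) (q : Corner) : ElemDart P.Edge :=
  .post (P.ends.symm (Sum.inl (c, q)))

/-- The first cobordism `)( → )(` of the morphism `Φ`: the two vertical sheets, joined by a tube
(when both `σ` and `τ` are `V` at `c`). -/
noncomputable def tubeBord (σ τ : P.Crossing → Smoothing) (c : P.Crossing) :
    Bord (P.smoothed χ σ) (P.smoothed χ τ) :=
  (P.saddle χ σ τ).addEdge (P.post c .SW) (P.post c .SE)

/-- The second cobordism `)( → )(` of the morphism `Φ`: the two vertical sheets, the left one
having a `1`-handle attached (when both `σ` and `τ` are `V` at `c`). -/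
noncomputable def handleBord (σ τ : P.Crossing → Smoothing) (c : P.Crossing) :
    Bord (P.smoothed χ σ) (P.smoothed χ τ) :=
  (P.saddle χ σ τ).addHandle (P.post c .SW)

/-! ### The universal bracket complex -/

variable (k : Type*) [CommRing k] (κ κ' : P.Crossing → Kind) (c : P.Crossing)

/-- The set `c(D)` of crossings of the diagram `D = (P, κ)`. -/
def crossings : Finset P.Crossing := Finset.univ.filter (fun x => (κ x).isCrossing = true)

/-- The states with `i` elements. -/
abbrev State (i : ℤ) : Type :=
  {s : Finset P.Crossing // s ⊆ P.crossings κ ∧ (s.card : ℤ) = i}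

/-- The smoothings of the crossings according to a state. -/
def res (s : Finset P.Crossing) (x : P.Crossing) : Smoothing := (κ x).resolve (decide (x ∈ s))

/-- The object `⟦D⟧ⁱ`, the sum of `D_s ⊗ E_s` over all states `s` with `i` elements. -/
noncomputable abbrev bracketX (i : ℤ) : Mat_ (KCob k (P.bottom χ) (P.top χ)) where
  ι := P.State κ i
  X s := (P.smoothed χ (P.res κ s.1)).obj k

/-- The differential of `⟦D⟧`, the sum of `S_{s;a} ⊗ (∧ a)` over all `a ∈ c(D) \ s`. -/
noncomputable def bracketD (i j : ℤ) : P.bracketX χ k κ i ⟶ P.bracketX χ k κ j :=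
  fun s t => ∑ a ∈ P.crossings κ \ s.1,
    if t.1 = insert a s.1 then
      wedgeSign s.1 a • (P.saddle χ (P.res κ s.1) (P.res κ t.1)).mor k
    else 0

lemma bracketD_shape (i j : ℤ) (h : i + 1 ≠ j) : P.bracketD χ k κ i j = 0 := by
  ext s t
  change ∑ a ∈ P.crossings κ \ s.1, _ = 0
  refine Finset.sum_eq_zero fun a ha => if_neg fun hst => h ?_
  rw [← s.2.2, ← t.2.2, hst, Finset.card_insert_of_notMem (Finset.mem_sdiff.1 ha).2]
  push_cast
  ring

/-- The differential squares to zero. -/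
def IsComplex : Prop :=
  ∀ i j l : ℤ, P.bracketD χ k κ i j ≫ P.bracketD χ k κ j l = 0

/-- The universal bracket complex `⟦D⟧`. -/
noncomputable def bracket (h : P.IsComplex χ k κ) :
    CochainComplex (Mat_ (KCob k (P.bottom χ) (P.top χ))) ℤ where
  X := P.bracketX χ k κ
  d := P.bracketD χ k κ
  shape i j hij := P.bracketD_shape χ k κ i j hij
  d_comp_d' i j l _ _ := h i j l

/-- The morphism `⟦D⟧ⁱ → ⟦D'⟧ʲ` between two diagrams which have crossings in the same places up to
smoothing, consisting of the products with `[0,1]` or saddles `D_s → D'_s`,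
for the states `s` of both diagrams. -/
noncomputable def saddleMap (i j : ℤ) : P.bracketX χ k κ i ⟶ P.bracketX χ k κ' j :=
  fun s t => if t.1 = s.1 then (P.saddle χ (P.res κ s.1) (P.res κ' t.1)).mor k else 0

/-- The morphism `Φ` induced by the first cobordism minus the second one at the double point `c`,
where `D` has been given the smoothing `V`. -/
noncomputable def phiMap (i j : ℤ) : P.bracketX χ k κ i ⟶ P.bracketX χ k κ j :=
  fun s t => if t.1 = s.1 then
    (P.tubeBord χ (P.res κ s.1) (P.res κ t.1) c).mor k
      - (P.handleBord χ (P.res κ s.1) (P.res κ t.1) c).mor k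
    else 0

/-- The morphism given by the first cobordism minus the second one, each `⊗ č`, from the summands
`s` with `c ∈ s` (at which a negative crossing `c` has the smoothing `V`) to the summands `s \ {c}`
(at which a positive crossing `c` has the smoothing `V`), and by zero elsewhere. -/
noncomputable def phiHatMap (i j : ℤ) : P.bracketX χ k κ i ⟶ P.bracketX χ k κ' j :=
  fun s t => if t.1 = s.1.erase c then
    checkSign s.1 c • (P.tubeBord χ (P.res κ s.1) (P.res κ' t.1) c).mor k
      - checkSign s.1 c • (P.handleBord χ (P.res κ s.1) (P.res κ' t.1) c).mor k
    else 0

/-- The morphism `id ⊗ (∧ c)`, from the diagram with `c` replaced by its `1`-smoothing to the one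
with the crossing `c`. -/
noncomputable def wedgeMap (i j : ℤ) : P.bracketX χ k κ i ⟶ P.bracketX χ k κ' j :=
  fun s t => if t.1 = insert c s.1 then
    wedgeSign s.1 c • (P.saddle χ (P.res κ s.1) (P.res κ' t.1)).mor k
    else 0

/-! ### Bigradings -/

/-- The number of positive crossings. -/
noncomputable def numPos : ℕ := Nat.card {x : P.Crossing // κ x = Kind.pos}

/-- The number of negative crossings. -/
noncomputable def numNeg : ℕ := Nat.card {x : P.Crossing // κ x = Kind.neg}

/-- The homological degree of the summand `D_s ⊗ E_s` in the Khovanov complex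
`⟦D⟧[-n₋]`. -/
noncomputable def homDegree (s : Finset P.Crossing) : ℤ := (s.card : ℤ) - P.numNeg κ

/-- The quantum degree shift of the summand `D_s ⊗ E_s` in the Khovanov complex. -/
noncomputable def quantumDegree (s : Finset P.Crossing) : ℤ :=
  (s.card : ℤ) + P.numPos κ - 2 * P.numNeg κ

/-- A morphism between sums of the `D_s ⊗ E_s` has bidegree `(a, b)`: its component
`D_s ⊗ E_s → D'_t ⊗ E_t` vanishes unless the homological degrees differ by `a`, and its
Euler degree plus the difference of the quantum degree shifts is `b`. -/
def HasBidegree {i j : ℤ} (f : P.bracketX χ k κ i ⟶ P.bracketX χ k κ' j) (a b : ℤ) : Prop :=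
  ∀ (s : P.State κ i) (t : P.State κ' j),
    (P.homDegree κ' t.1 - P.homDegree κ s.1 ≠ a → f s t = 0) ∧
    IsHomogeneous (f s t)
      ((b : ℚ) - ((P.quantumDegree κ' t.1 : ℚ) - (P.quantumDegree κ s.1 : ℚ)))

end TangleShadow

end GenusOne

open GenusOne

/-! The theorem rests on one fact about surfaces: a foot of a tube can be slid over the surface, and
a tube between two adjacent discs is a handle on either of them. At a crossing smoothed as `V`, the
map `Φ` is a tube between the two sheets minus a handle on the left sheet. Next to a saddle at that
crossing, before or after, the two sheets are connected through the saddle. The foot on the right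
sheet can then be carried across the saddle to the left sheet, where the tube becomes a handle, so
the difference vanishes (`cls_stack_addEdge_upper`, `cls_stack_addEdge_lower`). These are equalities
of diffeomorphism classes; the relations S, T and 4Tu are not needed.

Since bordisms are glued polygons and diffeomorphisms are generated by moves, each topological fact
is reduced to cutting, subdividing, relabelling and collars. The recurring argument is to add to
each of two surfaces an edge that merely cuts a polygon, and to check that the results agree up to
relabelling. This yields the sliding of a foot inside a polygon (`cls_addEdge_rotate`) and across an
edge (`cls_addEdge_cross`), and the comparison of tubes with handles (`cls_addHandle_of_adjacent`).

The second geometric input is `cls_elementary_comp`: two stacked elementary bordisms that change the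
links at different ends form a single elementary bordism. Saddles at different crossings therefore
commute, which gives `isComplex`. Together with the sliding of tubes and handles through a stack it
also shows that `Φ` commutes with saddles away from `c`.

The remaining work is algebra with matrices of bordisms, organised by `term`, and with the signs of
the exterior powers. In the chain map identity for the genus-one morphism, the part of the
differential at a crossing other than `c` is handled by commutation and anticommuting signs. At `c`
itself both composites vanish separately, because `Φ` is killed by the saddle on either side. For
the bidegree, a product with `[0,1]` has Euler degree 0, a tube or a handle lowers it by 2, and the
quantum shift rises by 2. -/

set_option linter.unusedSimpArgs false
set_option linter.unnecessarySeqFocus false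

namespace GenusOne

/-! ### Cycles of permutations of finite sets. -/

section Cycles

variable {D : Type} {f : Equiv.Perm D}

lemma sameCycle_apply (x : D) : f.SameCycle x (f x) := ⟨1, by simp⟩

lemma sameCycle_of_apply_eq {x y : D} (h : f x = y) : f.SameCycle x y := h ▸ sameCycle_apply x

lemma ne_of_not_sameCycle {u v : D} (h : ¬ f.SameCycle u v) : u ≠ v :=
  fun h' => h (h' ▸ Equiv.Perm.SameCycle.refl _ _)

/-- Induction along a cycle of a permutation of a finite set. -/
lemma sameCycle_induction [Finite D] {p : D → Prop} {x y : D} (h : f.SameCycle x y) (hx : p x)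
    (hs : ∀ z, f.SameCycle x z → p z → p (f z)) : p y := by
  obtain ⟨n, hn⟩ := h.exists_nat_pow_eq
  subst hn
  clear h
  induction n with
  | zero => simpa using hx
  | succ n ih =>
    rw [pow_succ', Equiv.Perm.mul_apply]
    exact hs _ ⟨n, by simp⟩ ih

/-- The map `i` need not commute with the permutations: it suffices that each step of `f` stays
within one cycle of `g`. This leaves room for new sides inserted between old ones. -/
lemma sameCycle_map [Finite D] {E : Type} {g : Equiv.Perm E} {i : D → E} {x y : D}
    (h : f.SameCycle x y)
    (hs : ∀ z, f.SameCycle x z → g.SameCycle (i z) (i (f z))) : g.SameCycle (i x) (i y) :=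
  sameCycle_induction (p := fun y => g.SameCycle (i x) (i y)) h (Equiv.Perm.SameCycle.refl _ _)
    fun z hz h' => h'.trans (hs z hz)

/-- An invariant labelling separates cycles; this is how sides are shown to lie in different
polygons. -/
lemma label_eq_of_sameCycle [Finite D] {Λ : Sort*} (lab : D → Λ) (hl : ∀ x, lab (f x) = lab x)
    {x y : D} (hxy : f.SameCycle x y) : lab x = lab y :=
  sameCycle_induction (p := fun y => lab x = lab y) hxy rfl fun z _ hz => hz.trans (hl z).symm

/-- Walking along a cycle, up to the first meeting with its end. -/
lemma sameCycle_map_of_walk [Finite D] {E : Type} {g : Equiv.Perm E} {i : D → E} {a b : D}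
    (h : f.SameCycle a b)
    (hs : ∀ z, f.SameCycle a z → z ≠ b → g.SameCycle (i z) (i (f z))) :
    g.SameCycle (i a) (i b) := by
  classical
  have hex := h.exists_nat_pow_eq
  -- `Nat.find` picks the first arrival at `b`, so every earlier point of the walk differs from `b`
  -- and the hypothesis on steps applies to it.
  have key : ∀ m ≤ Nat.find hex, g.SameCycle (i a) (i ((f ^ m) a)) := by
    intro m
    induction m with
    | zero => intro _; exact Equiv.Perm.SameCycle.refl _ _
    | succ m ih =>
      intro hm
      rw [pow_succ', Equiv.Perm.mul_apply]
      exact (ih (by omega)).trans (hs _ ⟨m, by simp⟩ (Nat.find_min hex (by omega)))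
  have := key _ le_rfl
  rwa [Nat.find_spec hex] at this

end Cycles

/-! ### The effect of a new edge on the polygons. -/

section AddEdge

open Bord

variable {D : Type} [Finite D] (f : Equiv.Perm D) (u v : D)

/-- The permutation `addEdgeFun`. -/
noncomputable def addEdgePerm : Equiv.Perm (D ⊕ Bool) :=
  Equiv.ofBijective _ (addEdgeFun_bijective f u v)

open Classical in
lemma addEdgePerm_inl (d : D) : addEdgePerm f u v (Sum.inl d) =
    if d = u then Sum.inr false else if d = v then Sum.inr true else Sum.inl (f d) := rfl

@[simp] lemma addEdgePerm_false : addEdgePerm f u v (Sum.inr false) = Sum.inl (f v) := rfl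

open Classical in
lemma addEdgePerm_inl_ne {d : D} (hd : f d ≠ d) : addEdgePerm f u v (Sum.inl d) ≠ Sum.inl d := by
  rw [addEdgePerm_inl]
  split_ifs <;> simp [hd]

open Classical in
lemma addEdgePerm_true : addEdgePerm f u v (Sum.inr true) =
    if u = v then Sum.inr true else Sum.inl (f u) := rfl

@[simp] lemma addEdgePerm_left : addEdgePerm f u v (Sum.inl u) = Sum.inr false := by
  simp [addEdgePerm_inl]

variable {u v}

lemma addEdgePerm_right (h : u ≠ v) : addEdgePerm f u v (Sum.inl v) = Sum.inr true := by
  simp [addEdgePerm_inl, h.symm]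

lemma addEdgePerm_other {d : D} (hu : d ≠ u) (hv : d ≠ v) :
    addEdgePerm f u v (Sum.inl d) = Sum.inl (f d) := by
  simp [addEdgePerm_inl, hu, hv]

variable {f}

lemma addEdgePerm_sameCycle_left : (addEdgePerm f u v).SameCycle (Sum.inl u) (Sum.inr false) :=
  sameCycle_of_apply_eq (by simp)

lemma addEdgePerm_sameCycle_right (h : u ≠ v) :
    (addEdgePerm f u v).SameCycle (Sum.inl v) (Sum.inr true) :=
  sameCycle_of_apply_eq (addEdgePerm_right f h)

/-- An edge between two cycles joins them. -/
lemma addEdgePerm_sameCycle_join (h : ¬ f.SameCycle u v) :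
    (addEdgePerm f u v).SameCycle (Sum.inl u) (Sum.inl v) := by
  -- After `inr false` the walk enters the cycle of `v` at `f v` and follows it up to its first
  -- arrival at `v`. It cannot be diverted at `u`, which lies on another cycle.
  refine addEdgePerm_sameCycle_left.trans ((sameCycle_of_apply_eq (addEdgePerm_false f u v)).trans
    (sameCycle_map_of_walk (i := Sum.inl) (sameCycle_apply (f := f) v).symm fun z hz hzv => ?_))
  refine sameCycle_of_apply_eq (addEdgePerm_other f (fun hzu => h ?_) hzv)
  exact hzu ▸ ((sameCycle_apply v).trans hz).symm

/-- A step out of `u` or `v` is diverted along the new edge, but both ends of the old step still lie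
on the merged cycle. -/
lemma addEdgePerm_sameCycle_inl (h : ¬ f.SameCycle u v) {a b : D} (hab : f.SameCycle a b) :
    (addEdgePerm f u v).SameCycle (Sum.inl a) (Sum.inl b) := by
  have huv := ne_of_not_sameCycle h
  refine sameCycle_map hab fun z _ => ?_
  by_cases hu : z = u
  · subst hu
    refine ((addEdgePerm_sameCycle_join h).trans (addEdgePerm_sameCycle_right huv)).trans
      (sameCycle_of_apply_eq ?_)
    simp [addEdgePerm_true, huv]
  · by_cases hv : z = v
    · subst hv
      exact ((addEdgePerm_sameCycle_join h).symm.trans addEdgePerm_sameCycle_left).trans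
        (sameCycle_of_apply_eq (addEdgePerm_false f u z))
    · exact sameCycle_of_apply_eq (addEdgePerm_other f hu hv)

/-- A loop only cuts off a one-sided polygon. For the forward direction, collapsing both new sides
to `u` keeps every step inside a cycle of `f`. -/
lemma addEdgePerm_self_sameCycle_inl_iff {a b : D} :
    (addEdgePerm f u u).SameCycle (Sum.inl a) (Sum.inl b) ↔ f.SameCycle a b := by
  constructor
  · intro h
    refine sameCycle_induction
      (p := fun d : D ⊕ Bool => f.SameCycle a (Sum.elim id (fun _ => u) d))
      h (Equiv.Perm.SameCycle.refl _ _) ?_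
    rintro (d | _ | _) _ hd
    · by_cases hu : d = u
      · subst hu; simpa using hd
      · simpa [addEdgePerm_other _ hu hu] using hd
    · simpa using hd
    · simpa [addEdgePerm_true] using hd
  · refine fun hab => sameCycle_map hab fun z _ => ?_
    by_cases hu : z = u
    · subst hu
      exact addEdgePerm_sameCycle_left.trans (sameCycle_of_apply_eq (addEdgePerm_false f z z))
    · exact sameCycle_of_apply_eq (addEdgePerm_other f hu hu)

lemma addEdgePerm_self_not_sameCycle_true {d : D ⊕ Bool} (hd : d ≠ Sum.inr true) :
    ¬ (addEdgePerm f u u).SameCycle (Sum.inr true) d := fun h =>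
  hd (sameCycle_induction (p := fun d => d = Sum.inr true) h rfl
    (by rintro d _ rfl; simp [addEdgePerm_true]))

end AddEdge

/-! ### Sliding tubes and handles over a polygonal surface. -/

namespace Bord

variable {Y₀ Y₁ : OrientedPoints} {W₀ W₁ W₂ : OneCob Y₀ Y₁}

lemma cls_eq_of_relabel {S T : Bord W₀ W₁} (f : S.Dart → T.Dart) (hf : Function.Bijective f)
    (hface : ∀ d, T.face (f d) = f (S.face d))
    (hglue : ∀ d, T.glue (f d) = (S.glue d).map f id) : S.cls = T.cls :=
  Quot.sound (Step.relabel S T (Equiv.ofBijective f hf) hface hglue)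

lemma cls_addEdge_of_sameCycle (S : Bord W₀ W₁) {u v : S.Dart} (h : S.face.SameCycle u v) :
    (S.addEdge u v).cls = S.cls :=
  (Quot.sound (Step.cut S u v h)).symm

lemma cls_subdivide (S : Bord W₀ W₁) (d d' : S.Dart) (h : S.glue d = Sum.inl d') :
    (S.subdivide d d' h).cls = S.cls :=
  (Quot.sound (Step.subdivide S d d' h)).symm

/-- The gluing map of `addEdge`. -/
def addEdgeGlue {D L : Type} (g : D → D ⊕ L) : D ⊕ Bool → (D ⊕ Bool) ⊕ L
  | Sum.inl d => (g d).map Sum.inl id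
  | Sum.inr b => Sum.inl (Sum.inr (!b))

variable (S : Bord W₀ W₁) {u v : S.Dart}

lemma addEdge_face (u v : S.Dart) : (S.addEdge u v).face = addEdgePerm S.face u v := rfl

lemma addEdge_glue (u v : S.Dart) : (S.addEdge u v).glue = addEdgeGlue S.glue := by
  ext d; rcases d with d | b <;> rfl

lemma cls_addEdge_eq_of_relabel {u v u' v' : S.Dart} (f : S.Dart ⊕ Bool → S.Dart ⊕ Bool)
    (hf : Function.Injective f)
    (hface : ∀ d, addEdgePerm S.face u' v' (f d) = f (addEdgePerm S.face u v d))
    (hglue : ∀ d, addEdgeGlue S.glue (f d) = (addEdgeGlue S.glue d).map f id) :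
    (S.addEdge u v).cls = (S.addEdge u' v').cls := by
  refine cls_eq_of_relabel (S := S.addEdge u v) (T := S.addEdge u' v') f
    (Finite.injective_iff_bijective.1 hf) hface fun d => ?_
  rw [addEdge_glue, addEdge_glue]
  exact hglue d

/-- The tool for all sliding moves: the first edge is the one of interest, the second a cut, and the
two enlarged surfaces are matched side by side. -/
lemma cls_addEdge_addEdge_eq_of_relabel {u v u' v' : S.Dart} {a b a' b' : S.Dart ⊕ Bool}
    (f : (S.Dart ⊕ Bool) ⊕ Bool → (S.Dart ⊕ Bool) ⊕ Bool)
    (hf : Function.Injective f)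
    (hface : ∀ d, addEdgePerm (addEdgePerm S.face u' v') a' b' (f d) =
      f (addEdgePerm (addEdgePerm S.face u v) a b d))
    (hglue : ∀ d, addEdgeGlue (addEdgeGlue S.glue) (f d) =
      (addEdgeGlue (addEdgeGlue S.glue) d).map f id) :
    ((S.addEdge u v).addEdge a b).cls = ((S.addEdge u' v').addEdge a' b').cls := by
  refine cls_eq_of_relabel (S := (S.addEdge u v).addEdge a b)
    (T := (S.addEdge u' v').addEdge a' b') f
    (Finite.injective_iff_bijective.1 hf) hface fun d => ?_
  have h : ∀ (u v : S.Dart) (a b : S.Dart ⊕ Bool) (d : (S.Dart ⊕ Bool) ⊕ Bool),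
      ((S.addEdge u v).addEdge a b).glue d = addEdgeGlue (addEdgeGlue S.glue) d := by
    rintro u v a b ((d | _) | _) <;> rfl
  exact (h u' v' a' b' (f d)).trans ((hglue d).trans
    (congrArg (Sum.map f id) (h u v a b d)).symm)

lemma cls_addEdge_swap (h : u ≠ v) : (S.addEdge u v).cls = (S.addEdge v u).cls := by
  refine S.cls_addEdge_eq_of_relabel (Sum.map id not)
    (Function.Injective.sumMap Function.injective_id Bool.not_injective) ?_ ?_
  · rintro (d | _ | _)
    · by_cases h1 : d = u
      · subst h1; simp [addEdgePerm_inl, h]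
      · by_cases h2 : d = v
        · subst h2; simp [addEdgePerm_inl, h1]
        · simp [addEdgePerm_inl, h1, h2]
    · simp [addEdgePerm_true, h.symm]
    · simp [addEdgePerm_true, h]
  · rintro (d | b)
    · rcases hd : S.glue d with a | l <;> simp [addEdgeGlue, hd]
    · simp [addEdgeGlue]

/-- Exchange the two edges added last. -/
def swapLast {D : Type} : (D ⊕ Bool) ⊕ Bool → (D ⊕ Bool) ⊕ Bool :=
  Sum.elim (Sum.elim (fun d => Sum.inl (Sum.inl d)) Sum.inr) (fun b => Sum.inl (Sum.inr b))

lemma swapLast_injective {D : Type} : Function.Injective (swapLast (D := D)) := by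
  rintro ((a | a) | a) ((b | b) | b) h <;> simp_all [swapLast]

lemma swapLast_glue {D L : Type} (g : D → D ⊕ L) (d : (D ⊕ Bool) ⊕ Bool) :
    addEdgeGlue (addEdgeGlue g) (swapLast d) =
      (addEdgeGlue (addEdgeGlue g) d).map swapLast id := by
  rcases d with (d | b) | b
  · rcases hd : g d with a | l <;> simp [addEdgeGlue, swapLast, hd]
  · simp [addEdgeGlue, swapLast]
  · simp [addEdgeGlue, swapLast]

/-- A tube from a polygon cut off at a corner is a tube from that corner. -/
lemma cls_addEdge_puncture (h : ¬ S.face.SameCycle u v) :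
    ((S.addEdge u u).addEdge (Sum.inr true) (Sum.inl v)).cls = (S.addEdge u v).cls := by
  have huv := ne_of_not_sameCycle h
  -- Once the tube is attached, `u` and `inr true` lie in one polygon, so the loop around the foot
  -- of the tube is a mere cut. Attaching loop and tube in the other order gives the same surface,
  -- with the two new edges exchanged.
  have hs : (S.addEdge u v).face.SameCycle (Sum.inl u) (Sum.inr true) :=
    (addEdgePerm_sameCycle_join h).trans (addEdgePerm_sameCycle_right huv)
  rw [← cls_addEdge_of_sameCycle _ hs]
  refine S.cls_addEdge_addEdge_eq_of_relabel swapLast swapLast_injective ?_ (swapLast_glue _)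
  rintro ((d | _ | _) | _ | _)
  · by_cases h1 : d = u
    · subst h1; simp [addEdgePerm_inl, swapLast, huv]
    · by_cases h2 : d = v
      · subst h2; simp [addEdgePerm_inl, swapLast, h1]
      · simp [addEdgePerm_inl, swapLast, h1, h2]
  all_goals simp [addEdgePerm_inl, addEdgePerm_true, swapLast, huv, huv.symm]

/-- The end of a tube can be moved inside a polygon. -/
lemma cls_addEdge_rotate {u' : S.Dart} (h : ¬ S.face.SameCycle u v)
    (hu : S.face.SameCycle u u') : (S.addEdge u v).cls = (S.addEdge u' v).cls := by
  by_cases huu : u = u'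
  · rw [huu]
  have h' : ¬ S.face.SameCycle u' v := fun hh => h (hu.trans hh)
  have huv := ne_of_not_sameCycle h
  have huv' := ne_of_not_sameCycle h'
  -- Both candidate edges are attached. The first one is the tube and merges the polygons, which
  -- turns the other one into a cut. The second edge ends at `inl v` in one order but starts from
  -- `u` and ends at `inr false` in the other, because the first edge divides the corner after `v`.
  have hs : (S.addEdge u v).face.SameCycle (Sum.inl u') (Sum.inl v) :=
    (addEdgePerm_sameCycle_inl h hu).symm.trans (addEdgePerm_sameCycle_join h)
  have hs' : (S.addEdge u' v).face.SameCycle (Sum.inl u) (Sum.inr false) :=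
    (addEdgePerm_sameCycle_inl h' hu).trans addEdgePerm_sameCycle_left
  rw [← cls_addEdge_of_sameCycle _ hs, ← cls_addEdge_of_sameCycle _ hs']
  refine S.cls_addEdge_addEdge_eq_of_relabel swapLast swapLast_injective ?_ (swapLast_glue _)
  rintro ((d | _ | _) | _ | _)
  · by_cases h1 : d = u
    · subst h1; simp [addEdgePerm_inl, swapLast, huv, huu]
    · by_cases h2 : d = v
      · subst h2; simp [addEdgePerm_inl, swapLast, huv.symm, huv'.symm]
      · by_cases h3 : d = u'
        · subst h3; simp [addEdgePerm_inl, swapLast, h1, h2]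
        · simp [addEdgePerm_inl, swapLast, h1, h2, h3]
  all_goals simp [addEdgePerm_inl, addEdgePerm_true, swapLast, huv, huv', huv.symm, huv'.symm,
    huu, Ne.symm huu]

open Classical in
/-- The relabelling which replaces the sides `x`, `x'` of an edge by those of the last edge. -/
noncomputable def crossMap {D : Type} (x x' : D) :
    (D ⊕ Bool) ⊕ Bool → (D ⊕ Bool) ⊕ Bool
  | Sum.inl (Sum.inl d) => if d = x then Sum.inr true else if d = x' then Sum.inr false else
      Sum.inl (Sum.inl d)
  | Sum.inl (Sum.inr b) => Sum.inl (Sum.inr b)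
  | Sum.inr false => Sum.inl (Sum.inl x)
  | Sum.inr true => Sum.inl (Sum.inl x')

lemma crossMap_injective {D : Type} {x x' : D} (h : x ≠ x') :
    Function.Injective (crossMap x x') := by
  rintro ((a | a) | _ | _) ((b | b) | _ | _) hab <;> simp only [crossMap] at hab <;> grind

lemma crossMap_glue {D L : Type} {g : D → D ⊕ L} {x x' : D} (h : x ≠ x')
    (hx : g x = Sum.inl x') (hx' : g x' = Sum.inl x)
    (hg : ∀ d d', g d = Sum.inl d' → g d' = Sum.inl d) (d : (D ⊕ Bool) ⊕ Bool) :
    addEdgeGlue (addEdgeGlue g) (crossMap x x' d) =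
      (addEdgeGlue (addEdgeGlue g) d).map (crossMap x x') id := by
  rcases d with (d | b) | _ | _
  · by_cases h1 : d = x
    · subst h1; simp [addEdgeGlue, crossMap, hx, h.symm]
    · by_cases h2 : d = x'
      · subst h2; simp [addEdgeGlue, crossMap, hx', h1]
      · rcases hd : g d with a | l
        · have h3 : a ≠ x := by
            rintro rfl; exact h2 (Sum.inl.inj ((hg _ _ hd).symm.trans hx))
          have h4 : a ≠ x' := by
            rintro rfl; exact h1 (Sum.inl.inj ((hg _ _ hd).symm.trans hx'))
          simp [addEdgeGlue, crossMap, hd, h1, h2, h3, h4]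
        · simp [addEdgeGlue, crossMap, hd, h1, h2]
  · simp [addEdgeGlue, crossMap]
  · simp [addEdgeGlue, crossMap, hx]
  · simp [addEdgeGlue, crossMap, hx']

/-- The end of a tube can be moved across an edge. -/
lemma cls_addEdge_cross {x x' y : S.Dart} (hg : S.glue x = Sum.inl x') (hy : S.face y = x')
    (hx : S.face x ≠ x) (hx' : S.face x' ≠ x') (hxx' : ¬ S.face.SameCycle x x')
    (hv : ¬ S.face.SameCycle x v) (hv' : ¬ S.face.SameCycle x' v) :
    (S.addEdge x v).cls = (S.addEdge y v).cls := by
  obtain ⟨z, hz⟩ := S.face.surjective x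
  have hzx : z ≠ x := fun h => hx (h ▸ hz)
  have hyx' : y ≠ x' := fun h => hx' (h ▸ hy)
  have hyx'c : S.face.SameCycle y x' := sameCycle_of_apply_eq hy
  have hzxc : S.face.SameCycle z x := sameCycle_of_apply_eq hz
  have hvy : ¬ S.face.SameCycle y v := fun h => hv' (hyx'c.symm.trans h)
  have n1 := ne_of_not_sameCycle hv
  have n2 := ne_of_not_sameCycle hv'
  have n3 := ne_of_not_sameCycle hxx'
  have n4 := ne_of_not_sameCycle hvy
  have n5 : z ≠ v := ne_of_not_sameCycle fun h => hv (hzxc.symm.trans h)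
  have n6 : z ≠ x' := ne_of_not_sameCycle fun h => hxx' (hzxc.symm.trans h)
  have n7 : y ≠ x := ne_of_not_sameCycle fun h => hxx' (h.symm.trans hyx'c)
  have n8 : y ≠ z := ne_of_not_sameCycle fun h => hxx' (hzxc.symm.trans (h.symm.trans hyx'c))
  -- In each surface a chord parallel to the edge of `x` and `x'` cuts off a polygon made of one
  -- side of that edge, the chord, both sides of the tube edge and the sides of the polygon of `v`.
  -- Exchanging the edge with the chord, as `crossMap` does, identifies the two surfaces.
  have hs : (S.addEdge x v).face.SameCycle (Sum.inl z) (Sum.inr true) :=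
    (addEdgePerm_sameCycle_inl hv hzxc).trans
      ((addEdgePerm_sameCycle_join hv).trans (addEdgePerm_sameCycle_right n1))
  have hs' : (S.addEdge y v).face.SameCycle (Sum.inl y) (Sum.inl x') :=
    addEdgePerm_sameCycle_inl hvy hyx'c
  rw [← cls_addEdge_of_sameCycle _ hs, ← cls_addEdge_of_sameCycle _ hs']
  refine S.cls_addEdge_addEdge_eq_of_relabel (crossMap x x') (crossMap_injective n3) ?_
    (crossMap_glue n3 hg (S.glue_symm _ _ hg) S.glue_symm)
  have fx : ∀ d, S.face d = x ↔ d = z := fun d => by rw [← hz]; exact S.face.injective.eq_iff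
  have fx' : ∀ d, S.face d = x' ↔ d = y := fun d => by rw [← hy]; exact S.face.injective.eq_iff
  rintro ((d | _ | _) | _ | _)
  · by_cases h1 : d = x
    · subst h1
      simp [addEdgePerm_inl, addEdgePerm_true, crossMap, n7.symm, n3, n7, n1, n2, n4, hzx.symm, hyx']
    · by_cases h2 : d = v
      · subst h2
        simp [addEdgePerm_inl, addEdgePerm_true, crossMap, n1.symm, n2.symm, n4.symm, n5.symm]
      · by_cases h3 : d = z
        · subst h3
          simp [addEdgePerm_inl, addEdgePerm_true, crossMap, hzx, n6, h2, n8.symm, hz]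
        · by_cases h4 : d = x'
          · subst h4
            simp [addEdgePerm_inl, addEdgePerm_true, crossMap, h1, h2, h3, hyx', hyx'.symm,
              fx, fx', n4, n2]
          · by_cases h5 : d = y
            · subst h5
              simp [addEdgePerm_inl, addEdgePerm_true, crossMap, h1, h2, h3, h4, hy, n3.symm]
            · simp [addEdgePerm_inl, addEdgePerm_true, crossMap, h1, h2, h3, h4, h5, fx, fx']
  all_goals simp [addEdgePerm_inl, addEdgePerm_true, crossMap, n1, n2, n3, n4, n5, n6, n7, n8,
    n1.symm, n2.symm, n3.symm, n4.symm, n5.symm, n6.symm, n7.symm, n8.symm, hzx, hyx',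
    hyx'.symm, hzx.symm, hz, hy, fx, fx']

/-- The polygons of two sides are different and adjacent. -/
def Adjacent (d d' : S.Dart) : Prop :=
  ∃ x x', S.glue x = Sum.inl x' ∧ S.face.SameCycle d x ∧ S.face.SameCycle x' d' ∧
    S.face x ≠ x ∧ S.face x' ≠ x' ∧ ¬ S.face.SameCycle x x'

variable {S}

lemma Adjacent.symm {d d' : S.Dart} (h : S.Adjacent d d') : S.Adjacent d' d := by
  obtain ⟨x, x', h1, h2, h3, h4, h5, h6⟩ := h
  exact ⟨x', x, S.glue_symm _ _ h1, h3.symm, h2.symm, h5, h4, fun h => h6 h.symm⟩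

lemma Adjacent.not_sameCycle {d d' : S.Dart} (h : S.Adjacent d d') :
    ¬ S.face.SameCycle d d' := by
  obtain ⟨x, x', _, h2, h3, _, _, h6⟩ := h
  exact fun h => h6 (h2.symm.trans (h.trans h3.symm))

/-- The end of a tube can be moved to an adjacent polygon. -/
lemma cls_addEdge_of_adjacent {d d' v : S.Dart} (h : S.Adjacent d d')
    (hv : ¬ S.face.SameCycle d v) (hv' : ¬ S.face.SameCycle d' v) :
    (S.addEdge d v).cls = (S.addEdge d' v).cls := by
  obtain ⟨x, x', h1, h2, h3, h4, h5, h6⟩ := h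
  obtain ⟨y, hy⟩ := S.face.surjective x'
  have hyx : S.face.SameCycle y x' := sameCycle_of_apply_eq hy
  -- The foot slides to the corner after `x`, crosses to the corner before `x'` at the same vertex,
  -- and slides on to `d'`.
  rw [S.cls_addEdge_rotate hv h2, S.cls_addEdge_cross h1 hy h4 h5 h6
    (fun h => hv (h2.trans h)) (fun h => hv' (h3.symm.trans h))]
  exact S.cls_addEdge_rotate (fun h => hv' (h3.symm.trans (hyx.symm.trans h))) (hyx.trans h3)

/-- A tube between adjacent polygons is a handle. -/
lemma cls_addHandle_of_adjacent {d d' : S.Dart} (h : S.Adjacent d d') :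
    (S.addHandle d).cls = (S.addEdge d d').cls := by
  have hn := h.not_sameCycle
  -- Both surfaces now carry a tube with one foot on the monogon cut off at `d`. The other foot lies
  -- in the rest of the polygon of `d` for the handle, and in the polygon of `d'` for the tube.
  -- These two polygons are still adjacent, so the foot can be moved.
  rw [← cls_addEdge_puncture S hn, addHandle]
  obtain ⟨x, x', h1, h2, h3, h4, h5, h6⟩ := h
  have hm : ∀ {a : S.Dart ⊕ Bool}, a ≠ Sum.inr true →
      ¬ (S.addEdge d d).face.SameCycle a (Sum.inr true) := fun ha h =>
    addEdgePerm_self_not_sameCycle_true ha h.symm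
  have hadj : (S.addEdge d d).Adjacent (Sum.inr false) (Sum.inl d') := by
    refine ⟨Sum.inl x, Sum.inl x', ?_, ?_, addEdgePerm_self_sameCycle_inl_iff.2 h3, ?_, ?_,
      fun h => h6 (addEdgePerm_self_sameCycle_inl_iff.1 h)⟩
    · change (S.glue x).map Sum.inl id = _
      rw [h1]
      rfl
    · exact addEdgePerm_sameCycle_left.symm.trans (addEdgePerm_self_sameCycle_inl_iff.2 h2)
    · exact addEdgePerm_inl_ne _ _ _ h4
    · exact addEdgePerm_inl_ne _ _ _ h5
  calc _ = ((S.addEdge d d).addEdge (Sum.inr false) (Sum.inr true)).cls :=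
        cls_addEdge_swap (S.addEdge d d) (Sum.inr_injective.ne (by simp))
    _ = ((S.addEdge d d).addEdge (Sum.inl d') (Sum.inr true)).cls :=
        cls_addEdge_of_adjacent hadj (hm (Sum.inr_injective.ne (by simp))) (hm Sum.inl_ne_inr)
    _ = _ := cls_addEdge_swap (S.addEdge d d) Sum.inl_ne_inr

/-- A handle can be moved to an adjacent polygon. -/
lemma cls_addHandle_eq_of_adjacent {d d' : S.Dart} (h : S.Adjacent d d') :
    (S.addHandle d).cls = (S.addHandle d').cls := by
  rw [cls_addHandle_of_adjacent h, cls_addHandle_of_adjacent h.symm,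
    cls_addEdge_swap S (ne_of_not_sameCycle h.not_sameCycle)]

end Bord

end GenusOne

/-! ### Splitting a vertex by a bigon. -/

namespace GenusOne

section Permutations

open Bord

variable {D : Type} [Finite D] (f : Equiv.Perm D)

open Classical in
/-- The face map of `blowup`. -/
noncomputable def blowupFun {D : Type} (face : D → D) (b c : D) :
    D ⊕ Bool × Bool → D ⊕ Bool × Bool
  | Sum.inl d => if d = b then Sum.inr (false, false) else
      if face d = c then Sum.inr (false, true) else Sum.inl (face d)
  | Sum.inr (false, false) => Sum.inl (face b)
  | Sum.inr (false, true) => Sum.inl c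
  | Sum.inr (true, i) => Sum.inr (true, !i)

/-- If `c` followed `b` directly, both new sides would claim the single corner between them; this is
what `f b ≠ c` excludes. -/
lemma blowupFun_bijective {b c : D} (h : f b ≠ c) : Function.Bijective (blowupFun f b c) := by
  classical
  rw [← Finite.injective_iff_bijective]
  have inj : ∀ x y, f x = f y → x = y := fun x y hxy => f.injective hxy
  rintro (a | ⟨_ | _, _ | _⟩) (a' | ⟨_ | _, _ | _⟩) h <;> simp only [blowupFun] at h <;> grind

/-- The permutation `blowupFun`. -/
noncomputable def blowupPerm {b c : D} (h : f b ≠ c) : Equiv.Perm (D ⊕ Bool × Bool) :=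
  Equiv.ofBijective _ (blowupFun_bijective f h)

/-- The permutation `subdivideFun`. -/
noncomputable def subdividePerm {d d' : D} (h : d ≠ d') : Equiv.Perm (D ⊕ Bool) :=
  Equiv.ofBijective _ (subdivideFun_bijective f d d' h)

end Permutations

namespace Bord

variable {Y₀ Y₁ : OrientedPoints} {W₀ W₁ W₂ : OneCob Y₀ Y₁}

/-- The gluing map of `blowup`. -/
def blowupGlue {D L : Type} (g : D → D ⊕ L) : D ⊕ Bool × Bool → (D ⊕ Bool × Bool) ⊕ L
  | Sum.inl d => (g d).map Sum.inl id
  | Sum.inr (k, i) => Sum.inl (Sum.inr (!k, i))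

section Turn

variable {D L : Type} {face : D → D} {glue : D → D ⊕ L} {b c b' c' : D}

open Classical in
/-- The side of `blowup` with the same initial vertex as a given side. -/
noncomputable def blowupStart (b' c : D) (x : D) : D ⊕ Bool × Bool :=
  if x = c then Sum.inr (false, true) else if x = b' then Sum.inr (true, false) else Sum.inl x

/-- Rotation about the old vertex passes from `c` to `b'` to `face b`. After the splitting it runs
through the bigon instead, about the outer one of the two vertices. `blowupStart` picks the side at
which this rotation continues, so boundary corners are preserved. -/
lemma turn_blowup (hinj : Function.Injective face)
    (hsymm : ∀ d d', glue d = Sum.inl d' → glue d' = Sum.inl d)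
    (hb : glue b = Sum.inl b') (hc : glue c = Sum.inl c') (hf : face c' = b')
    (hbc : face b ≠ c) (hne : b ≠ c) {x : D} {l : L} (h : Turn face glue x l) :
    Turn (blowupFun face b c) (blowupGlue glue) (blowupStart b' c x) l := by
  have hb' := hsymm _ _ hb
  have hc' := hsymm _ _ hc
  have hcb' : c ≠ b' := by
    rintro rfl
    have : b = c' := Sum.inl.inj (hb'.symm.trans hc)
    exact hbc (this ▸ hf)
  have hbb' : face b ≠ b' := fun h' => hcb' (by
    have : b = c' := hinj (h'.trans hf.symm)
    subst this
    exact Sum.inl.inj (hc'.symm.trans hb))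
  induction h with
  | here d l hd =>
    have h1 : d ≠ c := by rintro rfl; simp [hc] at hd
    have h2 : d ≠ b' := by rintro rfl; simp [hb'] at hd
    refine Turn.here _ _ ?_
    simp [blowupStart, h1, h2, blowupGlue, hd]
  | step d d' l hd _ ih =>
    by_cases h1 : d = c
    · subst h1
      obtain rfl : c' = d' := Sum.inl.inj (hc.symm.trans hd)
      rw [hf] at ih
      refine Turn.step _ (Sum.inr (true, true)) _ (by simp [blowupStart, blowupGlue]) ?_
      simpa [blowupFun, blowupStart, hcb'.symm] using ih
    · by_cases h2 : d = b'
      · subst h2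
        obtain rfl : b = d' := Sum.inl.inj (hb'.symm.trans hd)
        refine Turn.step _ (Sum.inr (false, false)) _
          (by simp [blowupStart, blowupGlue, h1]) ?_
        simpa [blowupFun, blowupStart, hbc, hbb'] using ih
      · have h3 : d' ≠ b := by
          rintro rfl
          exact h2 (Sum.inl.inj ((hsymm _ _ hd).symm.trans hb))
        have h4 : face d' ≠ b' := fun h => by
          have h5 : d' = c' := hinj (h.trans hf.symm)
          subst h5
          exact h1 (Sum.inl.inj ((hsymm _ _ hd).symm.trans hc'))
        refine Turn.step _ (Sum.inl d') _ (by simp [blowupStart, blowupGlue, h1, h2, hd]) ?_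
        by_cases h6 : face d' = c
        · simpa [blowupFun, blowupStart, h3, h6] using ih
        · simpa [blowupFun, blowupStart, h3, h6, h4] using ih

end Turn

section Blowup

variable (T : Bord W₀ W₁) {b c b' c' : T.Dart}

/-- Let `b` and `c` be sides, glued to consecutive sides `b'` and `c'` of a polygon, which
follows `c'` by `b'`.  The common vertex of the two edges is replaced by two vertices
which are joined by two parallel edges with a bigon between them, on the side of the vertex away
from this polygon: the new sides `inr (false, false)`, following `b`, and `inr (false, true)`,
preceding `c`, are glued to the sides of the bigon. -/
noncomputable def blowup (hb : T.glue b = Sum.inl b') (hc : T.glue c = Sum.inl c')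
    (hf : T.face c' = b') (hbc : T.face b ≠ c) (hne : b ≠ c) : Bord W₀ W₁ where
  Dart := T.Dart ⊕ Bool × Bool
  face := blowupPerm T.face hbc
  glue := blowupGlue T.glue
  side l := Sum.inl (T.side l)
  glue_side l := by simp [blowupGlue, T.glue_side]
  side_glue := by
    rintro (d | ⟨k, i⟩) l h
    · rcases hd : T.glue d with d' | l' <;> simp [blowupGlue, hd] at h
      subst h
      simp [T.side_glue _ _ hd]
    · simp [blowupGlue] at h
  glue_symm := by
    rintro (d | ⟨k, i⟩) d' h
    · rcases hd : T.glue d with a | l' <;> simp [blowupGlue, hd] at h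
      subst h
      simp [blowupGlue, T.glue_symm _ _ hd]
    · simp [blowupGlue] at h
      subst h
      simp [blowupGlue]
  glue_ne := by
    rintro (d | ⟨k, i⟩) h
    · rcases hd : T.glue d with a | l' <;> simp [blowupGlue, hd] at h
      subst h
      exact T.glue_ne _ hd
    · simp [blowupGlue] at h
  corner l := by
    have h1 : T.side l ≠ b := fun hh => by simpa [hh, hb] using T.glue_side l
    have h2 : T.face (T.side l) ≠ b' := fun hh => by
      have : T.side l = c' := T.face.injective (hh.trans hf.symm)
      simpa [this, T.glue_symm _ _ hc] using T.glue_side l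
    have := turn_blowup T.face.injective T.glue_symm hb hc hf hbc hne (T.corner l)
    change Turn (blowupFun T.face b c) (blowupGlue T.glue)
      (blowupFun T.face b c (Sum.inl (T.side l))) _
    simpa [blowupFun, blowupStart, h1, h2] using this

open Classical in
/-- The relabelling comparing `blowup` with a subdivision of the edge of `b` followed by cuts. -/
noncomputable def blowupMap {D : Type} (b' c c' : D) :
    (D ⊕ Bool × Bool) ⊕ Bool → ((D ⊕ Bool) ⊕ Bool) ⊕ Bool
  | Sum.inl (Sum.inl x) =>
      if x = c then Sum.inl (Sum.inr true) else if x = c' then Sum.inl (Sum.inr false) else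
      if x = b' then Sum.inl (Sum.inl (Sum.inr true)) else Sum.inl (Sum.inl (Sum.inl x))
  | Sum.inl (Sum.inr (false, false)) => Sum.inl (Sum.inl (Sum.inr false))
  | Sum.inl (Sum.inr (false, true)) => Sum.inr false
  | Sum.inl (Sum.inr (true, false)) => Sum.inl (Sum.inl (Sum.inl b'))
  | Sum.inl (Sum.inr (true, true)) => Sum.inr true
  | Sum.inr false => Sum.inl (Sum.inl (Sum.inl c))
  | Sum.inr true => Sum.inl (Sum.inl (Sum.inl c'))

lemma blowupMap_bijective {D : Type} {b' c c' : D} (h1 : c ≠ c') (h2 : b' ≠ c) (h3 : b' ≠ c') :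
    Function.Bijective (blowupMap b' c c') := by
  classical
  constructor
  · rintro ((a | ⟨_ | _, _ | _⟩) | _ | _) ((a' | ⟨_ | _, _ | _⟩) | _ | _) hab <;>
      simp only [blowupMap] at hab <;> grind
  · rintro (((x | _ | _) | _ | _) | _ | _)
    · by_cases hx : x = c
      · exact ⟨Sum.inr false, by simp [blowupMap, hx]⟩
      · by_cases hx' : x = c'
        · exact ⟨Sum.inr true, by simp [blowupMap, hx']⟩
        · by_cases hx'' : x = b'
          · exact ⟨Sum.inl (Sum.inr (true, false)), by simp [blowupMap, hx'']⟩
          · exact ⟨Sum.inl (Sum.inl x), by simp [blowupMap, hx, hx', hx'']⟩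
    · exact ⟨Sum.inl (Sum.inr (false, false)), rfl⟩
    · exact ⟨Sum.inl (Sum.inl b'), by simp [blowupMap, h2, h3]⟩
    · exact ⟨Sum.inl (Sum.inl c'), by simp [blowupMap, h1.symm]⟩
    · exact ⟨Sum.inl (Sum.inl c), by simp [blowupMap]⟩
    · exact ⟨Sum.inl (Sum.inr (false, true)), rfl⟩
    · exact ⟨Sum.inl (Sum.inr (true, true)), rfl⟩

/-- Both surfaces have a common refinement. In the blown-up surface a chord cuts off a triangle with
sides `inr (false, true)` and `c`. In `T` the edge of `b` is subdivided, one chord cuts off a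
triangle containing `c'` and the first half of `b'`, and a second chord cuts a bigon off this
triangle. Under `blowupMap` the edge of `c` corresponds to the first of these chords, and the chord
of the blown-up surface to the old edge of `c`. -/
lemma cls_blowup (hb : T.glue b = Sum.inl b') (hc : T.glue c = Sum.inl c')
    (hf : T.face c' = b') (hbc : T.face b ≠ c) (hne : b ≠ c) (hcc : T.face c ≠ c) :
    (T.blowup hb hc hf hbc hne).cls = T.cls := by
  classical
  have hb' := T.glue_symm _ _ hb
  have hc' := T.glue_symm _ _ hc
  have n1 : c ≠ c' := fun h => T.glue_ne c (by rw [hc, ← h])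
  have n0 : b ≠ b' := fun h => T.glue_ne b (by rw [hb, ← h])
  have n2 : b' ≠ c := by
    rintro rfl
    have : b = c' := Sum.inl.inj (hb'.symm.trans hc)
    exact hbc (this ▸ hf)
  have n3 : b' ≠ c' := by
    rintro rfl
    exact hne (Sum.inl.inj (hb'.symm.trans hc'))
  have n4 : b ≠ c' := by
    rintro rfl
    exact hbc (hf.trans (Sum.inl.inj (hb.symm.trans hc')))
  obtain ⟨y, hy⟩ := T.face.surjective c
  have hyc : y ≠ c := fun h => hcc (h ▸ hy)
  have hyb : y ≠ b := fun h => hbc (h ▸ hy)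
  -- The side before `c'` is taken in the subdivided surface, where it may be one of the new
  -- half-sides.
  obtain ⟨u, hu⟩ := (subdividePerm T.face n0).surjective (Sum.inl c')
  set T1 := T.subdivide b b' hb with hT1
  have hs1 : T1.face.SameCycle u (Sum.inl b') := by
    refine Equiv.Perm.SameCycle.trans (sameCycle_of_apply_eq hu) (sameCycle_of_apply_eq ?_)
    change subdivideFun T.face b b' (Sum.inl c') = _
    simp [subdivideFun, n4.symm, n3.symm, hf]
  set T2 := T1.addEdge u (Sum.inl b') with hT2
  have fc1 : subdivideFun T.face b b' (Sum.inl c') = Sum.inl b' := by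
    simp [subdivideFun, n4.symm, n3.symm, hf]
  have huc : u ≠ Sum.inl c' := by
    rintro rfl
    rw [show (subdividePerm T.face n0) (Sum.inl c') = _ from fc1] at hu
    exact n3 (Sum.inl.inj hu)
  have hs2 : T2.face.SameCycle (Sum.inl (Sum.inl c')) (Sum.inl (Sum.inl b')) := by
    refine sameCycle_of_apply_eq ?_
    refine (addEdgePerm_other T1.face huc.symm (Sum.inl_injective.ne n3.symm)).trans ?_
    exact congrArg Sum.inl fc1
  have hs0 : (T.blowup hb hc hf hbc hne).face.SameCycle (Sum.inl y) (Sum.inl c) := by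
    refine Equiv.Perm.SameCycle.trans (sameCycle_of_apply_eq (y := Sum.inr (false, true)) ?_)
      (sameCycle_of_apply_eq rfl)
    change blowupFun T.face b c (Sum.inl y) = _
    simp [blowupFun, hyb, hy]
  rw [← cls_addEdge_of_sameCycle _ hs0, ← T.cls_subdivide b b' hb,
    ← cls_addEdge_of_sameCycle T1 hs1, ← cls_addEdge_of_sameCycle T2 hs2]
  refine cls_eq_of_relabel (S := (T.blowup hb hc hf hbc hne).addEdge (Sum.inl y) (Sum.inl c))
    (T := T2.addEdge (Sum.inl (Sum.inl c')) (Sum.inl (Sum.inl b'))) (blowupMap b' c c')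
    (blowupMap_bijective n1 n2 n3) (fun d => ?_) (fun d => ?_)
  · change addEdgeFun (addEdgeFun (subdivideFun T.face b b') u (Sum.inl b'))
        (Sum.inl (Sum.inl c')) (Sum.inl (Sum.inl b')) (blowupMap b' c c' d) =
      blowupMap b' c c' (addEdgeFun (blowupFun T.face b c) (Sum.inl y) (Sum.inl c) d)
    change subdivideFun T.face b b' u = Sum.inl c' at hu
    have inj : ∀ p q, T.face p = T.face q → p = q := fun p q h => T.face.injective h
    have inj' : ∀ p q, subdivideFun T.face b b' p = subdivideFun T.face b b' q → p = q :=
      fun p q h => (subdividePerm T.face n0).injective h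
    have E1 : ∀ x, subdivideFun T.face b b' (Sum.inl x) = if x = b then Sum.inr false else
      if x = b' then Sum.inr true else Sum.inl (T.face x) := fun x => rfl
    have E2 : subdivideFun T.face b b' (Sum.inr false) = Sum.inl (T.face b) := rfl
    have E3 : subdivideFun T.face b b' (Sum.inr true) = Sum.inl (T.face b') := rfl
    have e1 := E1 b'
    have e2 := E1 c'
    rw [if_neg n0.symm, if_pos rfl] at e1
    rw [if_neg n4.symm, if_neg n3.symm, hf] at e2
    have hu0 : u ≠ Sum.inl b := by
      rintro rfl
      rw [E1, if_pos rfl] at hu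
      cases hu
    rcases d with (x | ⟨_ | _, _ | _⟩) | _ | _
    · simp only [blowupMap, blowupFun, addEdgeFun]
      grind (splits := 30)
    all_goals
      simp only [blowupMap, blowupFun, addEdgeFun]
      grind
  · have h1 : ∀ d : ((T.Dart ⊕ Bool) ⊕ Bool) ⊕ Bool,
        (T2.addEdge (Sum.inl (Sum.inl c')) (Sum.inl (Sum.inl b'))).glue d =
          addEdgeGlue (addEdgeGlue (subdivideGlue T b b')) d := by
      rintro ((d | _) | _) <;> rfl
    have h2 : ∀ d : (T.Dart ⊕ Bool × Bool) ⊕ Bool,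
        ((T.blowup hb hc hf hbc hne).addEdge (Sum.inl y) (Sum.inl c)).glue d =
          addEdgeGlue (blowupGlue T.glue) d := by
      rintro (d | _) <;> rfl
    refine (h1 _).trans (Eq.trans ?_ (congrArg (Sum.map (blowupMap b' c c') id) (h2 d)).symm)
    have symm := T.glue_symm
    have E1 : ∀ x, subdivideGlue T b b' (Sum.inl x) = if x = b then Sum.inl (Sum.inr true) else
      if x = b' then Sum.inl (Sum.inr false) else (T.glue x).map Sum.inl id := fun x => rfl
    have E2 : subdivideGlue T b b' (Sum.inr false) = Sum.inl (Sum.inl b') := rfl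
    have E3 : subdivideGlue T b b' (Sum.inr true) = Sum.inl (Sum.inl b) := rfl
    rcases d with (x | ⟨_ | _, _ | _⟩) | _ | _
    · by_cases h3 : x = b
      · subst h3
        simp [blowupMap, blowupGlue, addEdgeGlue, E1, E2, E3, hb, hne, n4, n0, n2, n3] <;> rfl
      by_cases h4 : x = b'
      · subst h4
        simp [blowupMap, blowupGlue, addEdgeGlue, E1, E2, E3, hb', hne, n4, n0, n2, n3] <;> rfl
      by_cases h5 : x = c
      · subst h5
        simp [blowupMap, blowupGlue, addEdgeGlue, E1, E2, E3, hc, n1.symm] <;> rfl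
      by_cases h6 : x = c'
      · subst h6
        simp [blowupMap, blowupGlue, addEdgeGlue, E1, E2, E3, hc', n1.symm] <;> rfl
      rcases hx : T.glue x with x' | l
      · have h3' : x' ≠ b' := by rintro rfl; exact h3 (Sum.inl.inj ((symm _ _ hx).symm.trans hb'))
        have h4' : x' ≠ b := by rintro rfl; exact h4 (Sum.inl.inj ((symm _ _ hx).symm.trans hb))
        have h5' : x' ≠ c' := by rintro rfl; exact h5 (Sum.inl.inj ((symm _ _ hx).symm.trans hc'))
        have h6' : x' ≠ c := by rintro rfl; exact h6 (Sum.inl.inj ((symm _ _ hx).symm.trans hc))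
        simp [blowupMap, blowupGlue, addEdgeGlue, E1, E2, E3, hx, h3, h4, h5, h6, h3', h4', h5',
          h6'] <;> rfl
      · simp [blowupMap, blowupGlue, addEdgeGlue, E1, E2, E3, hx, h3, h4, h5, h6] <;> rfl
    all_goals
      simp [blowupMap, blowupGlue, addEdgeGlue, E1, E2, E3, hb, hc, hb', hc', n0.symm, n1, n2,
        n3, n4, n1.symm, n2.symm, n3.symm, n4.symm, hne, hne.symm] <;> rfl

end Blowup

end Bord

end GenusOne

/-! ### Adding edges and splitting vertices for whole finite families. -/

namespace GenusOne

namespace Bord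

variable {Y₀ Y₁ : OrientedPoints} {W₀ W₁ W₂ : OneCob Y₀ Y₁}

/-- `T'` is obtained from `T` by adding, for every `e : ι`, an edge which does not change the
surface, as in `addEdge`. -/
structure IsAddEdges {ι : Type} (T T' : Bord W₀ W₁) (u v : ι → T.Dart)
    (f : T.Dart ⊕ ι × Bool ≃ T'.Dart) : Prop where
  cls : T'.cls = T.cls
  glue_inl : ∀ d, T'.glue (f (Sum.inl d)) = (T.glue d).map (fun a => f (Sum.inl a)) id
  glue_inr : ∀ e b, T'.glue (f (Sum.inr (e, b))) = Sum.inl (f (Sum.inr (e, !b)))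
  face_other : ∀ d, (∀ e, d ≠ u e) → (∀ e, d ≠ v e) →
    T'.face (f (Sum.inl d)) = f (Sum.inl (T.face d))
  face_left : ∀ e, T'.face (f (Sum.inl (u e))) = f (Sum.inr (e, false))
  face_right : ∀ e, u e ≠ v e → T'.face (f (Sum.inl (v e))) = f (Sum.inr (e, true))
  face_false : ∀ e, T'.face (f (Sum.inr (e, false))) = f (Sum.inl (T.face (v e)))
  face_true : ∀ e, u e ≠ v e → T'.face (f (Sum.inr (e, true))) = f (Sum.inl (T.face (u e)))
  face_loop : ∀ e, u e = v e → T'.face (f (Sum.inr (e, true))) = f (Sum.inr (e, true))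

/-- Split off the pieces indexed by `none`. -/
def optionSplit (D ι B : Type) : D ⊕ Option ι × B ≃ (D ⊕ ι × B) ⊕ B where
  toFun
    | Sum.inl d => Sum.inl (Sum.inl d)
    | Sum.inr (some e, b) => Sum.inl (Sum.inr (e, b))
    | Sum.inr (none, b) => Sum.inr b
  invFun
    | Sum.inl (Sum.inl d) => Sum.inl d
    | Sum.inl (Sum.inr (e, b)) => Sum.inr (some e, b)
    | Sum.inr b => Sum.inr (none, b)
  left_inv := by rintro (d | ⟨_ | e, b⟩) <;> rfl
  right_inv := by rintro ((d | ⟨e, b⟩) | b) <;> rfl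

/-- Induction on the index set. By the last hypothesis a genuine chord has its polygon to itself, so
the edges already added leave that polygon intact and its two ends still lie on one cycle. Loops cut
off monogons wherever they are and need no such care. -/
theorem exists_isAddEdges (T : Bord W₀ W₁) (ι : Type) [Finite ι] :
    ∀ u v : ι → T.Dart, Function.Injective u → Function.Injective v →
      (∀ e e', u e = v e' → e = e') → (∀ e, T.face.SameCycle (u e) (v e)) →
      (∀ e, u e = v e ∨ ∀ e', e' ≠ e → ¬ T.face.SameCycle (u e) (u e')) →
      ∃ (T' : Bord W₀ W₁) (f : T.Dart ⊕ ι × Bool ≃ T'.Dart), IsAddEdges T T' u v f := by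
  induction ι using Finite.induction_empty_option with
  | @of_equiv α β g ih =>
    intro u v hu hv huv hc hd
    obtain ⟨T', f, h⟩ := ih (u ∘ g) (v ∘ g) (hu.comp g.injective) (hv.comp g.injective)
      (fun e e' h => g.injective (huv _ _ h)) (fun e => hc _)
      (fun e => (hd (g e)).imp id fun h e' he => h _ (g.injective.ne he))
    refine ⟨T', (Equiv.sumCongr (Equiv.refl _) (Equiv.prodCongr g.symm (Equiv.refl _))).trans f,
      h.cls, ?_, ?_, ?_, ?_, ?_, ?_, ?_, ?_⟩
    · intro d; simpa using h.glue_inl d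
    · intro e b; simpa using h.glue_inr (g.symm e) b
    · intro d h1 h2; simpa using h.face_other d (fun e => h1 _) (fun e => h2 _)
    · intro e; simpa using h.face_left (g.symm e)
    · intro e he; simpa using h.face_right (g.symm e) (by simpa using he)
    · intro e; simpa using h.face_false (g.symm e)
    · intro e he; simpa using h.face_true (g.symm e) (by simpa using he)
    · intro e he; simpa using h.face_loop (g.symm e) (by simpa using he)
  | h_empty =>
    intro u v _ _ _ _ _
    refine ⟨T, Equiv.sumEmpty _ _, rfl, ?_, ?_, ?_, ?_, ?_, ?_, ?_, ?_⟩
    · intro d; cases h : T.glue d <;> simp [h]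
    · rintro ⟨⟩
    · intro d _ _; simp
    all_goals rintro ⟨⟩
  | @h_option ι _ ih =>
    intro u v hu hv huv hc hd
    obtain ⟨T₁, f, h⟩ := ih (u ∘ some) (v ∘ some) (hu.comp (Option.some_injective _))
      (hv.comp (Option.some_injective _))
      (fun e e' h => Option.some_injective _ (huv _ _ h)) (fun e => hc _)
      (fun e => (hd (some e)).imp id fun h e' he => h _ ((Option.some_injective _).ne he))
    have nu : ∀ e, u none ≠ u (some e) := fun e h => by simpa using hu h
    have nv : ∀ e, v none ≠ v (some e) := fun e h => by simpa using hv h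
    have nuv : ∀ e, u none ≠ v (some e) := fun e h => by simpa using huv _ _ h
    have nvu : ∀ e, v none ≠ u (some e) := fun e h => by simpa using huv _ _ h.symm
    have hcyc : T₁.face.SameCycle (f (Sum.inl (u none))) (f (Sum.inl (v none))) := by
      rcases hd none with hl | hd
      · rw [hl]
      · refine sameCycle_map (i := fun d => f (Sum.inl d)) (hc none) fun z hz => ?_
        refine sameCycle_of_apply_eq (h.face_other z ?_ ?_)
        · rintro e rfl
          exact hd (some e) (by simp) hz
        · rintro e rfl
          exact hd (some e) (by simp) (hz.trans (hc (some e)).symm)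
    have ne1 : ∀ {a b}, a ≠ b → f a ≠ f b := fun h => f.injective.ne h
    have ne2 : ∀ {a b : T.Dart}, a ≠ b → f (Sum.inl a) ≠ f (Sum.inl b) :=
      fun h => f.injective.ne (Sum.inl_injective.ne h)
    refine ⟨T₁.addEdge (f (Sum.inl (u none))) (f (Sum.inl (v none))),
      (optionSplit _ _ _).trans (Equiv.sumCongr f (Equiv.refl Bool)),
      (cls_addEdge_of_sameCycle T₁ hcyc).trans h.cls, ?_, ?_, ?_, ?_, ?_, ?_, ?_, ?_⟩
    · intro d
      change (T₁.glue (f (Sum.inl d))).map Sum.inl id = _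
      rw [h.glue_inl]
      cases T.glue d <;> rfl
    · rintro (_ | e) b
      · rfl
      · change (T₁.glue (f (Sum.inr (e, b)))).map Sum.inl id = _
        rw [h.glue_inr]
        rfl
    · intro d h1 h2
      refine (addEdgePerm_other T₁.face (ne2 (h1 none)) (ne2 (h2 none))).trans ?_
      exact congrArg Sum.inl (h.face_other d (fun e => h1 _) (fun e => h2 _))
    · rintro (_ | e)
      · exact addEdgePerm_left T₁.face _ _
      · exact (addEdgePerm_other T₁.face (ne2 (nu e).symm) (ne2 (nvu e).symm)).trans
          (congrArg Sum.inl (h.face_left e))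
    · rintro (_ | e) he
      · exact addEdgePerm_right T₁.face (ne2 he)
      · exact (addEdgePerm_other T₁.face (ne2 (nuv e).symm) (ne2 (nv e).symm)).trans
          (congrArg Sum.inl (h.face_right e he))
    · rintro (_ | e)
      · refine (addEdgePerm_false T₁.face _ _).trans (congrArg Sum.inl ?_)
        exact h.face_other _ nvu nv
      · exact (addEdgePerm_other T₁.face (ne1 (by simp)) (ne1 (by simp))).trans
          (congrArg Sum.inl (h.face_false e))
    · rintro (_ | e) he
      · refine ((addEdgePerm_true T₁.face _ _).trans (if_neg (ne2 he))).trans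
          (congrArg Sum.inl ?_)
        exact h.face_other _ nu nuv
      · exact (addEdgePerm_other T₁.face (ne1 (by simp)) (ne1 (by simp))).trans
          (congrArg Sum.inl (h.face_true e he))
    · rintro (_ | e) he
      · exact (addEdgePerm_true T₁.face _ _).trans (if_pos (by rw [he]))
      · exact (addEdgePerm_other T₁.face (ne1 (by simp)) (ne1 (by simp))).trans
          (congrArg Sum.inl (h.face_loop e he))

/-- `T'` is obtained from `T` by applying `blowup` for every `e : ι`. -/
structure IsBlowup {ι : Type} (T T' : Bord W₀ W₁) (b c : ι → T.Dart)
    (f : T.Dart ⊕ ι × Bool × Bool ≃ T'.Dart) : Prop where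
  cls : T'.cls = T.cls
  glue_inl : ∀ d, T'.glue (f (Sum.inl d)) = (T.glue d).map (fun a => f (Sum.inl a)) id
  glue_inr : ∀ e k i, T'.glue (f (Sum.inr (e, k, i))) = Sum.inl (f (Sum.inr (e, !k, i)))
  face_other : ∀ d, (∀ e, d ≠ b e) → (∀ e, T.face d ≠ c e) →
    T'.face (f (Sum.inl d)) = f (Sum.inl (T.face d))
  face_left : ∀ e, T'.face (f (Sum.inl (b e))) = f (Sum.inr (e, false, false))
  face_right : ∀ e d, T.face d = c e → T'.face (f (Sum.inl d)) = f (Sum.inr (e, false, true))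
  face_wall_left : ∀ e, T'.face (f (Sum.inr (e, false, false))) = f (Sum.inl (T.face (b e)))
  face_wall_right : ∀ e, T'.face (f (Sum.inr (e, false, true))) = f (Sum.inl (c e))
  face_post : ∀ e i, T'.face (f (Sum.inr (e, true, i))) = f (Sum.inr (e, true, !i))

/-- The disjointness hypotheses keep the splittings apart, so that the local picture required by
`cls_blowup` survives those already made. -/
theorem exists_isBlowup (T : Bord W₀ W₁) (ι : Type) [Finite ι] :
    ∀ b c b' c' : ι → T.Dart, Function.Injective b → Function.Injective c →
      (∀ e e', b e ≠ c e') → (∀ e, T.glue (b e) = Sum.inl (b' e)) →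
      (∀ e, T.glue (c e) = Sum.inl (c' e)) → (∀ e, T.face (c' e) = b' e) →
      (∀ e e', T.face (b e) ≠ c e') → (∀ e, T.face (c e) ≠ c e) →
      (∀ e e', c' e ≠ b e') → (∀ e e', b' e ≠ c e') →
      ∃ (T' : Bord W₀ W₁) (f : T.Dart ⊕ ι × Bool × Bool ≃ T'.Dart), IsBlowup T T' b c f := by
  induction ι using Finite.induction_empty_option with
  | @of_equiv α β g ih =>
    intro b c b' c' hb hc hbc gb gc hcb hf hcc h1 h2
    obtain ⟨T', f, h⟩ := ih (b ∘ g) (c ∘ g) (b' ∘ g) (c' ∘ g) (hb.comp g.injective)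
      (hc.comp g.injective) (fun e e' => hbc _ _) (fun e => gb _) (fun e => gc _)
      (fun e => hcb _) (fun e e' => hf _ _) (fun e => hcc _) (fun e e' => h1 _ _)
      (fun e e' => h2 _ _)
    refine ⟨T', (Equiv.sumCongr (Equiv.refl _) (Equiv.prodCongr g.symm (Equiv.refl _))).trans f,
      h.cls, ?_, ?_, ?_, ?_, ?_, ?_, ?_, ?_⟩
    · intro d; simpa using h.glue_inl d
    · intro e k i; simpa using h.glue_inr (g.symm e) k i
    · intro d h1 h2; simpa using h.face_other d (fun e => h1 _) (fun e => h2 _)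
    · intro e; simpa using h.face_left (g.symm e)
    · intro e d hd; simpa using h.face_right (g.symm e) d (by simpa using hd)
    · intro e; simpa using h.face_wall_left (g.symm e)
    · intro e; simpa using h.face_wall_right (g.symm e)
    · intro e i; simpa using h.face_post (g.symm e) i
  | h_empty =>
    intro b c b' c' _ _ _ _ _ _ _ _ _ _
    refine ⟨T, Equiv.sumEmpty _ _, rfl, ?_, ?_, ?_, ?_, ?_, ?_, ?_, ?_⟩
    · intro d; cases h : T.glue d <;> simp [h]
    · rintro ⟨⟩
    · intro d _ _; simp
    all_goals rintro ⟨⟩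
  | @h_option ι _ ih =>
    intro b c b' c' hb hc hbc gb gc hcb hf hcc h1 h2
    obtain ⟨T₁, f, h⟩ := ih (b ∘ some) (c ∘ some) (b' ∘ some) (c' ∘ some)
      (hb.comp (Option.some_injective _)) (hc.comp (Option.some_injective _))
      (fun e e' => hbc _ _) (fun e => gb _) (fun e => gc _)
      (fun e => hcb _) (fun e e' => hf _ _) (fun e => hcc _) (fun e e' => h1 _ _)
      (fun e e' => h2 _ _)
    have nb : ∀ e, b none ≠ b (some e) := fun e h => by simpa using hb h
    have nc : ∀ e, c none ≠ c (some e) := fun e h => by simpa using hc h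
    have ne1 : ∀ {a b}, a ≠ b → f a ≠ f b := fun h => f.injective.ne h
    have ne2 : ∀ {a b : T.Dart}, a ≠ b → f (Sum.inl a) ≠ f (Sum.inl b) :=
      fun h => f.injective.ne (Sum.inl_injective.ne h)
    have q1 : T₁.glue (f (Sum.inl (b none))) = Sum.inl (f (Sum.inl (b' none))) := by
      rw [h.glue_inl, gb]; rfl
    have q2 : T₁.glue (f (Sum.inl (c none))) = Sum.inl (f (Sum.inl (c' none))) := by
      rw [h.glue_inl, gc]; rfl
    have q3 : T₁.face (f (Sum.inl (c' none))) = f (Sum.inl (b' none)) := by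
      rw [h.face_other _ (fun e => h1 _ _) (fun e => by rw [hcb]; exact h2 _ _), hcb]
    have q4' : T₁.face (f (Sum.inl (b none))) = f (Sum.inl (T.face (b none))) :=
      h.face_other _ nb (fun e => hf _ _)
    have q4 : T₁.face (f (Sum.inl (b none))) ≠ f (Sum.inl (c none)) := by
      rw [q4']; exact ne2 (hf _ _)
    -- The successor of `c none` may by now be a new side inserted before another `c (some e)`; in
    -- either case it is not `c none`.
    have q5 : T₁.face (f (Sum.inl (c none))) ≠ f (Sum.inl (c none)) := by
      by_cases hx : ∃ e, T.face (c none) = c (some e)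
      · obtain ⟨e, he⟩ := hx
        rw [h.face_right e _ he]
        exact ne1 (by simp)
      · rw [h.face_other _ (fun e => (hbc _ _).symm) (fun e he => hx ⟨e, he⟩)]
        exact ne2 (hcc _)
    refine ⟨T₁.blowup q1 q2 q3 q4 (ne2 (hbc _ _)),
      (optionSplit _ _ _).trans (Equiv.sumCongr f (Equiv.refl (Bool × Bool))),
      (T₁.cls_blowup q1 q2 q3 q4 (ne2 (hbc _ _)) q5).trans h.cls, ?_, ?_, ?_, ?_, ?_, ?_, ?_, ?_⟩
    · intro d
      change (T₁.glue (f (Sum.inl d))).map Sum.inl id = _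
      rw [h.glue_inl]
      cases T.glue d <;> rfl
    · rintro (_ | e) k i
      · rfl
      · change (T₁.glue (f (Sum.inr (e, k, i)))).map Sum.inl id = _
        rw [h.glue_inr]
        rfl
    · intro d h3 h4
      have h5 := h.face_other d (fun e => h3 _) (fun e => h4 _)
      change blowupFun T₁.face _ _ (Sum.inl (f (Sum.inl d))) = Sum.inl (f (Sum.inl (T.face d)))
      simp [blowupFun, ne2 (h3 none), h5, ne2 (h4 none)]
    · rintro (_ | e)
      · change blowupFun T₁.face _ _ (Sum.inl (f (Sum.inl (b none)))) = Sum.inr (false, false)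
        simp [blowupFun]
      · change blowupFun T₁.face _ _ (Sum.inl (f (Sum.inl (b (some e))))) =
          Sum.inl (f (Sum.inr (e, false, false)))
        have := h.face_left e
        simp only [Function.comp] at this
        simp [blowupFun, ne2 (nb e).symm, this]
    · rintro (_ | e) d hd
      · have h3 : T₁.face (f (Sum.inl d)) = f (Sum.inl (c none)) := by
          rw [h.face_other d _ (fun e => hd ▸ nc e), hd]
          rintro e rfl
          exact hf _ _ hd
        have h4 : d ≠ b none := by rintro rfl; exact hf _ _ hd
        change blowupFun T₁.face _ _ (Sum.inl (f (Sum.inl d))) = Sum.inr (false, true)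
        simp [blowupFun, ne2 h4, h3]
      · have h3 := h.face_right e d hd
        have h4 : d ≠ b none := by rintro rfl; exact hf _ _ hd
        change blowupFun T₁.face _ _ (Sum.inl (f (Sum.inl d))) =
          Sum.inl (f (Sum.inr (e, false, true)))
        simp [blowupFun, ne2 h4, h3]
    · rintro (_ | e)
      · change Sum.inl (T₁.face (f (Sum.inl (b none)))) = Sum.inl (f (Sum.inl (T.face (b none))))
        rw [q4']
      · have h3 := h.face_wall_left e
        change blowupFun T₁.face _ _ (Sum.inl (f (Sum.inr (e, false, false)))) =
          Sum.inl (f (Sum.inl (T.face (b (some e)))))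
        have h4 : f (Sum.inl (T.face (b (some e)))) ≠ f (Sum.inl (c none)) := ne2 (hf _ _)
        simp only [Function.comp] at h3
        simp [blowupFun, h3, h4]
    · rintro (_ | e)
      · rfl
      · have h3 := h.face_wall_right e
        change blowupFun T₁.face _ _ (Sum.inl (f (Sum.inr (e, false, true)))) =
          Sum.inl (f (Sum.inl (c (some e))))
        simp only [Function.comp] at h3
        simp [blowupFun, h3, ne2 (nc e).symm]
    · rintro (_ | e) i
      · rfl
      · have := h.face_post e i
        change blowupFun T₁.face _ _ (Sum.inl (f (Sum.inr (e, true, i)))) =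
          Sum.inl (f (Sum.inr (e, true, !i)))
        simp [blowupFun, this]

end Bord

end GenusOne

/-! ### Stacks of elementary bordisms. -/

namespace GenusOne

/-- The sides of a stack of two elementary bordisms whose squares have been merged to hexagons;
the walls and posts of the lower and the upper level carry the label `false` and `true`. -/
inductive HexDart (E : Type) : Type
  | bot (e : E)
  | top (e : E)
  | wall (up : Bool) (a : E × Bool)
  | post (up : Bool) (a : E × Bool)

namespace HexDart

variable {Y₀ Y₁ : OrientedPoints} {E : Type} {head : E → Bool}

/-- The polygons of a stack of two elementary bordisms with merged squares. -/
def face (L₀ L₁ L₂ : Linking Y₀ Y₁ E head) : HexDart E → HexDart E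
  | bot e => wall false (e, !(head e))
  | top e => wall true (e, head e)
  | wall false a => if IsHead head a then bot a.1 else wall true a
  | wall true a => if IsHead head a then wall false a else top a.1
  | post false a => post false (around L₀ L₁ a)
  | post true a => post true (around L₁ L₂ a)

/-- The gluing of a stack of two elementary bordisms. -/
def glue : HexDart E → HexDart E ⊕ (E ⊕ E)
  | bot e => Sum.inr (Sum.inl e)
  | top e => Sum.inr (Sum.inr e)
  | wall up a => Sum.inl (post up a)
  | post up a => Sum.inl (wall up a)

/-- A wall or a post. -/
def side (k up : Bool) (a : E × Bool) : HexDart E := if k then post up a else wall up a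

/-- The edge to whose hexagon a side belongs. -/
def edge : HexDart E → Option E
  | bot e => some e
  | top e => some e
  | wall _ a => some a.1
  | post _ _ => none

lemma edge_face (L₀ L₁ L₂ : Linking Y₀ Y₁ E head) (x : HexDart E) :
    (face L₀ L₁ L₂ x).edge = x.edge := by
  rcases x with e | e | ⟨_ | _, a⟩ | ⟨_ | _, a⟩ <;> (try simp only [face]) <;>
    (try split_ifs) <;> rfl

end HexDart

section Mate

variable {Y₀ Y₁ : OrientedPoints} {E : Type} {head : E → Bool} (L : Linking Y₀ Y₁ E head)

/-- The end linked to a given one. -/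
def Linking.mate (a : E × Bool) : E × Bool :=
  match L.link a with
  | Sum.inl b => b
  -- Default value at a boundary point, harmless because `Linked` fails there.
  | Sum.inr _ => a

/-- The end is not a boundary point. -/
def Linking.Linked (a : E × Bool) : Prop := L.link a = Sum.inl (L.mate a)

variable {L}

lemma Linking.mate_eq {a b : E × Bool} (h : L.link a = Sum.inl b) : L.mate a = b := by
  simp [mate, h]

lemma Linking.linked_of_link {a b : E × Bool} (h : L.link a = Sum.inl b) : L.Linked a := by
  rw [Linked, mate_eq h, h]

lemma Linking.exists_of_not_linked {a : E × Bool} (h : ¬ L.Linked a) :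
    ∃ y, L.link a = Sum.inr y := by
  rcases hl : L.link a with b | y
  · exact absurd (linked_of_link hl) h
  · exact ⟨y, rfl⟩

lemma Linking.Linked.link_mate {a : E × Bool} (h : L.Linked a) :
    L.link (L.mate a) = Sum.inl a := L.link_symm _ _ h

lemma Linking.Linked.mate_mate {a : E × Bool} (h : L.Linked a) : L.mate (L.mate a) = a :=
  mate_eq h.link_mate

lemma Linking.Linked.linked_mate {a : E × Bool} (h : L.Linked a) : L.Linked (L.mate a) :=
  linked_of_link h.link_mate

lemma Linking.Linked.isHead_mate {a : E × Bool} (h : L.Linked a) :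
    IsHead head (L.mate a) ↔ ¬ IsHead head a := L.orient _ _ h

end Mate

namespace Bord

variable {Y₀ Y₁ : OrientedPoints} {W₀ W₁ W₂ : OneCob Y₀ Y₁}

/-- Both surfaces are compared with one model set of sides, which spares an explicit bijection
between them. -/
lemma cls_eq_of_correspondence {S T : Bord W₀ W₁} {R : Type} (g : R ≃ S.Dart) (h : R ≃ T.Dart)
    (φ : R → R) (γ : R → R ⊕ (W₀.Edge ⊕ W₁.Edge))
    (hS : ∀ r, S.face (g r) = g (φ r)) (hT : ∀ r, T.face (h r) = h (φ r))
    (gS : ∀ r, S.glue (g r) = (γ r).map g id) (gT : ∀ r, T.glue (h r) = (γ r).map h id) :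
    S.cls = T.cls := by
  refine cls_eq_of_relabel (g.symm.trans h) (g.symm.trans h).bijective (fun d => ?_) fun d => ?_
  · obtain ⟨r, rfl⟩ := g.surjective d
    simp [hS, hT]
  · obtain ⟨r, rfl⟩ := g.surjective d
    cases hr : γ r <;> simp [gS, gT, hr]

section HexMap

variable {E : Type} {head : E → Bool} {mate : E × Bool → E × Bool} {linked : E × Bool → Prop}
  (α : E × Bool → Bool)

open Classical in
/-- The identification of the sides of a stack of two elementary bordisms with those of the
elementary bordism from which it is obtained by blowing up vertices and adding loops. -/
noncomputable def hexMap (head : E → Bool) (mate : E × Bool → E × Bool)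
    (linked : E × Bool → Prop) :
    (ElemDart E ⊕ {a // IsHead head a ∧ linked a} × Bool × Bool) ⊕ {a // ¬ linked a} × Bool →
      HexDart E
  | Sum.inl (Sum.inl (.bot e)) => .bot e
  | Sum.inl (Sum.inl (.top e)) => .top e
  | Sum.inl (Sum.inl (.wall a)) => .wall (α a) a
  | Sum.inl (Sum.inl (.post a)) => .post (α a) a
  | Sum.inl (Sum.inr (a, k, i)) => .side k (!(α a)) (if i = α a then mate a else a)
  | Sum.inr (a, k) => .side k false a

/-- Every wall and every post is needed on two levels, and `α a` is the level of the original one.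
The other level comes from a bigon if `a` is linked and from a loop if it is not. A bigon serves a
linked pair of ends and is indexed by the head of the pair, so nothing is hit twice. -/
lemma hexMap_bijective (hm : ∀ a, linked a → linked (mate a) ∧ mate (mate a) = a)
    (ho : ∀ a, linked a → (IsHead head (mate a) ↔ ¬ IsHead head a))
    (hα : ∀ a, linked a → α (mate a) = α a) (hn : ∀ a, ¬ linked a → α a = true) :
    Function.Bijective (hexMap α head mate linked) := by
  classical
  constructor
  · rintro (((e | e | a | a) | ⟨⟨a, ha, hl⟩, k, i⟩) | ⟨⟨a, ha⟩, k⟩)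
      (((e' | e' | a' | a') | ⟨⟨a', ha', hl'⟩, k', i'⟩) | ⟨⟨a', ha'⟩, k'⟩) h <;>
    simp only [hexMap, HexDart.side] at h
    case inl.inr.inl.inr =>
      have hk : k = k' := by cases k <;> cases k' <;> simp at h ⊢
      have h' : (if i = α a then mate a else a) = if i' = α a' then mate a' else a' := by
        subst hk
        cases k <;> simp only [Bool.false_eq_true, ↓reduceIte, HexDart.wall.injEq,
          HexDart.post.injEq] at h <;> exact h.2
      have haa : a = a' := by
        have h1 := hm a hl
        have h2 := hm a' hl'
        have h3 := ho a hl
        have h4 := ho a' hl'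
        split_ifs at h' <;> grind
      subst haa
      have hi : i = i' := by
        have h3 := ho a hl
        cases i <;> cases i' <;> cases hα : α a <;> simp [hα] at h' ⊢ <;> grind
      rw [hk, hi]
    all_goals grind
  · have key : ∀ k up a, ∃ r, hexMap α head mate linked r = .side k up a := by
      intro k up a
      by_cases hu : up = α a
      · subst hu
        cases k
        · exact ⟨Sum.inl (Sum.inl (.wall a)), rfl⟩
        · exact ⟨Sum.inl (Sum.inl (.post a)), rfl⟩
      have hu' : up = !α a := by cases up <;> cases h : α a <;> simp_all
      subst hu'
      by_cases hl : linked a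
      · by_cases hh : IsHead head a
        · exact ⟨Sum.inl (Sum.inr (⟨a, hh, hl⟩, k, !α a)), by simp [hexMap]⟩
        · exact ⟨Sum.inl (Sum.inr (⟨mate a, (ho a hl).2 hh, (hm a hl).1⟩, k, α a)),
            by simp [hexMap, hα a hl, (hm a hl).2]⟩
      · exact ⟨Sum.inr (⟨a, hl⟩, k), by simp [hexMap, hn a hl]⟩
    rintro (e | e | ⟨up, a⟩ | ⟨up, a⟩)
    · exact ⟨Sum.inl (Sum.inl (.bot e)), rfl⟩
    · exact ⟨Sum.inl (Sum.inl (.top e)), rfl⟩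
    · exact key false up a
    · exact key true up a

end HexMap

section Elementary

variable {E : Type} {head : E → Bool}

lemma isHead_head (e : E) : IsHead head (e, head e) := rfl

lemma not_isHead_tail (e : E) : ¬ IsHead head (e, !(head e)) := by simp [IsHead]

section Around

variable {L₀ L₁ L₂ : Linking Y₀ Y₁ E head} {a b : E × Bool}

lemma around_of_isHead (ha : IsHead head a) (h : L₁.link a = Sum.inl b) :
    around L₀ L₁ a = b := by simp [around, ha, h]

lemma around_of_not_isHead (ha : ¬ IsHead head a) (h : L₀.link a = Sum.inl b) :
    around L₀ L₁ a = b := by simp [around, ha, h]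

lemma around_eq_self {y : Y₀.pt ⊕ Y₁.pt} (h₀ : L₀.link a = Sum.inr y)
    (h₁ : L₁.link a = Sum.inr y) : around L₀ L₁ a = a := by
  simp [around, h₀, h₁, L₀.att_link _ _ h₀, L₁.att_link _ _ h₁]

end Around

variable [Finite E] (L₀ L₁ L₂ : Linking Y₀ Y₁ E head)

lemma elementary_face (d : ElemDart E) : (elementary L₀ L₁).face d = elemFace L₀ L₁ d := rfl

variable {L₀ L₁ L₂}

/-- Where `L₀` and `L₁` agree, the lower level is a product: the walls of `elementary L₀ L₂` serve
as upper walls, and splitting vertices creates the lower bigons. Where they differ, `L₁` and `L₂`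
agree and the levels exchange roles. At a boundary point a loop supplies the missing lower monogon.
-/
theorem exists_hex (h : ∀ a, L₀.link a = L₁.link a ∨ L₁.link a = L₂.link a)
    (h01 : L₀.att = L₁.att) (h12 : L₁.att = L₂.att) :
    ∃ (T : Bord (OneCob.mk E head L₀) (OneCob.mk E head L₂)) (g : HexDart E ≃ T.Dart),
      T.cls = (elementary L₀ L₂).cls ∧
      (∀ x, T.face (g x) = g (HexDart.face L₀ L₁ L₂ x)) ∧
      ∀ x, T.glue (g x) = (HexDart.glue x).map g id := by
  classical
  have hb0 : ∀ {a y}, L₁.link a = Sum.inr y → L₀.link a = Sum.inr y := fun {a y} hy => by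
    rw [← L₁.att_link _ _ hy, ← h01, L₀.link_att]
  have hb2 : ∀ {a y}, L₁.link a = Sum.inr y → L₂.link a = Sum.inr y := fun {a y} hy => by
    rw [← L₁.att_link _ _ hy, h12, L₂.link_att]
  set A : E × Bool → Prop := fun a => L₀.link a = L₁.link a with hA
  have hA2 : ∀ {a}, ¬ A a → L₁.link a = L₂.link a := fun {a} ha => (h a).resolve_left ha
  set m := L₁.mate with hmdef
  set α : E × Bool → Bool := fun a => decide (A a) with hα
  have hAm : ∀ a, L₁.Linked a → (A (m a) ↔ A a) := by
    intro a ha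
    have key : ∀ a, L₁.Linked a → A a → A (m a) := fun a ha hAa => by
      have h1 : L₀.link a = Sum.inl (m a) := Eq.trans hAa ha
      exact (L₀.link_symm _ _ h1).trans ha.link_mate.symm
    exact ⟨fun h => ha.mate_mate ▸ key _ ha.linked_mate h, key a ha⟩
  have hAn : ∀ a, ¬ L₁.Linked a → A a := fun a ha => by
    obtain ⟨y, hy⟩ := Linking.exists_of_not_linked ha
    exact (hb0 hy).trans hy.symm
  have hmap := hexMap_bijective (head := head) (mate := m) (linked := L₁.Linked) α
    (fun a ha => ⟨ha.linked_mate, ha.mate_mate⟩) (fun a ha => ha.isHead_mate)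
    (fun a ha => by simp [hα, hAm a ha]) (fun a ha => by simp [hα, hAn a ha])
  set ι₁ := {a : E × Bool // IsHead head a ∧ L₁.Linked a} with hι₁
  set ι₂ := {a : E × Bool // ¬ L₁.Linked a} with hι₂
  -- The boundary of a hexagon runs down at the head of the edge and up at the tail. A new lower
  -- wall therefore follows the old wall at the head and precedes it at the tail; for a new upper
  -- wall it is the other way round. Hence the choice of `b₀`, after which a side is inserted, and
  -- of `c₀`, before which one is inserted.
  let b₀ : ι₁ → E × Bool := fun a => if A a.1 then a.1 else m a.1
  let c₀ : ι₁ → E × Bool := fun a => if A a.1 then m a.1 else a.1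
  have hmt : ∀ a : ι₁, ¬ IsHead head (m a.1) := fun a => fun h => (a.2.2.isHead_mate.1 h) a.2.1
  have hminj : ∀ a a' : ι₁, m a.1 = m a'.1 → a = a' := fun a a' h => by
    apply Subtype.ext
    rw [← a.2.2.mate_mate, ← a'.2.2.mate_mate]
    exact congrArg m h
  have hmne : ∀ a a' : ι₁, m a.1 ≠ a'.1 := fun a a' h => hmt a (h ▸ a'.2.1)
  have hAmi : ∀ a : ι₁, A (m a.1) ↔ A a.1 := fun a => hAm _ a.2.2
  have hb₀ : Function.Injective b₀ := by
    intro a a' h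
    simp only [b₀] at h
    split_ifs at h
    · exact Subtype.ext h
    · exact absurd h.symm (hmne _ _)
    · exact absurd h (hmne _ _)
    · exact hminj _ _ h
  have hc₀ : Function.Injective c₀ := by
    intro a a' h
    simp only [c₀] at h
    split_ifs at h
    · exact hminj _ _ h
    · exact absurd h (hmne _ _)
    · exact absurd h.symm (hmne _ _)
    · exact Subtype.ext h
  have hbc₀ : ∀ a a', b₀ a ≠ c₀ a' := by
    intro a a' h
    simp only [b₀, c₀] at h
    split_ifs at h with h1 h2 h2
    · exact hmne _ _ h.symm
    · exact h2 (h ▸ h1)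
    · exact h1 (hminj _ _ h ▸ h2)
    · exact hmne _ _ h
  have hcb : ∀ a, around L₀ L₂ (c₀ a) = b₀ a := by
    intro a
    by_cases ha : A a.1
    · have h1 : L₀.link (m a.1) = Sum.inl a.1 := by
        rw [show L₀.link (m a.1) = L₁.link (m a.1) from (hAmi a).2 ha]
        exact a.2.2.link_mate
      simp [b₀, c₀, ha, around, hmt a, h1]
    · have h1 : L₂.link a.1 = Sum.inl (m a.1) := (hA2 ha).symm.trans a.2.2
      simp [b₀, c₀, ha, around, a.2.1, h1]
  have wall_face : ∀ a a' : E × Bool, elemFace L₀ L₂ (.wall a) ≠ .wall a' := by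
    intro a a'
    simp only [elemFace]
    split_ifs <;> simp
  obtain ⟨T₁, f₁', B⟩ := exists_isBlowup (elementary L₀ L₂) ι₁
    (fun a => ElemDart.wall (b₀ a)) (fun a => ElemDart.wall (c₀ a))
    (fun a => ElemDart.post (b₀ a)) (fun a => ElemDart.post (c₀ a))
    (fun a a' h => hb₀ (ElemDart.wall.inj h)) (fun a a' h => hc₀ (ElemDart.wall.inj h))
    (fun a a' h => hbc₀ a a' (ElemDart.wall.inj h)) (fun a => rfl) (fun a => rfl)
    (fun a => congrArg ElemDart.post (hcb a)) (fun a a' => wall_face _ _)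
    (fun a => wall_face _ _) (fun a a' => nofun) (fun a a' => nofun)
  obtain ⟨f₁, hf₁⟩ : ∃ f₁ : ElemDart E ⊕ ι₁ × Bool × Bool ≃ T₁.Dart, f₁ = f₁' := ⟨f₁', rfl⟩
  have Bcls : T₁.cls = (elementary L₀ L₂).cls := B.cls
  have Bg1 : ∀ d : ElemDart E, T₁.glue (f₁ (Sum.inl d)) =
      (elemGlue d).map (fun a => f₁ (Sum.inl a)) id := hf₁ ▸ B.glue_inl
  have Bg2 : ∀ e k i, T₁.glue (f₁ (Sum.inr (e, k, i))) = Sum.inl (f₁ (Sum.inr (e, !k, i))) :=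
    hf₁ ▸ B.glue_inr
  have Bo : ∀ d : ElemDart E, (∀ e, d ≠ .wall (b₀ e)) → (∀ e, elemFace L₀ L₂ d ≠ .wall (c₀ e)) →
      T₁.face (f₁ (Sum.inl d)) = f₁ (Sum.inl (elemFace L₀ L₂ d)) := hf₁ ▸ B.face_other
  have Bl : ∀ e, T₁.face (f₁ (Sum.inl (.wall (b₀ e)))) = f₁ (Sum.inr (e, false, false)) :=
    hf₁ ▸ B.face_left
  have Br : ∀ e (d : ElemDart E), elemFace L₀ L₂ d = .wall (c₀ e) →
      T₁.face (f₁ (Sum.inl d)) = f₁ (Sum.inr (e, false, true)) := hf₁ ▸ B.face_right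
  have Bwl : ∀ e, T₁.face (f₁ (Sum.inr (e, false, false))) =
      f₁ (Sum.inl (elemFace L₀ L₂ (.wall (b₀ e)))) := hf₁ ▸ B.face_wall_left
  have Bwr : ∀ e, T₁.face (f₁ (Sum.inr (e, false, true))) = f₁ (Sum.inl (.wall (c₀ e))) :=
    hf₁ ▸ B.face_wall_right
  have Bp : ∀ e i, T₁.face (f₁ (Sum.inr (e, true, i))) = f₁ (Sum.inr (e, true, !i)) :=
    hf₁ ▸ B.face_post
  clear B hf₁ f₁'
  -- The new lower wall at a boundary end comes after the old wall if the end is a head, and between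
  -- the bottom and the old wall if it is a tail.
  let u : ι₂ → ElemDart E := fun a => if IsHead head a.1 then .wall a.1 else .bot a.1.1
  have hu : Function.Injective u := by
    intro a a' h
    simp only [u] at h
    split_ifs at h with h1 h2 h2
    · exact Subtype.ext (ElemDart.wall.inj h)
    · apply Subtype.ext
      rw [← eq_tail_of_not_isHead h1, ← eq_tail_of_not_isHead h2, ElemDart.bot.inj h]
  have hu' : Function.Injective fun a => f₁ (Sum.inl (u a)) :=
    f₁.injective.comp (Sum.inl_injective.comp hu)
  obtain ⟨T₂, f₂, C⟩ := exists_isAddEdges T₁ ι₂ (fun a => f₁ (Sum.inl (u a)))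
    (fun a => f₁ (Sum.inl (u a))) hu' hu' (fun a a' h => hu' h) (fun a => Equiv.Perm.SameCycle.refl _ _)
    (fun a => Or.inl rfl)
  have Co : ∀ r : ElemDart E ⊕ ι₁ × Bool × Bool, (∀ a, r ≠ Sum.inl (u a)) →
      T₂.face (f₂ (Sum.inl (f₁ r))) = f₂ (Sum.inl (T₁.face (f₁ r))) := fun r hr =>
    C.face_other _ (fun a => f₁.injective.ne (hr a)) (fun a => f₁.injective.ne (hr a))
  let gR := (Equiv.sumCongr f₁ (Equiv.refl (ι₂ × Bool))).trans f₂
  let hR := Equiv.ofBijective _ hmap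
  refine ⟨T₂, hR.symm.trans gR, C.cls.trans Bcls, ?_, ?_⟩
  · suffices hs : ∀ r, ∃ r', T₂.face (gR r) = gR r' ∧
        HexDart.face L₀ L₁ L₂ (hR r) = hR r' by
      intro x
      obtain ⟨r, rfl⟩ := hR.surjective x
      obtain ⟨r', h1, h2⟩ := hs r
      simp [h1, h2]
    have Ci : ∀ i, T₂.face (gR (Sum.inl (Sum.inr i))) = f₂ (Sum.inl (T₁.face (f₁ (Sum.inr i)))) :=
      fun i => Co _ (fun a => nofun)
    have Ce : ∀ d : ElemDart E, (∀ a, d ≠ u a) → T₂.face (gR (Sum.inl (Sum.inl d))) =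
        f₂ (Sum.inl (T₁.face (f₁ (Sum.inl d)))) :=
      fun d hd => Co _ (fun a ha => hd a (Sum.inl_injective ha))
    have Cl : ∀ a : ι₂, T₂.face (gR (Sum.inl (Sum.inl (u a)))) = gR (Sum.inr (a, false)) :=
      C.face_left
    have Cf : ∀ a : ι₂, T₂.face (gR (Sum.inr (a, false))) =
        f₂ (Sum.inl (T₁.face (f₁ (Sum.inl (u a))))) := C.face_false
    have Ct : ∀ a : ι₂, T₂.face (gR (Sum.inr (a, true))) = gR (Sum.inr (a, true)) :=
      fun a => C.face_loop a rfl
    have hR1 : ∀ e, hR (Sum.inl (Sum.inl (.bot e))) = .bot e := fun _ => rfl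
    have hR2 : ∀ e, hR (Sum.inl (Sum.inl (.top e))) = .top e := fun _ => rfl
    have hR3 : ∀ a, hR (Sum.inl (Sum.inl (.wall a))) = .wall (α a) a := fun _ => rfl
    have hR4 : ∀ a, hR (Sum.inl (Sum.inl (.post a))) = .post (α a) a := fun _ => rfl
    have hR5 : ∀ a k i, hR (Sum.inl (Sum.inr (a, k, i))) =
      .side k (!(α a.1)) (if i = α a.1 then m a.1 else a.1) := fun _ _ _ => rfl
    have hR6 : ∀ a k, hR (Sum.inr (a, k)) = .side k false a.1 := fun _ _ => rfl
    have hbl : ∀ i, L₁.Linked (b₀ i) := fun i => by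
      simp only [b₀]; split_ifs
      exacts [i.2.2, i.2.2.linked_mate]
    have hcl : ∀ i, L₁.Linked (c₀ i) := fun i => by
      simp only [c₀]; split_ifs
      exacts [i.2.2.linked_mate, i.2.2]
    have hbA : ∀ i, A (b₀ i) ↔ IsHead head (b₀ i) := fun i => by
      have := i.2.1; have := hmt i; have := hAmi i
      simp only [b₀]; split_ifs <;> grind
    have hcA : ∀ i, A (c₀ i) ↔ ¬ IsHead head (c₀ i) := fun i => by
      have := i.2.1; have := hmt i; have := hAmi i
      simp only [c₀]; split_ifs <;> grind
    have hut : ∀ i e, u i = .top e → False := fun i e h => by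
      simp only [u] at h; split_ifs at h
    have hup : ∀ i a, u i = .post a → False := fun i e h => by
      simp only [u] at h; split_ifs at h
    have huw : ∀ i a, u i = .wall a → i.1 = a ∧ IsHead head a := fun i e h => by
      simp only [u] at h
      split_ifs at h with h1
      exact ⟨ElemDart.wall.inj h, ElemDart.wall.inj h ▸ h1⟩
    have hub : ∀ i e, u i = .bot e → i.1 = (e, !(head e)) := fun i e h => by
      simp only [u] at h
      split_ifs at h with h1
      rw [← eq_tail_of_not_isHead h1, ElemDart.bot.inj h]
    have uh : ∀ a ha, IsHead head a → u ⟨a, ha⟩ = .wall a := fun a ha h => if_pos h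
    have ut : ∀ a ha, ¬ IsHead head a → u ⟨a, ha⟩ = .bot a.1 := fun a ha h => if_neg h
    have hαt : ∀ {a}, A a → α a = true := fun h => decide_eq_true h
    have hαf : ∀ {a}, ¬ A a → α a = false := fun h => decide_eq_false h
    have hAl : ∀ {a}, ¬ A a → L₁.Linked a := fun {a} h => by
      by_contra h'; exact h (hAn a h')
    rintro (((e | e | a | a) | ⟨a, k, i⟩) | ⟨a, k⟩)
    · have hh := not_isHead_tail (head := head) e
      rw [hR1]
      by_cases ht : L₁.Linked (e, !(head e))
      · rw [Ce _ fun a ha => a.2 (by rw [hub a e ha.symm]; exact ht)]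
        by_cases hAt : A (e, !(head e))
        · let i : ι₁ := ⟨m (e, !(head e)), ht.isHead_mate.2 hh, ht.linked_mate⟩
          have hi : A i.1 := (hAm _ ht).2 hAt
          have hc : c₀ i = (e, !(head e)) := (if_pos hi).trans ht.mate_mate
          refine ⟨Sum.inl (Sum.inr (i, false, true)), ?_, ?_⟩
          · rw [Br i (.bot e) (congrArg ElemDart.wall hc.symm)]; rfl
          · rw [hR5, hαt hi]
            exact congrArg (HexDart.wall false) ht.mate_mate.symm
        · refine ⟨Sum.inl (Sum.inl (.wall (e, !(head e)))), ?_, ?_⟩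
          · rw [Bo (.bot e) (fun i => nofun) fun i hi => ?_]
            · rfl
            · have := ElemDart.wall.inj hi
              exact hAt (this ▸ (hcA i).2 (this ▸ hh))
          · rw [hR3, hαf hAt]; rfl
      · refine ⟨Sum.inr (⟨_, ht⟩, false), ?_, rfl⟩
        rw [← Cl, ut _ ht hh]
    · have hh := isHead_head (head := head) e
      rw [hR2, Ce _ fun a ha => hut a _ ha.symm]
      by_cases hAt : A (e, head e)
      · refine ⟨Sum.inl (Sum.inl (.wall (e, head e))), ?_, ?_⟩
        · rw [Bo (.top e) (fun i => nofun) fun i hi => ?_]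
          · rfl
          · have := ElemDart.wall.inj hi
            exact (hcA i).1 (this ▸ hAt) (this ▸ hh)
        · rw [hR3, hαt hAt]; rfl
      · let i : ι₁ := ⟨(e, head e), hh, hAl hAt⟩
        refine ⟨Sum.inl (Sum.inr (i, false, true)), ?_, ?_⟩
        · rw [Br i (.top e) (congrArg ElemDart.wall (if_neg hAt).symm)]; rfl
        · rw [hR5, hαf hAt]; rfl
    · rw [hR3]
      by_cases hAa : A a
      · rw [hαt hAa]
        by_cases hh : IsHead head a
        · by_cases ha : L₁.Linked a
          · let i : ι₁ := ⟨a, hh, ha⟩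
            have hb : b₀ i = a := if_pos hAa
            refine ⟨Sum.inl (Sum.inr (i, false, false)), ?_, ?_⟩
            · rw [Ce _ fun i h => i.2 ((huw i a h.symm).1 ▸ ha), ← hb, Bl]; rfl
            · rw [hR5, hαt hAa]; exact if_pos hh
          · refine ⟨Sum.inr (⟨a, ha⟩, false), ?_, if_pos hh⟩
            rw [← Cl, uh _ ha hh]
        · refine ⟨Sum.inl (Sum.inl (.top a.1)), ?_, if_neg hh⟩
          rw [Ce _ fun i h => hh (huw i a h.symm).2, Bo _ (fun i hi => ?_) fun i hi => ?_]
          · simp only [elemFace, if_neg hh]; rfl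
          · have := ElemDart.wall.inj hi
            exact hh (this ▸ (hbA i).1 (this ▸ hAa))
          · simp only [elemFace, if_neg hh] at hi
            cases hi
      · rw [hαf hAa]
        by_cases hh : IsHead head a
        · refine ⟨Sum.inl (Sum.inl (.bot a.1)), ?_, if_pos hh⟩
          rw [Ce _ fun i h => i.2 ((huw i a h.symm).1 ▸ hAl hAa), Bo _ (fun i hi => ?_)
            fun i hi => ?_]
          · simp only [elemFace, if_pos hh]; rfl
          · have := ElemDart.wall.inj hi
            exact hAa (this ▸ (hbA i).2 (this ▸ hh))
          · simp only [elemFace, if_pos hh] at hi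
            cases hi
        · have ha := hAl hAa
          let i : ι₁ := ⟨m a, ha.isHead_mate.2 hh, ha.linked_mate⟩
          have hi : ¬ A i.1 := fun h => hAa ((hAm _ ha).1 h)
          have hb : b₀ i = a := (if_neg hi).trans ha.mate_mate
          refine ⟨Sum.inl (Sum.inr (i, false, false)), ?_, ?_⟩
          · rw [Ce _ fun i h => hh (huw i a h.symm).2]
            conv_lhs => rw [← hb, Bl]
            rfl
          · rw [hR5, hαf hi]
            exact (if_neg hh).trans (congrArg (HexDart.wall true) ha.mate_mate.symm)
    · rw [hR4]
      refine ⟨Sum.inl (Sum.inl (.post (around L₀ L₂ a))), ?_, ?_⟩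
      · rw [Ce _ fun i h => hup i a h.symm, Bo (.post a) (fun i => nofun) fun i (h : ElemDart.post _ = _) => nomatch h]
        rfl
      · rw [hR4]
        by_cases hAa : A a
        · have h1 : around L₁ L₂ a = around L₀ L₂ a := by
            simp only [around, ← show L₀.link a = L₁.link a from hAa, h01]
          -- A polygon of posts lies on a single level: agreement of `L₀` and `L₁` passes from each
          -- of its ends to the next.
          have h2 : A (around L₀ L₂ a) := by
            by_contra hb
            have hb' := hAl hb
            have hb2 := hA2 hb
            by_cases hh : IsHead head a
            · rcases hl : L₂.link a with b | y
              · rw [around_of_isHead hh hl] at hb hb2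
                have h3 : L₁.link b = Sum.inl a := hb2.trans (L₂.link_symm _ _ hl)
                have h4 := Eq.trans hAa (L₁.link_symm _ _ h3)
                exact hb ((L₀.link_symm _ _ h4).trans h3.symm)
              · have h3 : around L₀ L₂ a = L₀.att y := by simp [around, hh, hl]
                rw [h3, h01] at hb'
                exact Sum.inr_ne_inl ((L₁.link_att y).symm.trans hb')
            · rcases hl : L₀.link a with b | y
              · rw [around_of_not_isHead hh hl] at hb
                exact hb ((L₀.link_symm _ _ hl).trans
                  (L₁.link_symm _ _ ((Eq.symm hAa).trans hl)).symm)
              · have h3 : around L₀ L₂ a = L₂.att y := by simp [around, hh, hl]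
                rw [h3, ← h12] at hb'
                exact Sum.inr_ne_inl ((L₁.link_att y).symm.trans hb')
          rw [hαt hAa, hαt h2]
          exact congrArg (HexDart.post true) h1
        · have ha := hAl hAa
          have hl2 := (hA2 hAa).symm.trans ha
          have h3 : around L₀ L₁ a = around L₀ L₂ a ∧ ¬ A (around L₀ L₂ a) := by
            by_cases hh : IsHead head a
            · rw [around_of_isHead hh ha, around_of_isHead hh hl2]
              exact ⟨rfl, fun h => hAa ((hAm _ ha).1 h)⟩
            · rcases hl : L₀.link a with b | y
              · rw [around_of_not_isHead hh hl, around_of_not_isHead hh hl]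
                refine ⟨rfl, fun h => hAa (hl.trans ?_)⟩
                exact (L₁.link_symm _ _ ((Eq.symm h).trans (L₀.link_symm _ _ hl))).symm
              · have h4 : L₁.link a = Sum.inr y := by
                  rw [← L₀.att_link _ _ hl, h01, L₁.link_att]
                exact absurd (h4.symm.trans ha) Sum.inr_ne_inl
          rw [hαf hAa, hαf h3.2]
          exact congrArg (HexDart.post false) h3.1
    · have hh := a.2.1
      have hl := a.2.2
      rw [hR5, Ci]
      cases k
      · cases i
        · rw [Bwl]
          by_cases hAa : A a.1
          · refine ⟨Sum.inl (Sum.inl (.bot a.1.1)), ?_, ?_⟩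
            · rw [show b₀ a = a.1 from if_pos hAa]
              simp only [elemFace, if_pos hh]; rfl
            · rw [hαt hAa]; exact if_pos hh
          · refine ⟨Sum.inl (Sum.inl (.top (m a.1).1)), ?_, ?_⟩
            · rw [show b₀ a = m a.1 from if_neg hAa]
              simp only [elemFace, if_neg (hmt a)]; rfl
            · rw [hαf hAa]; exact if_neg (hmt a)
        · rw [Bwr]
          refine ⟨Sum.inl (Sum.inl (.wall (c₀ a))), rfl, ?_⟩
          rw [hR3]
          by_cases hAa : A a.1
          · rw [show c₀ a = m a.1 from if_pos hAa, hαt hAa, hαt ((hAmi a).2 hAa)]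
            exact if_neg (hmt a)
          · rw [show c₀ a = a.1 from if_neg hAa, hαf hAa]
            exact if_pos hh
      · rw [Bp]
        refine ⟨Sum.inl (Sum.inr (a, true, !i)), rfl, ?_⟩
        rw [hR5]
        by_cases hAa : A a.1
        · have e1 : around L₀ L₁ a.1 = m a.1 := around_of_isHead hh hl
          have e2 : around L₀ L₁ (m a.1) = a.1 := around_of_not_isHead (hmt a)
            (((hAmi a).2 hAa).trans hl.link_mate)
          rw [hαt hAa]
          cases i
          · exact congrArg (HexDart.post false) e1
          · exact congrArg (HexDart.post false) e2
        · have e1 : around L₁ L₂ a.1 = m a.1 := around_of_isHead hh ((hA2 hAa).symm.trans hl)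
          have e2 : around L₁ L₂ (m a.1) = a.1 := around_of_not_isHead (hmt a) hl.link_mate
          rw [hαf hAa]
          cases i
          · exact congrArg (HexDart.post true) e2
          · exact congrArg (HexDart.post true) e1
    · rw [hR6]
      have hAa := hAn a.1 a.2
      cases k
      · rw [Cf]
        by_cases hh : IsHead head a.1
        · refine ⟨Sum.inl (Sum.inl (.bot a.1.1)), ?_, if_pos hh⟩
          rw [uh _ a.2 hh, Bo _ (fun i hi => ?_) fun i hi => ?_]
          · simp only [elemFace, if_pos hh]; rfl
          · exact a.2 ((ElemDart.wall.inj hi) ▸ hbl i)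
          · simp only [elemFace, if_pos hh] at hi
            cases hi
        · have ht := eq_tail_of_not_isHead hh
          refine ⟨Sum.inl (Sum.inl (.wall a.1)), ?_, ?_⟩
          · rw [ut _ a.2 hh, Bo (.bot a.1.1) (fun i => nofun) fun i hi => ?_]
            · simp only [elemFace, ht]; rfl
            · simp only [elemFace, ht] at hi
              exact a.2 ((ElemDart.wall.inj hi) ▸ hcl i)
          · rw [hR3, hαt hAa]; exact if_neg hh
      · refine ⟨_, Ct a, ?_⟩
        obtain ⟨y, hy⟩ := Linking.exists_of_not_linked a.2
        exact congrArg (HexDart.post false) (around_eq_self (Eq.trans hAa hy) hy)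
  · intro x
    obtain ⟨r, rfl⟩ := hR.surjective x
    simp only [Equiv.trans_apply, Equiv.symm_apply_apply]
    have Gi : ∀ r, T₂.glue (gR (Sum.inl r)) =
      (T₁.glue (f₁ r)).map (fun a => f₂ (Sum.inl a)) id := fun r => C.glue_inl _
    have Ge : ∀ d, T₂.glue (gR (Sum.inl (Sum.inl d))) =
        (elemGlue d).map (fun a => gR (Sum.inl (Sum.inl a))) id := fun d => by
      rw [Gi, Bg1]; cases elemGlue d <;> rfl
    have Gb : ∀ a k i, T₂.glue (gR (Sum.inl (Sum.inr (a, k, i)))) =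
        Sum.inl (gR (Sum.inl (Sum.inr (a, !k, i)))) := fun a k i => by
      rw [Gi, Bg2]; rfl
    have Gl : ∀ a k, T₂.glue (gR (Sum.inr (a, k))) = Sum.inl (gR (Sum.inr (a, !k))) :=
      C.glue_inr
    have key : ∀ r r', HexDart.glue (hR r) = Sum.inl (hR r') →
        (HexDart.glue (hR r)).map (fun x => gR (hR.symm x)) id = Sum.inl (gR r') := by
      intro r r' h
      simp [h]
    rcases r with ((e | e | a | a) | ⟨a, k, i⟩) | ⟨a, k⟩
    · exact Ge _
    · exact Ge _
    · exact (Ge _).trans (key _ (Sum.inl (Sum.inl (.post a))) rfl).symm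
    · exact (Ge _).trans (key _ (Sum.inl (Sum.inl (.wall a))) rfl).symm
    · refine (Gb _ _ _).trans (key _ (Sum.inl (Sum.inr (a, !k, i))) ?_).symm
      cases k <;> rfl
    · refine (Gl _ _).trans (key _ (Sum.inr (a, !k)) ?_).symm
      cases k <;> rfl

/-- The sides of a stack of two elementary bordisms. -/
def stackEquiv (E : Type) : HexDart E ⊕ E × Bool ≃ ElemDart E ⊕ ElemDart E where
  toFun
    | Sum.inl (.bot e) => Sum.inl (.bot e)
    | Sum.inl (.top e) => Sum.inr (.top e)
    | Sum.inl (.wall false a) => Sum.inl (.wall a)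
    | Sum.inl (.wall true a) => Sum.inr (.wall a)
    | Sum.inl (.post false a) => Sum.inl (.post a)
    | Sum.inl (.post true a) => Sum.inr (.post a)
    | Sum.inr (e, false) => Sum.inl (.top e)
    | Sum.inr (e, true) => Sum.inr (.bot e)
  invFun
    | Sum.inl (.bot e) => Sum.inl (.bot e)
    | Sum.inr (.top e) => Sum.inl (.top e)
    | Sum.inl (.wall a) => Sum.inl (.wall false a)
    | Sum.inr (.wall a) => Sum.inl (.wall true a)
    | Sum.inl (.post a) => Sum.inl (.post false a)
    | Sum.inr (.post a) => Sum.inl (.post true a)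
    | Sum.inl (.top e) => Sum.inr (e, false)
    | Sum.inr (.bot e) => Sum.inr (e, true)
  left_inv := by rintro ((e | e | ⟨_ | _, a⟩ | ⟨_ | _, a⟩) | ⟨e, _ | _⟩) <;> rfl
  right_inv := by rintro ((e | e | a | a) | (e | e | a | a)) <;> rfl

/-- Stacking elementary bordisms which do not change the same ends. -/
theorem cls_elementary_comp (h : ∀ a, L₀.link a = L₁.link a ∨ L₁.link a = L₂.link a)
    (h01 : L₀.att = L₁.att) (h12 : L₁.att = L₂.att) :
    ((elementary L₀ L₁).comp (elementary L₁ L₂)).cls = (elementary L₀ L₂).cls := by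
  classical
  obtain ⟨T, g, hcls, hface, hglue⟩ := exists_hex h h01 h12
  have hstep : ∀ x y, HexDart.face L₀ L₁ L₂ x = y → T.face.SameCycle (g x) (g y) :=
    fun x y hxy => sameCycle_of_apply_eq (by rw [hface, hxy])
  have hedge : ∀ x y, T.face.SameCycle (g x) (g y) → x.edge = y.edge := fun x y hxy => by
    have := label_eq_of_sameCycle (fun d => (g.symm d).edge) (fun d => by
      obtain ⟨x, rfl⟩ := g.surjective d
      simp only [hface, Equiv.symm_apply_apply, HexDart.edge_face]) hxy
    simpa using this
  have ht := not_isHead_tail (head := head)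
  have hh := isHead_head (head := head)
  -- A hexagon is cut from the corner after the lower wall at the tail to the corner after the upper
  -- wall at the head. The chord is the middle copy of the edge, along which the lower and the upper
  -- square of the stack are glued.
  obtain ⟨T', f, F⟩ := exists_isAddEdges T E (fun e => g (.wall false (e, !(head e))))
    (fun e => g (.wall true (e, head e)))
    (fun e e' he => Option.some_injective _ (congrArg HexDart.edge (g.injective he)))
    (fun e e' he => Option.some_injective _ (congrArg HexDart.edge (g.injective he)))
    (fun e e' he => by simpa using g.injective he)
    (fun e => by
      refine (hstep (.wall false (e, !(head e))) (.wall true (e, !(head e))) (if_neg (ht e))).trans ?_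
      exact (hstep (.wall true (e, !(head e))) (.top e) (if_neg (ht e))).trans (hstep _ _ rfl))
    (fun e => Or.inr fun e' hne hs => hne (by simpa [HexDart.edge] using (hedge _ _ hs).symm))
  have hne : ∀ e, g (.wall false (e, !(head e))) ≠ g (.wall true (e, head e)) :=
    fun e he => by simpa using g.injective he
  refine ((cls_eq_of_correspondence
    ((Equiv.sumCongr g (Equiv.refl (E × Bool))).trans f) (stackEquiv E)
    (fun r => (stackEquiv E).symm
      (Equiv.sumCongr (elementary L₀ L₁).face (elementary L₁ L₂).face (stackEquiv E r)))
    (fun r => (compGlue (elementary L₀ L₁) (elementary L₁ L₂) (stackEquiv E r)).map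
      (stackEquiv E).symm id) ?_ ?_ ?_ ?_).symm.trans F.cls).trans hcls
  · have other : ∀ x y, (∀ e, x ≠ .wall false (e, !(head e))) →
        (∀ e, x ≠ .wall true (e, head e)) → HexDart.face L₀ L₁ L₂ x = y →
        T'.face (f (Sum.inl (g x))) = f (Sum.inl (g y)) := fun x y h1 h2 h3 => by
      rw [F.face_other _ (fun e => g.injective.ne (h1 e)) (fun e => g.injective.ne (h2 e)),
        hface, h3]
    have conv : ∀ r r', stackEquiv E r' = Equiv.sumCongr (elementary L₀ L₁).face
          (elementary L₁ L₂).face (stackEquiv E r) →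
        T'.face (((Equiv.sumCongr g (Equiv.refl (E × Bool))).trans f) r) =
          ((Equiv.sumCongr g (Equiv.refl (E × Bool))).trans f) r' →
        T'.face (((Equiv.sumCongr g (Equiv.refl (E × Bool))).trans f) r) =
          ((Equiv.sumCongr g (Equiv.refl (E × Bool))).trans f) ((stackEquiv E).symm
          (Equiv.sumCongr (elementary L₀ L₁).face (elementary L₁ L₂).face (stackEquiv E r))) :=
      fun r r' h1 h2 => by rw [h2, ← h1, Equiv.symm_apply_apply]
    rintro ((e | e | ⟨_ | _, a⟩ | ⟨_ | _, a⟩) | ⟨e, _ | _⟩)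
    · exact conv _ (Sum.inl (.wall false (e, !(head e)))) rfl (other _ _ (by simp) (by simp) rfl)
    · exact conv _ (Sum.inl (.wall true (e, head e))) rfl (other _ _ (by simp) (by simp) rfl)
    · by_cases ha : IsHead head a
      · refine conv _ (Sum.inl (.bot a.1)) (congrArg Sum.inl (if_pos ha).symm)
          (other _ _ ?_ (by simp) (if_pos ha))
        rintro e he
        exact ht e (by simpa using (HexDart.wall.inj he).2 ▸ ha)
      · refine conv _ (Sum.inr (a.1, false)) (congrArg Sum.inl (if_neg ha).symm) ?_
        have := F.face_left a.1
        rwa [eq_tail_of_not_isHead ha] at this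
    · by_cases ha : IsHead head a
      · refine conv _ (Sum.inr (a.1, true)) (congrArg Sum.inr (if_pos ha).symm) ?_
        have := F.face_right a.1 (hne _)
        rwa [eq_head_of_isHead ha] at this
      · refine conv _ (Sum.inl (.top a.1)) (congrArg Sum.inr (if_neg ha).symm)
          (other _ _ (by simp) ?_ (if_neg ha))
        rintro e he
        exact ha ((HexDart.wall.inj he).2 ▸ hh e)
    · exact conv _ (Sum.inl (.post false (around L₀ L₁ a))) rfl
        (other _ _ (by simp) (by simp) rfl)
    · exact conv _ (Sum.inl (.post true (around L₁ L₂ a))) rfl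
        (other _ _ (by simp) (by simp) rfl)
    · refine conv _ (Sum.inl (.wall false (e, head e))) rfl ((F.face_false e).trans ?_)
      rw [hface]
      exact congrArg (fun x => f (Sum.inl (g x))) (if_pos (hh e))
    · refine conv _ (Sum.inl (.wall true (e, !(head e)))) rfl ((F.face_true e (hne e)).trans ?_)
      rw [hface]
      exact congrArg (fun x => f (Sum.inl (g x))) (if_neg (ht e))
  · intro r
    exact ((stackEquiv E).apply_symm_apply _).symm
  · rintro ((e | e | ⟨_ | _, a⟩ | ⟨_ | _, a⟩) | ⟨e, _ | _⟩)
    · exact (F.glue_inl _).trans (by rw [hglue]; rfl)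
    · exact (F.glue_inl _).trans (by rw [hglue]; rfl)
    · exact (F.glue_inl _).trans (by rw [hglue]; rfl)
    · exact (F.glue_inl _).trans (by rw [hglue]; rfl)
    · exact (F.glue_inl _).trans (by rw [hglue]; rfl)
    · exact (F.glue_inl _).trans (by rw [hglue]; rfl)
    · exact F.glue_inr _ _
    · exact F.glue_inr _ _
  · intro r
    change compGlue (elementary L₀ L₁) (elementary L₁ L₂) (stackEquiv E r) = _
    generalize compGlue (elementary L₀ L₁) (elementary L₁ L₂) (stackEquiv E r) = z
    rcases z with z | z
    · exact congrArg Sum.inl ((stackEquiv E).apply_symm_apply _).symm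
    · rfl

end Elementary

end Bord

end GenusOne

/-! ### Tubes and handles in a stack. -/

namespace GenusOne

namespace Bord

variable {Y₀ Y₁ : OrientedPoints} {W₀ W₁ W₂ : OneCob Y₀ Y₁}

lemma cls_cylinder_comp (S : Bord W₀ W₁) : ((cylinder W₀).comp S).cls = S.cls :=
  Quot.sound (Step.collar_left S)

lemma cls_comp_cylinder (S : Bord W₀ W₁) : (S.comp (cylinder W₁)).cls = S.cls :=
  Quot.sound (Step.collar_right S)

/-- A bijection between the sides of two polygonal surfaces which is compatible with their
structure. -/
structure IsRelabel (S T : Bord W₀ W₁) (e : S.Dart ≃ T.Dart) : Prop where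
  face : ∀ d, T.face (e d) = e (S.face d)
  glue : ∀ d, T.glue (e d) = (S.glue d).map e id

lemma IsRelabel.cls {S T : Bord W₀ W₁} {e : S.Dart ≃ T.Dart} (h : IsRelabel S T e) :
    S.cls = T.cls := Quot.sound (Step.relabel S T e h.face h.glue)

lemma addEdgePerm_map {D D' : Type} [Finite D] [Finite D'] {f : Equiv.Perm D}
    {g : Equiv.Perm D'} (e : D ≃ D') (h : ∀ d, g (e d) = e (f d)) (u v : D) (d : D ⊕ Bool) :
    addEdgePerm g (e u) (e v) (Sum.map e id d) = Sum.map e id (addEdgePerm f u v d) := by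
  have he : ∀ a b, e a = e b ↔ a = b := fun _ _ => e.injective.eq_iff
  rcases d with d | _ | _
  · simp only [Sum.map_inl, addEdgePerm_inl, he, h]
    split_ifs <;> simp_all
  · exact congrArg Sum.inl (h v)
  · simp only [Sum.map_inr, id, addEdgePerm_true, he, h]
    split_ifs <;> simp_all

lemma IsRelabel.addEdge {S T : Bord W₀ W₁} {e : S.Dart ≃ T.Dart} (h : IsRelabel S T e)
    (u v : S.Dart) : IsRelabel (S.addEdge u v) (T.addEdge (e u) (e v))
      (Equiv.sumCongr e (Equiv.refl Bool)) where
  face := addEdgePerm_map e h.face u v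
  glue := by
    rintro (d | b)
    · change (T.glue (e d)).map Sum.inl id = ((S.glue d).map Sum.inl id).map _ id
      rw [h.glue]
      cases S.glue d <;> rfl
    · rfl

/-- Move the summand `Bool` to the end. -/
def addEdgeCompEquiv (D D' : Type) : (D ⊕ Bool) ⊕ D' ≃ (D ⊕ D') ⊕ Bool where
  toFun
    | Sum.inl (Sum.inl d) => Sum.inl (Sum.inl d)
    | Sum.inl (Sum.inr b) => Sum.inr b
    | Sum.inr d => Sum.inl (Sum.inr d)
  invFun
    | Sum.inl (Sum.inl d) => Sum.inl (Sum.inl d)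
    | Sum.inl (Sum.inr d) => Sum.inr d
    | Sum.inr b => Sum.inl (Sum.inr b)
  left_inv := by rintro ((d | b) | d) <;> rfl
  right_inv := by rintro ((d | d) | b) <;> rfl

/-- Kept as a relabelling rather than an equality of classes: a handle consists of two added edges,
and `IsRelabel.addEdge` carries the second one along. -/
lemma isRelabel_addEdge_comp (S : Bord W₀ W₁) (T : Bord W₁ W₂) (u v : S.Dart) :
    IsRelabel ((S.addEdge u v).comp T) ((S.comp T).addEdge (Sum.inl u) (Sum.inl v))
      (addEdgeCompEquiv S.Dart T.Dart) where
  face := by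
    classical
    rintro ((d | _ | _) | d)
    · change addEdgePerm (Equiv.sumCongr S.face T.face) (Sum.inl u) (Sum.inl v)
        (Sum.inl (Sum.inl d)) =
        addEdgeCompEquiv S.Dart T.Dart (Sum.inl (addEdgePerm S.face u v (Sum.inl d)))
      rw [addEdgePerm_inl, addEdgePerm_inl]
      simp only [Sum.inl_injective.eq_iff]
      split_ifs <;> rfl
    · rfl
    · change addEdgePerm (Equiv.sumCongr S.face T.face) (Sum.inl u) (Sum.inl v)
        (Sum.inr true) =
        addEdgeCompEquiv S.Dart T.Dart (Sum.inl (addEdgePerm S.face u v (Sum.inr true)))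
      rw [addEdgePerm_true, addEdgePerm_true]
      simp only [Sum.inl_injective.eq_iff]
      split_ifs <;> rfl
    · exact addEdgePerm_other _ Sum.inr_ne_inl Sum.inr_ne_inl
  glue := by
    rintro ((d | b) | d)
    · change (compGlue S T (Sum.inl d)).map Sum.inl id =
        (compGlue (S.addEdge u v) T (Sum.inl (Sum.inl d))).map _ id
      simp only [compGlue, addEdge]
      rcases S.glue d with a | e | e <;> rfl
    · rfl
    · change (compGlue S T (Sum.inr d)).map Sum.inl id =
        (compGlue (S.addEdge u v) T (Sum.inr d)).map _ id
      simp only [compGlue, addEdge]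
      rcases T.glue d with a | e | e <;> rfl

lemma isRelabel_comp_addEdge (S : Bord W₀ W₁) (T : Bord W₁ W₂) (u v : T.Dart) :
    IsRelabel (S.comp (T.addEdge u v)) ((S.comp T).addEdge (Sum.inr u) (Sum.inr v))
      (Equiv.sumAssoc S.Dart T.Dart Bool).symm where
  face := by
    classical
    rintro (d | d | _ | _)
    · exact addEdgePerm_other _ Sum.inl_ne_inr Sum.inl_ne_inr
    · change addEdgePerm (Equiv.sumCongr S.face T.face) (Sum.inr u) (Sum.inr v)
        (Sum.inl (Sum.inr d)) =
        (Equiv.sumAssoc S.Dart T.Dart Bool).symm (Sum.inr (addEdgePerm T.face u v (Sum.inl d)))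
      rw [addEdgePerm_inl, addEdgePerm_inl]
      simp only [Sum.inr_injective.eq_iff]
      split_ifs <;> rfl
    · rfl
    · change addEdgePerm (Equiv.sumCongr S.face T.face) (Sum.inr u) (Sum.inr v)
        (Sum.inr true) =
        (Equiv.sumAssoc S.Dart T.Dart Bool).symm (Sum.inr (addEdgePerm T.face u v (Sum.inr true)))
      rw [addEdgePerm_true, addEdgePerm_true]
      simp only [Sum.inr_injective.eq_iff]
      split_ifs <;> rfl
  glue := by
    rintro (d | d | b)
    · change (compGlue S T (Sum.inl d)).map Sum.inl id =
        (compGlue S (T.addEdge u v) (Sum.inl d)).map _ id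
      simp only [compGlue, addEdge]
      rcases S.glue d with a | e | e <;> rfl
    · change (compGlue S T (Sum.inr d)).map Sum.inl id =
        (compGlue S (T.addEdge u v) (Sum.inr (Sum.inl d))).map _ id
      simp only [compGlue, addEdge]
      rcases T.glue d with a | e | e <;> rfl
    · rfl

lemma cls_addEdge_comp (S : Bord W₀ W₁) (T : Bord W₁ W₂) (u v : S.Dart) :
    ((S.addEdge u v).comp T).cls = ((S.comp T).addEdge (Sum.inl u) (Sum.inl v)).cls :=
  (isRelabel_addEdge_comp S T u v).cls

lemma cls_comp_addEdge (S : Bord W₀ W₁) (T : Bord W₁ W₂) (u v : T.Dart) :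
    (S.comp (T.addEdge u v)).cls = ((S.comp T).addEdge (Sum.inr u) (Sum.inr v)).cls :=
  (isRelabel_comp_addEdge S T u v).cls

lemma cls_addHandle_comp (S : Bord W₀ W₁) (T : Bord W₁ W₂) (u : S.Dart) :
    ((S.addHandle u).comp T).cls = ((S.comp T).addHandle (Sum.inl u)).cls :=
  (cls_addEdge_comp (S.addEdge u u) T _ _).trans ((isRelabel_addEdge_comp S T u u).addEdge _ _).cls

lemma cls_comp_addHandle (S : Bord W₀ W₁) (T : Bord W₁ W₂) (u : T.Dart) :
    (S.comp (T.addHandle u)).cls = ((S.comp T).addHandle (Sum.inr u)).cls :=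
  (cls_comp_addEdge S (T.addEdge u u) _ _).trans ((isRelabel_comp_addEdge S T u u).addEdge _ _).cls

section Elementary

lemma sameCycle_sumCongr_inl {D D' : Type} [Finite D] [Finite D'] {f : Equiv.Perm D}
    {g : Equiv.Perm D'} {x y : D} :
    Equiv.Perm.SameCycle (Equiv.sumCongr f g) (Sum.inl x) (Sum.inl y) ↔ f.SameCycle x y := by
  refine ⟨fun h => ?_, fun h => sameCycle_map (i := Sum.inl) h fun z _ =>
    sameCycle_apply (f := Equiv.sumCongr f g) _⟩
  have := label_eq_of_sameCycle (f := Equiv.sumCongr f g) (Sum.elim (fun z => f.SameCycle x z) fun _ => False) (by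
    rintro (z | z)
    · exact propext Equiv.Perm.sameCycle_apply_right
    · rfl) h
  exact this.mp (Equiv.Perm.SameCycle.refl _ _)

lemma sameCycle_sumCongr_inr {D D' : Type} [Finite D] [Finite D'] {f : Equiv.Perm D}
    {g : Equiv.Perm D'} {x y : D'} :
    Equiv.Perm.SameCycle (Equiv.sumCongr f g) (Sum.inr x) (Sum.inr y) ↔ g.SameCycle x y := by
  refine ⟨fun h => ?_, fun h => sameCycle_map (i := Sum.inr) h fun z _ =>
    sameCycle_apply (f := Equiv.sumCongr f g) _⟩
  have := label_eq_of_sameCycle (f := Equiv.sumCongr f g) (Sum.elim (fun _ => False) (fun z => g.SameCycle x z)) (by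
    rintro (z | z)
    · rfl
    · exact propext Equiv.Perm.sameCycle_apply_right) h
  exact this.mp (Equiv.Perm.SameCycle.refl _ _)

variable {E : Type} {head : E → Bool}

/-- Whether a side belongs to a square. -/
def squareLabel : ElemDart E → Bool
  | .post _ => false
  | _ => true

/-- The level of a side in a stack, and whether it belongs to a square. -/
def stackLabel : ElemDart E ⊕ ElemDart E → Bool × Bool
  | Sum.inl d => (false, squareLabel d)
  | Sum.inr d => (true, squareLabel d)

variable {L₀ L₁ L₂ : Linking Y₀ Y₁ E head}

lemma squareLabel_face (d : ElemDart E) : squareLabel (elemFace L₀ L₁ d) = squareLabel d := by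
  rcases d with e | e | a | a <;> (try simp only [elemFace]) <;> (try split_ifs) <;> rfl

lemma elementary_wall_ne (a : E × Bool) : elemFace L₀ L₁ (.wall a) ≠ .wall a := by
  simp only [elemFace]; split_ifs <;> nofun

lemma elementary_post_ne {a : E × Bool} (h : around L₀ L₁ a ≠ a) :
    elemFace L₀ L₁ (.post a) ≠ .post a := fun h' => h (ElemDart.post.inj h')

variable [Finite E] (L₀ L₁ L₂)

/-- A stack of two elementary bordisms. -/
abbrev stack : Bord (OneCob.mk E head L₀) (OneCob.mk E head L₂) :=
  (elementary L₀ L₁).comp (elementary L₁ L₂)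

variable {L₀ L₁ L₂}

/-- A polygon stays on one level and is either a square or made of posts. This settles most of the
conditions that the feet of a tube lie in different polygons. -/
lemma stack_not_sameCycle {x y : ElemDart E ⊕ ElemDart E} (h : stackLabel x ≠ stackLabel y) :
    ¬ (stack L₀ L₁ L₂).face.SameCycle x y := fun hs => h <| by
  refine label_eq_of_sameCycle (f := (stack L₀ L₁ L₂).face) stackLabel ?_ hs
  rintro (d | d)
  · exact congrArg (Prod.mk false) (squareLabel_face d)
  · exact congrArg (Prod.mk true) (squareLabel_face d)

lemma elementary_wall_sameCycle (a : E × Bool) (d : ElemDart E) (hd : d = .bot a.1 ∨ d = .top a.1) :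
    (elementary L₀ L₁).face.SameCycle (.wall a) d := by
  have hh := isHead_head (head := head) a.1
  have ht := not_isHead_tail (head := head) a.1
  have s1 : (elementary L₀ L₁).face.SameCycle (.wall (a.1, head a.1)) (.bot a.1) :=
    sameCycle_of_apply_eq (if_pos hh)
  have s2 : (elementary L₀ L₁).face.SameCycle (.wall (a.1, !(head a.1))) (.top a.1) :=
    sameCycle_of_apply_eq (if_neg ht)
  have s3 : (elementary L₀ L₁).face.SameCycle (.bot a.1) (.wall (a.1, !(head a.1))) :=
    sameCycle_of_apply_eq rfl
  have s4 : (elementary L₀ L₁).face.SameCycle (.wall a) (.bot a.1) := by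
    by_cases ha : IsHead head a
    · rwa [eq_head_of_isHead ha] at s1
    · rw [eq_tail_of_not_isHead ha] at s3
      exact s3.symm
  rcases hd with rfl | rfl
  · exact s4
  · exact s4.trans (s3.trans s2)

lemma stack_adjacent_lower {a : E × Bool} (h : around L₀ L₁ a ≠ a) :
    (stack L₀ L₁ L₂).Adjacent (Sum.inl (.post a)) (Sum.inl (.wall a)) :=
  ⟨Sum.inl (.post a), Sum.inl (.wall a), rfl, Equiv.Perm.SameCycle.refl _ _,
    Equiv.Perm.SameCycle.refl _ _, Sum.inl_injective.ne (elementary_post_ne h),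
    Sum.inl_injective.ne (elementary_wall_ne (L₀ := L₀) (L₁ := L₁) a), stack_not_sameCycle (by simp [stackLabel, squareLabel])⟩

lemma stack_adjacent_upper {a : E × Bool} (h : around L₁ L₂ a ≠ a) :
    (stack L₀ L₁ L₂).Adjacent (Sum.inr (.wall a)) (Sum.inr (.post a)) :=
  ⟨Sum.inr (.wall a), Sum.inr (.post a), rfl, Equiv.Perm.SameCycle.refl _ _,
    Equiv.Perm.SameCycle.refl _ _, Sum.inr_injective.ne (elementary_wall_ne (L₀ := L₁) (L₁ := L₂) a),
    Sum.inr_injective.ne (elementary_post_ne h), stack_not_sameCycle (by simp [stackLabel, squareLabel])⟩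

/-- The top of the lower square is glued to the bottom of the upper one. -/
lemma stack_adjacent_middle (a : E × Bool) :
    (stack L₀ L₁ L₂).Adjacent (Sum.inl (.wall a)) (Sum.inr (.wall a)) := by
  refine ⟨Sum.inl (.top a.1), Sum.inr (.bot a.1), rfl,
    (sameCycle_sumCongr_inl (f := (elementary L₀ L₁).face) (g := (elementary L₁ L₂).face)).2 (elementary_wall_sameCycle a _ (Or.inr rfl)),
    (sameCycle_sumCongr_inr (f := (elementary L₀ L₁).face) (g := (elementary L₁ L₂).face)).2 (elementary_wall_sameCycle a _ (Or.inl rfl)).symm,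
    fun h => ?_, fun h => ?_, stack_not_sameCycle (by simp [stackLabel, squareLabel])⟩
  · cases Sum.inl_injective h
  · cases Sum.inr_injective h

/-- A handle can be moved through a stack. -/
theorem cls_stack_addHandle {a : E × Bool} (h₀ : around L₀ L₁ a ≠ a) (h₁ : around L₁ L₂ a ≠ a) :
    ((stack L₀ L₁ L₂).addHandle (Sum.inl (.post a))).cls =
      ((stack L₀ L₁ L₂).addHandle (Sum.inr (.post a))).cls :=
  (cls_addHandle_eq_of_adjacent (stack_adjacent_lower h₀)).trans <|
    (cls_addHandle_eq_of_adjacent (stack_adjacent_middle a)).trans <|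
    cls_addHandle_eq_of_adjacent (stack_adjacent_upper h₁)

/-- The lower end of a tube can be moved up. -/
lemma cls_stack_addEdge_up {a b : E × Bool} (h₀ : around L₀ L₁ a ≠ a) (h₁ : around L₁ L₂ a ≠ a)
    (hn : ¬ (elementary L₀ L₁).face.SameCycle (.post a) (.post b)) :
    ((stack L₀ L₁ L₂).addEdge (Sum.inl (.post a)) (Sum.inl (.post b))).cls =
      ((stack L₀ L₁ L₂).addEdge (Sum.inr (.post a)) (Sum.inl (.post b))).cls :=
  (cls_addEdge_of_adjacent (stack_adjacent_lower h₀) (fun h => hn ((sameCycle_sumCongr_inl (f := (elementary L₀ L₁).face) (g := (elementary L₁ L₂).face)).1 h))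
    (stack_not_sameCycle (by simp [stackLabel, squareLabel]))).trans <|
  (cls_addEdge_of_adjacent (stack_adjacent_middle a)
    (stack_not_sameCycle (by simp [stackLabel, squareLabel]))
    (stack_not_sameCycle (by simp [stackLabel, squareLabel]))).trans <|
  cls_addEdge_of_adjacent (stack_adjacent_upper h₁)
    (stack_not_sameCycle (by simp [stackLabel, squareLabel]))
    (stack_not_sameCycle (by simp [stackLabel, squareLabel]))

/-- The upper end of a tube can be moved down. -/
lemma cls_stack_addEdge_down {a b : E × Bool} (h₀ : around L₀ L₁ a ≠ a)
    (h₁ : around L₁ L₂ a ≠ a)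
    (hn : ¬ (elementary L₁ L₂).face.SameCycle (.post a) (.post b)) :
    ((stack L₀ L₁ L₂).addEdge (Sum.inr (.post a)) (Sum.inr (.post b))).cls =
      ((stack L₀ L₁ L₂).addEdge (Sum.inl (.post a)) (Sum.inr (.post b))).cls :=
  (cls_addEdge_of_adjacent (stack_adjacent_upper h₁).symm
    (fun h => hn ((sameCycle_sumCongr_inr (f := (elementary L₀ L₁).face) (g := (elementary L₁ L₂).face)).1 h))
    (stack_not_sameCycle (by simp [stackLabel, squareLabel]))).trans <|
  (cls_addEdge_of_adjacent (stack_adjacent_middle a).symm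
    (stack_not_sameCycle (by simp [stackLabel, squareLabel]))
    (stack_not_sameCycle (by simp [stackLabel, squareLabel]))).trans <|
  cls_addEdge_of_adjacent (stack_adjacent_lower h₀).symm
    (stack_not_sameCycle (by simp [stackLabel, squareLabel]))
    (stack_not_sameCycle (by simp [stackLabel, squareLabel]))

lemma stack_swap {a b : ElemDart E} :
    ((stack L₀ L₁ L₂).addEdge (Sum.inl a) (Sum.inr b)).cls =
      ((stack L₀ L₁ L₂).addEdge (Sum.inr b) (Sum.inl a)).cls :=
  cls_addEdge_swap _ Sum.inl_ne_inr

/-- A tube can be moved through a stack. -/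
theorem cls_stack_addEdge {a b : E × Bool} (a₀ : around L₀ L₁ a ≠ a) (a₁ : around L₁ L₂ a ≠ a)
    (b₀ : around L₀ L₁ b ≠ b) (b₁ : around L₁ L₂ b ≠ b)
    (hn₀ : ¬ (elementary L₀ L₁).face.SameCycle (.post a) (.post b))
    (hn₁ : ¬ (elementary L₁ L₂).face.SameCycle (.post a) (.post b)) :
    ((stack L₀ L₁ L₂).addEdge (Sum.inl (.post a)) (Sum.inl (.post b))).cls =
      ((stack L₀ L₁ L₂).addEdge (Sum.inr (.post a)) (Sum.inr (.post b))).cls := by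
  -- One foot moves at a time. In the intermediate position the feet are on different levels, hence
  -- in different polygons; only the initial and the final position need `hn₀` and `hn₁`.
  rw [cls_stack_addEdge_up a₀ a₁ hn₀, ← stack_swap,
    ← cls_stack_addEdge_down b₀ b₁ fun h => hn₁ h.symm]
  exact cls_addEdge_swap _ (Sum.inr_injective.ne fun h => hn₁ (by rw [h]; exact Equiv.Perm.SameCycle.refl _ _))

/-- A tube between two sheets which are joined by a saddle below is a handle. -/
theorem cls_stack_addEdge_upper {a b : E × Bool} (a₀ : around L₀ L₁ a ≠ a)
    (a₁ : around L₁ L₂ a ≠ a) (b₀ : around L₀ L₁ b ≠ b) (b₁ : around L₁ L₂ b ≠ b)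
    (hs : (elementary L₀ L₁).face.SameCycle (.post a) (.post b))
    (hn : ¬ (elementary L₁ L₂).face.SameCycle (.post a) (.post b)) :
    ((stack L₀ L₁ L₂).addEdge (Sum.inr (.post a)) (Sum.inr (.post b))).cls =
      ((stack L₀ L₁ L₂).addHandle (Sum.inr (.post a))).cls := by
  have hab : ElemDart.post a ≠ ElemDart.post b := fun h => hn (by rw [h]; exact Equiv.Perm.SameCycle.refl _ _)
  -- The foot at `b` descends into the polygon shared with `a`, moves inside it to `a`, and climbs
  -- to the upper square next to the other foot. There the tube joins adjacent polygons and is a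
  -- handle.
  calc _ = ((stack L₀ L₁ L₂).addEdge (Sum.inr (.post b)) (Sum.inr (.post a))).cls :=
        cls_addEdge_swap _ (Sum.inr_injective.ne hab)
    _ = ((stack L₀ L₁ L₂).addEdge (Sum.inl (.post b)) (Sum.inr (.post a))).cls :=
        cls_stack_addEdge_down b₀ b₁ fun h => hn h.symm
    _ = ((stack L₀ L₁ L₂).addEdge (Sum.inl (.post a)) (Sum.inr (.post a))).cls :=
        cls_addEdge_rotate _ (stack_not_sameCycle (by simp [stackLabel, squareLabel]))
          ((sameCycle_sumCongr_inl (f := (elementary L₀ L₁).face) (g := (elementary L₁ L₂).face)).2 hs.symm)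
    _ = ((stack L₀ L₁ L₂).addEdge (Sum.inl (.wall a)) (Sum.inr (.post a))).cls :=
        cls_addEdge_of_adjacent (stack_adjacent_lower a₀)
          (stack_not_sameCycle (by simp [stackLabel, squareLabel]))
          (stack_not_sameCycle (by simp [stackLabel, squareLabel]))
    _ = ((stack L₀ L₁ L₂).addEdge (Sum.inr (.wall a)) (Sum.inr (.post a))).cls :=
        cls_addEdge_of_adjacent (stack_adjacent_middle a)
          (stack_not_sameCycle (by simp [stackLabel, squareLabel]))
          (stack_not_sameCycle (by simp [stackLabel, squareLabel]))
    _ = ((stack L₀ L₁ L₂).addEdge (Sum.inr (.post a)) (Sum.inr (.wall a))).cls :=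
        cls_addEdge_swap _ (Sum.inr_injective.ne nofun)
    _ = _ := (cls_addHandle_of_adjacent (stack_adjacent_upper a₁).symm).symm

/-- A tube between two sheets which are joined by a saddle above is a handle. -/
theorem cls_stack_addEdge_lower {a b : E × Bool} (a₀ : around L₀ L₁ a ≠ a)
    (a₁ : around L₁ L₂ a ≠ a) (b₀ : around L₀ L₁ b ≠ b) (b₁ : around L₁ L₂ b ≠ b)
    (hs : (elementary L₁ L₂).face.SameCycle (.post a) (.post b))
    (hn : ¬ (elementary L₀ L₁).face.SameCycle (.post a) (.post b)) :
    ((stack L₀ L₁ L₂).addEdge (Sum.inl (.post a)) (Sum.inl (.post b))).cls =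
      ((stack L₀ L₁ L₂).addHandle (Sum.inl (.post a))).cls := by
  have hab : ElemDart.post a ≠ ElemDart.post b := fun h => hn (by rw [h]; exact Equiv.Perm.SameCycle.refl _ _)
  -- The mirror image: the foot at `b` climbs, crosses over to `a` in the shared polygon above, and
  -- comes down to the lower square next to the other foot.
  calc _ = ((stack L₀ L₁ L₂).addEdge (Sum.inl (.post b)) (Sum.inl (.post a))).cls :=
        cls_addEdge_swap _ (Sum.inl_injective.ne hab)
    _ = ((stack L₀ L₁ L₂).addEdge (Sum.inr (.post b)) (Sum.inl (.post a))).cls :=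
        cls_stack_addEdge_up b₀ b₁ fun h => hn h.symm
    _ = ((stack L₀ L₁ L₂).addEdge (Sum.inr (.post a)) (Sum.inl (.post a))).cls :=
        cls_addEdge_rotate _ (stack_not_sameCycle (by simp [stackLabel, squareLabel]))
          ((sameCycle_sumCongr_inr (f := (elementary L₀ L₁).face) (g := (elementary L₁ L₂).face)).2 hs.symm)
    _ = ((stack L₀ L₁ L₂).addEdge (Sum.inr (.wall a)) (Sum.inl (.post a))).cls :=
        cls_addEdge_of_adjacent (stack_adjacent_upper a₁).symm
          (stack_not_sameCycle (by simp [stackLabel, squareLabel]))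
          (stack_not_sameCycle (by simp [stackLabel, squareLabel]))
    _ = ((stack L₀ L₁ L₂).addEdge (Sum.inl (.wall a)) (Sum.inl (.post a))).cls :=
        cls_addEdge_of_adjacent (stack_adjacent_middle a).symm
          (stack_not_sameCycle (by simp [stackLabel, squareLabel]))
          (stack_not_sameCycle (by simp [stackLabel, squareLabel]))
    _ = ((stack L₀ L₁ L₂).addEdge (Sum.inl (.post a)) (Sum.inl (.wall a))).cls :=
        cls_addEdge_swap _ (Sum.inl_injective.ne nofun)
    _ = _ := (cls_addHandle_of_adjacent (stack_adjacent_lower a₀)).symm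

end Elementary

end Bord

end GenusOne

/-! ### Saddles, and tube minus handle, at a crossing. -/

namespace GenusOne

namespace Bord

variable {Y₀ Y₁ : OrientedPoints} {W₀ W₁ W₂ : OneCob Y₀ Y₁} (k : Type*) [CommRing k]

lemma mor_eq_of_cls {S T : Bord W₀ W₁} (h : S.cls = T.cls) : S.mor k = T.mor k := by
  rw [mor, mor, lin, lin, h]

lemma mor_comp (S : Bord W₀ W₁) (T : Bord W₁ W₂) : S.mor k ≫ T.mor k = (S.comp T).mor k := by
  refine ((Quotient.functor (rel4Tu k Y₀ Y₁)).map_comp (S.lin k) (T.lin k)).symm.trans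
    (congrArg (Quotient.functor (rel4Tu k Y₀ Y₁)).map ?_)
  exact (Free.single_comp_single (R := k) (C := OneCob Y₀ Y₁) S.cls T.cls 1 1).trans
    (by rw [mul_one]; rfl)

lemma mor_cylinder (W : OneCob Y₀ Y₁) : (cylinder W).mor k = 𝟙 (W.obj k) :=
  (Quotient.functor (rel4Tu k Y₀ Y₁)).map_id _

end Bord

namespace TangleShadow

open Bord

variable (P : TangleShadow) (χ : Coloring P) (k : Type*) [CommRing k]
  {σ τ ρ : P.Crossing → Smoothing} {c : P.Crossing}

lemma around_crossing_of_isHead {q : Corner}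
    (h : IsHead (P.head χ) (P.ends.symm (Sum.inl (c, q)))) :
    around (P.linking χ σ) (P.linking χ τ) (P.ends.symm (Sum.inl (c, q))) =
      P.ends.symm (Sum.inl (c, (τ c).partner q)) :=
  around_of_isHead h (P.link_crossing τ c q)

lemma around_crossing_of_not_isHead {q : Corner}
    (h : ¬ IsHead (P.head χ) (P.ends.symm (Sum.inl (c, q)))) :
    around (P.linking χ σ) (P.linking χ τ) (P.ends.symm (Sum.inl (c, q))) =
      P.ends.symm (Sum.inl (c, (σ c).partner q)) :=
  around_of_not_isHead h (P.link_crossing σ c q)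

/-- A smoothing joins a corner to a different one, so no monogon occurs at a crossing. This is the
hypothesis of the sliding lemmas. -/
lemma around_crossing_ne (q : Corner) :
    around (P.linking χ σ) (P.linking χ τ) (P.ends.symm (Sum.inl (c, q))) ≠
      P.ends.symm (Sum.inl (c, q)) := by
  have key : ∀ r : Smoothing, P.ends.symm (Sum.inl (c, r.partner q)) ≠
      P.ends.symm (Sum.inl (c, q)) := fun r h => by
    have := (Prod.mk.inj (Sum.inl_injective (P.ends.symm.injective h))).2
    cases r <;> cases q <;> cases this
  by_cases h : IsHead (P.head χ) (P.ends.symm (Sum.inl (c, q)))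
  · rw [around_crossing_of_isHead P χ h]; exact key _
  · rw [around_crossing_of_not_isHead P χ h]; exact key _

/-- The left and the right sheet at a crossing smoothed as `V` are different. -/
lemma post_not_sameCycle (hσ : σ c = .V) (hτ : τ c = .V) :
    ¬ (P.saddle χ σ τ).face.SameCycle (P.post c .SW) (P.post c .SE) := by
  intro h
  -- The ends of the left arc are preserved by `around`. The claim is proved for every pair of
  -- smoothings that are `V` at `c`, because the inverse of the face map is `around` with the two
  -- exchanged.
  set X : P.Edge × Bool → Prop := fun a => a = P.ends.symm (Sum.inl (c, .SW)) ∨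
    a = P.ends.symm (Sum.inl (c, .NW)) with hX
  have key : ∀ {σ τ : P.Crossing → Smoothing}, σ c = .V → τ c = .V → ∀ a, X a →
      X (around (P.linking χ σ) (P.linking χ τ) a) := by
    rintro σ τ hσ hτ a (rfl | rfl)
    · right
      by_cases h : IsHead (P.head χ) (P.ends.symm (Sum.inl (c, .SW)))
      · rw [around_crossing_of_isHead P χ h, hτ]; rfl
      · rw [around_crossing_of_not_isHead P χ h, hσ]; rfl
    · left
      by_cases h : IsHead (P.head χ) (P.ends.symm (Sum.inl (c, .NW)))
      · rw [around_crossing_of_isHead P χ h, hτ]; rfl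
      · rw [around_crossing_of_not_isHead P χ h, hσ]; rfl
  have := label_eq_of_sameCycle (f := (P.saddle χ σ τ).face)
    (fun d : ElemDart P.Edge => ∃ a, d = .post a ∧ X a) (fun d => propext ?_) h
  · obtain ⟨a, ha, hXa⟩ := this.mp ⟨_, rfl, Or.inl rfl⟩
    rw [← ElemDart.post.inj ha] at hXa
    rcases hXa with h | h <;>
      cases (Prod.mk.inj (Sum.inl_injective (P.ends.symm.injective h))).2
  · constructor
    · rintro ⟨a, ha, hXa⟩
      rcases d with e | e | b | b
      · cases ha
      · cases ha
      · change elemFace (P.linking χ σ) (P.linking χ τ) (.wall b) = ElemDart.post a at ha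
        simp only [elemFace] at ha
        split_ifs at ha
      · obtain rfl := ElemDart.post.inj ha
        have := key hτ hσ _ hXa
        rw [around_around] at this
        exact ⟨b, rfl, this⟩
    · rintro ⟨a, rfl, hXa⟩
      exact ⟨_, rfl, key hσ hτ _ hXa⟩

lemma post_face_of_isHead {q : Corner} (h : IsHead (P.head χ) (P.ends.symm (Sum.inl (c, q)))) :
    (P.saddle χ σ τ).face.SameCycle (P.post c q) (P.post c ((τ c).partner q)) :=
  sameCycle_of_apply_eq (congrArg ElemDart.post (around_crossing_of_isHead P χ h))

lemma post_face_of_not_isHead {q : Corner}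
    (h : ¬ IsHead (P.head χ) (P.ends.symm (Sum.inl (c, q)))) :
    (P.saddle χ σ τ).face.SameCycle (P.post c q) (P.post c ((σ c).partner q)) :=
  sameCycle_of_apply_eq (congrArg ElemDart.post (around_crossing_of_not_isHead P χ h))

/-- A saddle joins the left and the right sheet. -/
lemma post_sameCycle (h : σ c = .H ∧ τ c = .V ∨ σ c = .V ∧ τ c = .H) :
    (P.saddle χ σ τ).face.SameCycle (P.post c .SW) (P.post c .SE) := by
  have hV := P.isHead_partner χ c .V
  have hH := P.isHead_partner χ c .H
  have h1 := hV .SW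
  have h2 := hV .SE
  have h3 := hH .SW
  simp only [Smoothing.partner] at h1 h2 h3
  -- The polygon of the saddle is a quadrilateral through all four corners; the colouring decides in
  -- which direction it is traversed.
  by_cases hs : IsHead (P.head χ) (P.ends.symm (Sum.inl (c, .SW)))
  · have f1 := P.post_face_of_isHead χ (σ := σ) (τ := τ) hs
    have f2 := P.post_face_of_not_isHead χ (σ := σ) (τ := τ) (c := c) (q := .NW) (by tauto)
    have f3 := P.post_face_of_isHead χ (σ := σ) (τ := τ) (c := c) (q := .NE) (by tauto)
    rcases h with ⟨e1, e2⟩ | ⟨e1, e2⟩ <;> rw [e2] at f1 f3 <;> rw [e1] at f2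
    · exact f1.trans (f2.trans f3)
    · exact f1
  · have f1 := P.post_face_of_not_isHead χ (σ := σ) (τ := τ) hs
    have f2 := P.post_face_of_isHead χ (σ := σ) (τ := τ) (c := c) (q := .NW) (by tauto)
    have f3 := P.post_face_of_not_isHead χ (σ := σ) (τ := τ) (c := c) (q := .NE) (by tauto)
    rcases h with ⟨e1, e2⟩ | ⟨e1, e2⟩ <;> rw [e1] at f1 f3 <;> rw [e2] at f2
    · exact f1
    · exact f1.trans (f2.trans f3)

lemma link_eq_or {a : P.Edge × Bool} (h : ∀ x, σ x = τ x ∨ τ x = ρ x) :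
    P.link σ a = P.link τ a ∨ P.link τ a = P.link ρ a := by
  obtain ⟨v, rfl⟩ := P.ends.symm.surjective a
  rcases v with ⟨x, q⟩ | ⟨j, b⟩ | z
  · simp only [link_crossing]
    exact (h x).imp (fun h => by rw [h]) fun h => by rw [h]
  · simp [link_joint]
  · simp [link_boundary]

/-- Saddles at different crossings can be performed simultaneously, whereas two successive saddles
at one crossing do not form an elementary bordism; hence the condition at each `x`. -/
lemma cls_saddle_comp (h : ∀ x, σ x = τ x ∨ τ x = ρ x) :
    ((P.saddle χ σ τ).comp (P.saddle χ τ ρ)).cls = (P.saddle χ σ ρ).cls :=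
  cls_elementary_comp (fun _ => P.link_eq_or h) rfl rfl

lemma saddle_comp (h : ∀ x, σ x = τ x ∨ τ x = ρ x) :
    (P.saddle χ σ τ).mor k ≫ (P.saddle χ τ ρ).mor k = (P.saddle χ σ ρ).mor k :=
  (mor_comp k _ _).trans (mor_eq_of_cls k (P.cls_saddle_comp χ h))

/-- The first cobordism minus the second one. -/
noncomputable def phi (σ τ : P.Crossing → Smoothing) (c : P.Crossing) :
    (P.smoothed χ σ).obj k ⟶ (P.smoothed χ τ).obj k :=
  (P.tubeBord χ σ τ c).mor k - (P.handleBord χ σ τ c).mor k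

/-- Once the tube has been slid into the upper bordism, only a collar is left below. -/
lemma tube_comp_saddle (hσ : σ c = .V) (hτ : τ c = .V) :
    ((P.tubeBord χ σ σ c).comp (P.saddle χ σ τ)).cls = (P.tubeBord χ σ τ c).cls := by
  exact (cls_addEdge_comp _ _ _ _).trans <| (cls_stack_addEdge (P.around_crossing_ne χ _)
    (P.around_crossing_ne χ _) (P.around_crossing_ne χ _) (P.around_crossing_ne χ _) 
    (P.post_not_sameCycle χ hσ hσ) (P.post_not_sameCycle χ hσ hτ)).trans <| (cls_comp_addEdge _ _ _ _).symm.trans (cls_cylinder_comp _)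

lemma saddle_comp_tube (hσ : σ c = .V) (hτ : τ c = .V) :
    ((P.saddle χ σ τ).comp (P.tubeBord χ τ τ c)).cls = (P.tubeBord χ σ τ c).cls := by
  exact (cls_comp_addEdge _ _ _ _).trans <| (cls_stack_addEdge (P.around_crossing_ne χ _)
    (P.around_crossing_ne χ _) (P.around_crossing_ne χ _) (P.around_crossing_ne χ _)
    (P.post_not_sameCycle χ hσ hτ) (P.post_not_sameCycle χ hτ hτ)).symm.trans <|
    (cls_addEdge_comp _ _ _ _).symm.trans (cls_comp_cylinder _)

lemma handle_comp_saddle :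
    ((P.handleBord χ σ σ c).comp (P.saddle χ σ τ)).cls = (P.handleBord χ σ τ c).cls :=
  (cls_addHandle_comp _ _ _).trans <| (cls_stack_addHandle (P.around_crossing_ne χ _)
    (P.around_crossing_ne χ _)).trans <|
    (cls_comp_addHandle _ _ _).symm.trans (cls_cylinder_comp _)

lemma saddle_comp_handle :
    ((P.saddle χ σ τ).comp (P.handleBord χ τ τ c)).cls = (P.handleBord χ σ τ c).cls :=
  (cls_comp_addHandle _ _ _).trans <| (cls_stack_addHandle (P.around_crossing_ne χ _)
    (P.around_crossing_ne χ _)).symm.trans <|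
    (cls_addHandle_comp _ _ _).symm.trans (cls_comp_cylinder _)

/-- Below, the saddle puts the two posts into one polygon; above, in the product, they lie in two.
This is the situation of `cls_stack_addEdge_upper`. -/
lemma saddle_comp_tube_of_H (hσ : σ c = .H) (hτ : τ c = .V) :
    ((P.saddle χ σ τ).comp (P.tubeBord χ τ τ c)).cls =
      ((P.saddle χ σ τ).comp (P.handleBord χ τ τ c)).cls :=
  (cls_comp_addEdge _ _ _ _).trans <| (cls_stack_addEdge_upper (P.around_crossing_ne χ _)
    (P.around_crossing_ne χ _) (P.around_crossing_ne χ _) (P.around_crossing_ne χ _)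
    (P.post_sameCycle χ (Or.inl ⟨hσ, hτ⟩)) (P.post_not_sameCycle χ hτ hτ)).trans
    (cls_comp_addHandle _ _ _).symm

lemma tube_comp_saddle_of_H (hσ : σ c = .V) (hτ : τ c = .H) :
    ((P.tubeBord χ σ σ c).comp (P.saddle χ σ τ)).cls =
      ((P.handleBord χ σ σ c).comp (P.saddle χ σ τ)).cls :=
  (cls_addEdge_comp _ _ _ _).trans <| (cls_stack_addEdge_lower (P.around_crossing_ne χ _)
    (P.around_crossing_ne χ _) (P.around_crossing_ne χ _) (P.around_crossing_ne χ _)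
    (P.post_sameCycle χ (Or.inr ⟨hσ, hτ⟩)) (P.post_not_sameCycle χ hσ hσ)).trans
    (cls_addHandle_comp _ _ _).symm

/-- For `σ ≠ τ` the morphism `phi χ k σ τ c` is the common value of the two composites, with tube
minus handle placed before or after the saddles away from `c`. -/
lemma phi_comp_saddle (hσ : σ c = .V) (hτ : τ c = .V) :
    P.phi χ k σ σ c ≫ (P.saddle χ σ τ).mor k = P.phi χ k σ τ c := by
  rw [phi, phi, Preadditive.sub_comp, mor_comp, mor_comp,
    mor_eq_of_cls k (P.tube_comp_saddle χ hσ hτ), mor_eq_of_cls k (P.handle_comp_saddle χ)]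

lemma saddle_comp_phi (hσ : σ c = .V) (hτ : τ c = .V) :
    (P.saddle χ σ τ).mor k ≫ P.phi χ k τ τ c = P.phi χ k σ τ c := by
  rw [phi, phi, Preadditive.comp_sub, mor_comp, mor_comp,
    mor_eq_of_cls k (P.saddle_comp_tube χ hσ hτ), mor_eq_of_cls k (P.saddle_comp_handle χ)]

lemma saddle_comp_phi_of_H (hσ : σ c = .H) (hτ : τ c = .V) :
    (P.saddle χ σ τ).mor k ≫ P.phi χ k τ τ c = 0 := by
  rw [phi, Preadditive.comp_sub, mor_comp, mor_comp,
    mor_eq_of_cls k (P.saddle_comp_tube_of_H χ hσ hτ), sub_self]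

lemma phi_comp_saddle_of_H (hσ : σ c = .V) (hτ : τ c = .H) :
    P.phi χ k σ σ c ≫ (P.saddle χ σ τ).mor k = 0 := by
  rw [phi, Preadditive.sub_comp, mor_comp, mor_comp,
    mor_eq_of_cls k (P.tube_comp_saddle_of_H χ hσ hτ), sub_self]

lemma saddle_self (σ : P.Crossing → Smoothing) :
    (P.saddle χ σ σ).mor k = 𝟙 ((P.smoothed χ σ).obj k) := mor_cylinder k _

end TangleShadow

end GenusOne

/-! ### Euler characteristics. -/

namespace GenusOne

section Orbits

variable {D : Type} [Finite D]

/-- The cycles of a permutation. -/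
abbrev Orbits (f : D → D) : Type := Quot fun d d' : D => f d = d'

lemma orbits_mk_eq {f : Equiv.Perm D} {a b : D} (h : f.SameCycle a b) :
    (Quot.mk _ a : Orbits f) = Quot.mk _ b :=
  label_eq_of_sameCycle (fun d => (Quot.mk _ d : Orbits f)) (fun x => (Quot.sound (r := fun d d' : D => f d = d') (a := x) rfl).symm) h

-- The tube merges the cycles of `u` and `v`. The old cycles are matched with the new ones and an
-- extra element `none`, which stands for the old cycle of `v`.
open Classical in
lemma card_orbits_addEdge_of_not_sameCycle {f : Equiv.Perm D} {u v : D}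
    (h : ¬ f.SameCycle u v) :
    Nat.card (Orbits (addEdgePerm f u v)) + 1 = Nat.card (Orbits f) := by
  have huv := ne_of_not_sameCycle h
  have hst : ∀ d, f.SameCycle (f d) v ↔ f.SameCycle d v := fun d =>
    Equiv.Perm.sameCycle_apply_left
  rw [← Finite.card_option]
  refine Nat.card_congr ⟨fun o => o.elim (Quot.mk _ v) (Quot.lift
    (fun d => Quot.mk _ (Sum.elim (fun d => if f.SameCycle d v then u else d) (fun _ => u) d)) ?_),
    Quot.lift (fun d => if f.SameCycle d v then none else some (Quot.mk _ (Sum.inl d))) ?_,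
    ?_, ?_⟩
  · rintro (d | _ | _) _ rfl
    · by_cases hu : d = u
      · subst hu
        simp [h]
      · by_cases hv : d = v
        · subst hv
          rw [addEdgePerm_right f huv]
          simp [Equiv.Perm.SameCycle.refl]
        · rw [addEdgePerm_other f hu hv]
          by_cases hd : f.SameCycle d v
          · simp [hd, hst]
          · simp only [Sum.elim_inl, hd, hst, if_false]
            exact Quot.sound rfl
    · simp [hst, Equiv.Perm.SameCycle.refl]
    · rw [addEdgePerm_true, if_neg huv]
      simp only [Sum.elim_inl, Sum.elim_inr, hst, h, if_false]
      exact Quot.sound rfl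
  · rintro d _ rfl
    by_cases hd : f.SameCycle d v
    · simp [hd, hst]
    · simp only [hd, hst, if_false]
      exact congrArg some (orbits_mk_eq (addEdgePerm_sameCycle_inl h (sameCycle_apply d)))
  · rintro (_ | q)
    · exact if_pos (Equiv.Perm.SameCycle.refl _ _)
    obtain ⟨d | _ | _⟩ := q
    · by_cases hd : f.SameCycle d v
      · simp only [Option.elim, Sum.elim_inl, hd, if_true, h, if_false]
        exact congrArg some (orbits_mk_eq ((addEdgePerm_sameCycle_join h).trans
          (addEdgePerm_sameCycle_inl h hd.symm)))
      · simp only [Option.elim, Sum.elim_inl, hd, if_false]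
    · simp only [Option.elim, Sum.elim_inr, h, if_false]
      exact congrArg some (orbits_mk_eq addEdgePerm_sameCycle_left)
    · simp only [Option.elim, Sum.elim_inr, h, if_false]
      exact congrArg some (orbits_mk_eq ((addEdgePerm_sameCycle_join h).trans
        (addEdgePerm_sameCycle_right huv)))
  · rintro ⟨d⟩
    by_cases hd : f.SameCycle d v
    · simp only [hd, if_true]
      exact orbits_mk_eq hd.symm
    · simp only [hd, if_false, Option.elim, Sum.elim_inl]

/-- The additional cycle is the monogon `inr true`, matched with `none`. -/
lemma card_orbits_addEdge_self (f : Equiv.Perm D) (u : D) :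
    Nat.card (Orbits (addEdgePerm f u u)) = Nat.card (Orbits f) + 1 := by
  rw [← Finite.card_option]
  refine Nat.card_congr ⟨Quot.lift (Sum.elim (fun d => some (Quot.mk _ d))
    (fun b => if b then none else some (Quot.mk _ u))) ?_,
    fun o => o.elim (Quot.mk _ (Sum.inr true)) (Quot.lift (fun d => Quot.mk _ (Sum.inl d)) ?_),
    ?_, ?_⟩
  · rintro (d | _ | _) _ rfl
    · by_cases hu : d = u
      · subst hu
        simp
      · rw [addEdgePerm_other f hu hu]
        exact congrArg some (Quot.sound rfl)
    · exact congrArg some (Quot.sound rfl)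
    · rw [addEdgePerm_true, if_pos rfl]
  · rintro d _ rfl
    exact orbits_mk_eq (addEdgePerm_self_sameCycle_inl_iff.2 (sameCycle_apply d))
  · rintro ⟨d | _ | _⟩
    · rfl
    · exact orbits_mk_eq addEdgePerm_sameCycle_left
    · rfl
  · rintro (_ | q)
    · rfl
    · obtain ⟨d⟩ := q
      rfl

/-- The number of orbits of an involution, given a set which contains exactly one element of each
orbit with two elements. -/
lemma card_orbits_of_involutive_aux {f : D → D} (hf : Function.Involutive f) (p : D → Prop)
    (hp : ∀ a, f a = a ∨ (p (f a) ↔ ¬ p a)) :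
    Nat.card {a // p a} + Nat.card {a // f a = a ∧ ¬ p a} = Nat.card (Orbits f) := by
  rw [← Nat.card_sum]
  refine Nat.card_congr (Equiv.ofBijective
    (Sum.elim (fun a => (Quot.mk _ a.1 : Orbits f)) (fun a => Quot.mk _ a.1)) ⟨?_, ?_⟩)
  · have key : ∀ a b : D, (Quot.mk _ a : Orbits f) = Quot.mk _ b → a = b ∨ f a = b := by
      intro a b h
      -- The set `{a, f a}` is an invariant of the orbit, from which equality in the quotient can be
      -- read off.
      have := congrArg (Quot.lift (fun a => ({a, f a} : Set D)) (by
        rintro a _ rfl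
        rw [hf a, Set.pair_comm])) h
      have hb : b ∈ ({a, f a} : Set D) := by
        rw [show ({a, f a} : Set D) = {b, f b} from this]
        exact Set.mem_insert _ _
      exact hb.imp Eq.symm Eq.symm
    rintro (⟨a, ha⟩ | ⟨a, ha, ha'⟩) (⟨b, hb⟩ | ⟨b, hb, hb'⟩) h
    · have := hp a
      rcases key a b h with rfl | rfl
      · rfl
      · rcases this with h | h
        · simp [h]
        · exact absurd ha (h.1 hb)
    · rcases key b a h.symm with rfl | rfl
      · exact absurd ha hb'
      · exact absurd (hb ▸ ha) hb'
    · rcases key a b h with rfl | rfl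
      · exact absurd hb ha'
      · exact absurd (ha ▸ hb) ha'
    · rcases key a b h with rfl | rfl
      · rfl
      · simp [ha]
  · rintro ⟨a⟩
    by_cases h : p a
    · exact ⟨Sum.inl ⟨a, h⟩, rfl⟩
    · rcases hp a with h1 | h1
      · exact ⟨Sum.inr ⟨a, h1, h⟩, rfl⟩
      · exact ⟨Sum.inl ⟨f a, h1.2 h⟩, (Quot.sound (r := fun d d' : D => f d = d') (a := a) rfl).symm⟩

/-- The auxiliary count, applied to `p` and to its complement and added up, sees every element once
and every fixed point once more. -/
lemma card_orbits_of_involutive {f : D → D} (hf : Function.Involutive f) (p : D → Prop)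
    (hp : ∀ a, f a = a ∨ (p (f a) ↔ ¬ p a)) :
    2 * Nat.card (Orbits f) = Nat.card D + Nat.card {a // f a = a} := by
  classical
  have h1 := card_orbits_of_involutive_aux hf p hp
  have h2 := card_orbits_of_involutive_aux hf (fun a => ¬ p a) fun a => by
    rcases hp a with h | h
    · exact Or.inl h
    · right; tauto
  have h3 : Nat.card {a // p a} + Nat.card {a // ¬ p a} = Nat.card D := by
    rw [← Nat.card_sum]
    exact Nat.card_congr (Equiv.sumCompl p)
  have h4 : Nat.card {a // f a = a ∧ ¬ ¬ p a} + Nat.card {a // f a = a ∧ ¬ p a} =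
      Nat.card {a // f a = a} := by
    rw [← Nat.card_sum]
    refine Nat.card_congr (((Equiv.subtypeSubtypeEquivSubtypeInter (fun a => f a = a)
      fun a => ¬ ¬ p a).symm.sumCongr (Equiv.subtypeSubtypeEquivSubtypeInter (fun a => f a = a)
      fun a => ¬ p a).symm).trans ?_)
    exact (Equiv.sumComm _ _).trans (Equiv.sumCompl fun a : {a // f a = a} => ¬ p a.1)
  omega

end Orbits

namespace Bord

variable {Y₀ Y₁ : OrientedPoints} {W₀ W₁ : OneCob Y₀ Y₁} (S : Bord W₀ W₁)

lemma numFaces_addEdge_of_not_sameCycle {u v : S.Dart} (h : ¬ S.face.SameCycle u v) :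
    (S.addEdge u v).numFaces + 1 = S.numFaces := card_orbits_addEdge_of_not_sameCycle h

lemma numFaces_addEdge_self (u : S.Dart) : (S.addEdge u u).numFaces = S.numFaces + 1 :=
  card_orbits_addEdge_self S.face u

/-- The edges of a polygonal surface. -/
abbrev Edges {D L : Type} (g : D → D ⊕ L) : Type := Quot fun d d' : D => g d = Sum.inl d'

/-- The vertices of a polygonal surface. -/
abbrev Vertices {D L : Type} (f : D → D) (g : D → D ⊕ L) : Type :=
  Quot fun d d' : D => ∃ m, g d = Sum.inl m ∧ f m = d'

lemma addEdgeGlue_inl {D L : Type} {g : D → D ⊕ L} {d a : D} (h : g d = Sum.inl a) :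
    addEdgeGlue g (Sum.inl d) = Sum.inl (Sum.inl a) := by
  simp [addEdgeGlue, h]

lemma exists_of_addEdgeGlue_inl {D L : Type} {g : D → D ⊕ L} {d : D} {m : D ⊕ Bool}
    (h : addEdgeGlue g (Sum.inl d) = Sum.inl m) : ∃ a, g d = Sum.inl a ∧ m = Sum.inl a := by
  rcases hd : g d with a | l
  · rw [addEdgeGlue_inl hd] at h
    exact ⟨a, rfl, (Sum.inl_injective h).symm⟩
  · simp [addEdgeGlue, hd] at h

lemma card_edges_addEdge {D L : Type} [Finite D] (g : D → D ⊕ L) :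
    Nat.card (Edges (addEdgeGlue g)) = Nat.card (Edges g) + 1 := by
  rw [← Finite.card_option]
  refine Nat.card_congr ⟨Quot.lift (Sum.elim (fun d => some (Quot.mk _ d)) fun _ => none) ?_,
    fun o => o.elim (Quot.mk _ (Sum.inr true))
      (Quot.lift (fun d => Quot.mk _ (Sum.inl d)) ?_), ?_, ?_⟩
  · rintro (d | b) d' h
    · obtain ⟨a, hd, rfl⟩ := exists_of_addEdgeGlue_inl h
      exact congrArg some (Quot.sound hd)
    · obtain rfl : Sum.inr (!b) = d' := Sum.inl_injective h
      rfl
  · intro d d' h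
    exact Quot.sound (addEdgeGlue_inl h)
  · rintro ⟨d | _ | _⟩
    · rfl
    · exact Quot.sound (r := fun d d' => addEdgeGlue g d = Sum.inl d') rfl
    · rfl
  · rintro (_ | q)
    · rfl
    · obtain ⟨d⟩ := q
      rfl

/-- The ends of the new edge are old vertices: `inr false` starts where `f u` does, and `inr true`
where `f v` does. -/
lemma card_vertices_addEdge {D L : Type} [Finite D] (f : Equiv.Perm D) (g : D → D ⊕ L)
    (u v : D) :
    Nat.card (Vertices (addEdgePerm f u v) (addEdgeGlue g)) = Nat.card (Vertices f g) := by
  classical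
  have sound : ∀ {d m d' : D ⊕ Bool}, addEdgeGlue g d = Sum.inl m → addEdgePerm f u v m = d' →
      (Quot.mk _ d : Vertices (addEdgePerm f u v) (addEdgeGlue g)) = Quot.mk _ d' :=
    fun h h' => Quot.sound ⟨_, h, h'⟩
  have hfalse : (Quot.mk _ (Sum.inr false) : Vertices (addEdgePerm f u v) (addEdgeGlue g)) =
      Quot.mk _ (Sum.inl (f u)) := by
    by_cases huv : u = v
    · subst huv
      exact (sound (m := Sum.inr true) rfl (by rw [addEdgePerm_true, if_pos rfl])).trans
        (sound (m := Sum.inr false) rfl rfl)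
    · exact sound (m := Sum.inr true) rfl (by rw [addEdgePerm_true, if_neg huv])
  have htrue : (Quot.mk _ (Sum.inr true) : Vertices (addEdgePerm f u v) (addEdgeGlue g)) =
      Quot.mk _ (Sum.inl (f v)) := sound (m := Sum.inr false) rfl rfl
  refine Nat.card_congr ⟨Quot.lift (Sum.elim (fun d => Quot.mk _ d)
    fun b => Quot.mk _ (f (if b then v else u))) ?_,
    Quot.lift (fun d => Quot.mk _ (Sum.inl d)) ?_, ?_, ?_⟩
  · rintro (d | _ | _) d' ⟨m, hm, rfl⟩
    · obtain ⟨a, hd, rfl⟩ := exists_of_addEdgeGlue_inl hm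
      have : (Quot.mk _ d : Vertices f g) = Quot.mk _ (f a) := Quot.sound ⟨a, hd, rfl⟩
      rw [addEdgePerm_inl]
      split_ifs with h1 h2
      · subst h1; exact this
      · subst h2; exact this
      · exact this
    · obtain rfl : Sum.inr true = m := Sum.inl_injective hm
      rw [addEdgePerm_true]
      split_ifs with h1
      · subst h1; rfl
      · rfl
    · obtain rfl : Sum.inr false = m := Sum.inl_injective hm
      rfl
  · rintro d _ ⟨m, hm, rfl⟩
    refine (sound (addEdgeGlue_inl hm) rfl).trans ?_
    rw [addEdgePerm_inl]
    split_ifs with h2 h3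
    · subst h2; exact hfalse
    · subst h3; exact htrue
    · rfl
  · rintro ⟨d | _ | _⟩
    · rfl
    · exact hfalse.symm
    · exact htrue.symm
  · rintro ⟨d⟩
    rfl

lemma numEdges_addEdge (u v : S.Dart) : (S.addEdge u v).numEdges = S.numEdges + 1 := by
  rw [numEdges, addEdge_glue]
  exact card_edges_addEdge S.glue

lemma numVertices_addEdge (u v : S.Dart) : (S.addEdge u v).numVertices = S.numVertices := by
  rw [numVertices, addEdge_glue, addEdge_face]
  exact card_vertices_addEdge S.face S.glue u v

/-- The tube adds an edge, loses a polygon and leaves the vertices alone. -/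
lemma degree_addEdge_of_not_sameCycle {u v : S.Dart} (h : ¬ S.face.SameCycle u v) :
    (S.addEdge u v).degree = S.degree - 2 := by
  have := S.numFaces_addEdge_of_not_sameCycle h
  rw [degree, degree, eulerChar, eulerChar, numEdges_addEdge, numVertices_addEdge, ← this]
  push_cast
  ring

lemma degree_addEdge_self (u : S.Dart) : (S.addEdge u u).degree = S.degree := by
  rw [degree, degree, eulerChar, eulerChar, numEdges_addEdge, numVertices_addEdge,
    numFaces_addEdge_self]
  push_cast
  ring

/-- The loop costs nothing, since it creates one edge and one polygon; the tube from the monogon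
costs 2. -/
lemma degree_addHandle (u : S.Dart) : (S.addHandle u).degree = S.degree - 2 := by
  refine (degree_addEdge_of_not_sameCycle (S.addEdge u u) ?_).trans
    (congrArg (· - 2) (S.degree_addEdge_self u))
  exact addEdgePerm_self_not_sameCycle_true (Sum.inr_injective.ne (by simp))

section Cylinder

variable {E : Type} {head : E → Bool} (L : Linking Y₀ Y₁ E head)

/-- A linked end is never fixed, because a link joins a head to a tail. -/
lemma around_self_eq_iff (a : E × Bool) : around L L a = a ↔ ∃ y, L.link a = Sum.inr y := by
  constructor
  · intro h
    rcases hl : L.link a with b | y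
    · by_cases ha : IsHead head a
      · rw [around_of_isHead ha hl] at h
        exact absurd ((L.orient _ _ hl).1 (h ▸ ha)) (fun h => h ha)
      · rw [around_of_not_isHead ha hl] at h
        exact absurd ((L.orient _ _ hl).2 ha) (h ▸ ha)
    · exact ⟨y, rfl⟩
  · rintro ⟨y, hy⟩
    exact around_eq_self hy hy

variable [Finite E]

/-- Each vertex is the initial vertex of exactly one post. -/
lemma numVertices_elementary : (elementary L L).numVertices = Nat.card (E × Bool) := by
  have hh := isHead_head (head := head)
  have ht := not_isHead_tail (head := head)
  refine Nat.card_congr ⟨Quot.lift (fun d : ElemDart E => match d with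
    | .bot e => (e, head e)
    | .top e => (e, !(head e))
    | .wall a => around L L a
    | .post a => a) ?_, fun a => Quot.mk _ (ElemDart.post a), ?_, fun a => rfl⟩
  · rintro (e | e | a | a) d' ⟨m, hm, rfl⟩
    · cases hm
    · cases hm
    · obtain rfl : ElemDart.post a = m := Sum.inl_injective hm
      rfl
    · obtain rfl : ElemDart.wall a = m := Sum.inl_injective hm
      by_cases h : IsHead head a
      · have : elemFace L L (.wall a) = .bot a.1 := if_pos h
        rw [elementary_face, this]
        exact (eq_head_of_isHead h).symm
      · have : elemFace L L (.wall a) = .top a.1 := if_neg h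
        rw [elementary_face, this]
        exact (eq_tail_of_not_isHead h).symm
  · rintro ⟨e | e | a | a⟩
    · exact Quot.sound ⟨ElemDart.wall _, rfl, if_pos (hh e)⟩
    · exact Quot.sound ⟨ElemDart.wall _, rfl, if_neg (ht e)⟩
    · exact (Quot.sound ⟨ElemDart.post _, rfl, rfl⟩).symm
    · rfl

lemma numEdges_elementary :
    (elementary L L).numEdges = Nat.card (E ⊕ (E ⊕ E × Bool)) := by
  refine Nat.card_congr ⟨Quot.lift (fun d : ElemDart E => match d with
    | .bot e => Sum.inl e
    | .top e => Sum.inr (Sum.inl e)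
    | .wall a => Sum.inr (Sum.inr a)
    | .post a => Sum.inr (Sum.inr a)) ?_, Sum.elim (fun e => Quot.mk _ (ElemDart.bot e))
      (Sum.elim (fun e => Quot.mk _ (ElemDart.top e)) fun a => Quot.mk _ (ElemDart.post a)),
      ?_, ?_⟩
  · rintro (e | e | a | a) d' hm
    · cases hm
    · cases hm
    · obtain rfl : ElemDart.post a = d' := Sum.inl_injective hm
      rfl
    · obtain rfl : ElemDart.wall a = d' := Sum.inl_injective hm
      rfl
  · rintro ⟨e | e | a | a⟩
    · rfl
    · rfl
    · exact Quot.sound rfl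
    · rfl
  · rintro (e | e | a) <;> rfl

lemma numFaces_elementary :
    (elementary L L).numFaces = Nat.card (E ⊕ Orbits (around L L)) := by
  have hh := isHead_head (head := head)
  have ht := not_isHead_tail (head := head)
  refine Nat.card_congr ⟨Quot.lift (fun d : ElemDart E => match d with
    | .bot e => Sum.inl e
    | .top e => Sum.inl e
    | .wall a => Sum.inl a.1
    | .post a => Sum.inr (Quot.mk _ a)) ?_, Sum.elim (fun e => Quot.mk _ (ElemDart.bot e))
      (Quot.lift (fun a => Quot.mk _ (ElemDart.post a)) ?_), ?_, ?_⟩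
  · rintro (e | e | a | a) _ rfl
    · rfl
    · rfl
    · rw [elementary_face]
      simp only [elemFace]
      split_ifs <;> rfl
    · exact congrArg Sum.inr (Quot.sound rfl)
  · rintro a _ rfl
    exact Quot.sound rfl
  · rintro ⟨e | e | a | a⟩
    · rfl
    · exact orbits_mk_eq (elementary_wall_sameCycle (e, head e) (.bot e) (Or.inl rfl)).symm |>.trans
        (orbits_mk_eq (elementary_wall_sameCycle (e, head e) (.top e) (Or.inr rfl)))
    · exact orbits_mk_eq (elementary_wall_sameCycle a (.bot a.1) (Or.inl rfl)).symm
    · rfl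
  · rintro (e | q)
    · rfl
    · obtain ⟨a⟩ := q
      rfl

lemma card_orbits_around :
    2 * Nat.card (Orbits (around L L)) = Nat.card (E × Bool) + Nat.card (Y₀.pt ⊕ Y₁.pt) := by
  rw [card_orbits_of_involutive (around_around L L) (IsHead head)]
  · congr 1
    refine (Nat.card_congr (Equiv.ofBijective
      (fun y => ⟨L.att y, (around_self_eq_iff L _).2 ⟨y, L.link_att y⟩⟩) ⟨?_, ?_⟩)).symm
    · intro y y' h
      have h1 : L.att y = L.att y' := congrArg Subtype.val h
      exact Sum.inr_injective ((L.link_att y).symm.trans ((congrArg L.link h1).trans (L.link_att y')))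
    · rintro ⟨a, ha⟩
      obtain ⟨y, hy⟩ := (around_self_eq_iff L a).1 ha
      exact ⟨y, Subtype.ext (L.att_link _ _ hy)⟩
  · intro a
    rcases hl : L.link a with b | y
    · right
      by_cases ha : IsHead head a
      · rw [around_of_isHead ha hl]; exact L.orient _ _ hl
      · rw [around_of_not_isHead ha hl]; exact L.orient _ _ hl
    · exact Or.inl (around_eq_self hl hl)

/-- The Euler degree of a product with `[0,1]`. -/
lemma degree_elementary : (elementary L L).degree = 0 := by
  -- With `n` edges in the `1`-manifold and `y` boundary points there are `2n` vertices, `4n` edges,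
  -- `n` squares and `n + y/2` polygons of posts. The Euler characteristic is therefore `y/2`, which
  -- the normalisation of the degree subtracts.
  have h := card_orbits_around L
  have h' : (2 : ℚ) * Nat.card (Orbits (around L L)) =
    Nat.card E * 2 + Nat.card (Y₀.pt ⊕ Y₁.pt) := by
    have := congrArg (Nat.cast (R := ℚ)) h
    simpa [Nat.card_prod] using this
  rw [degree, eulerChar, numVertices_elementary, numEdges_elementary, numFaces_elementary,
    Nat.card_sum, Nat.card_sum, Nat.card_sum, Nat.card_prod]
  have : Nat.card Bool = 2 := by simp
  rw [this]
  push_cast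
  linarith

end Cylinder

end Bord

namespace TangleShadow

open Bord

variable (P : TangleShadow) (χ : Coloring P) (k : Type*) [CommRing k]
  {σ τ : P.Crossing → Smoothing} {c : P.Crossing}

lemma degree_tubeBord (h : σ = τ) (hσ : σ c = .V) : (P.tubeBord χ σ τ c).degree = -2 := by
  subst h
  refine (degree_addEdge_of_not_sameCycle _ (P.post_not_sameCycle χ hσ hσ)).trans ?_
  rw [saddle, degree_elementary]
  norm_num

lemma degree_handleBord (h : σ = τ) : (P.handleBord χ σ τ c).degree = -2 := by
  subst h
  refine (degree_addHandle _ _).trans ?_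
  rw [saddle, degree_elementary]
  norm_num

end TangleShadow

end GenusOne

/-! ### Exterior signs, and the bracket as a complex. -/

namespace GenusOne

section Signs

variable {C : Type} [LinearOrder C] {s : Finset C} {a b : C}

lemma wedgeSign_of_mem (h : a ∈ s) : wedgeSign s a = 0 := if_pos h

lemma notMem_of_wedgeSign_ne (h : wedgeSign s a ≠ 0) : a ∉ s := fun h' => h (wedgeSign_of_mem h')

lemma mem_of_checkSign_ne (h : checkSign s a ≠ 0) : a ∈ s := by
  by_contra h'
  exact h (if_neg h')

lemma card_filter_insert (ha : a ∉ s) :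
    ((-1 : ℤ)) ^ ((insert a s).filter (fun x => x < b)).card =
      (if a < b then -1 else 1) * (-1) ^ (s.filter (fun x => x < b)).card := by
  rw [Finset.filter_insert]
  split_ifs with h
  · rw [Finset.card_insert_of_notMem (fun h' => ha (Finset.mem_filter.1 h').1), pow_succ, mul_comm]
  · rw [one_mul]

lemma wedgeSign_insert (hab : a ≠ b) (ha : a ∉ s) :
    wedgeSign (insert a s) b = (if a < b then -1 else 1) * wedgeSign s b := by
  simp only [wedgeSign, Finset.mem_insert, hab.symm, false_or, card_filter_insert ha]
  split_ifs <;> simp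

lemma checkSign_insert (hab : a ≠ b) (ha : a ∉ s) :
    checkSign (insert a s) b = (if a < b then -1 else 1) * checkSign s b := by
  simp only [checkSign, Finset.mem_insert, hab.symm, false_or, card_filter_insert ha]
  split_ifs <;> simp

lemma sign_mul_sign (hab : a ≠ b) :
    (if a < b then (-1 : ℤ) else 1) = -(if b < a then (-1 : ℤ) else 1) := by
  rcases lt_or_gt_of_ne hab with h | h
  · simp [h, h.le, not_lt_of_gt h]
  · simp [h, h.le, not_lt_of_gt h]

/-- Anticommutation of `∧ a` and `∧ b`. If one of them already lies in `s`, both sides vanish. -/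
lemma wedgeSign_mul_wedgeSign (hab : a ≠ b) :
    wedgeSign s a * wedgeSign (insert a s) b = -(wedgeSign s b * wedgeSign (insert b s) a) := by
  by_cases ha : a ∈ s
  · rw [wedgeSign_of_mem ha, wedgeSign_of_mem (Finset.mem_insert_of_mem ha)]
    ring
  · by_cases hb : b ∈ s
    · rw [wedgeSign_of_mem hb, wedgeSign_of_mem (Finset.mem_insert_of_mem hb)]
      ring
    · rw [wedgeSign_insert hab ha, wedgeSign_insert hab.symm hb, sign_mul_sign hab]
      ring

/-- Anticommutation of `∧ a` with the contraction by a different `b`. This is the sign that a chain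
map into a shifted complex needs. -/
lemma wedgeSign_mul_checkSign (hab : a ≠ b) :
    wedgeSign s a * checkSign (insert a s) b = -(checkSign s b * wedgeSign (s.erase b) a) := by
  by_cases ha : a ∈ s
  · rw [wedgeSign_of_mem ha, wedgeSign_of_mem (Finset.mem_erase.2 ⟨hab, ha⟩)]
    ring
  · by_cases hb : b ∈ s
    · rw [checkSign_insert hab ha]
      conv_lhs => rw [← Finset.insert_erase hb]
      rw [wedgeSign_insert hab.symm (Finset.notMem_erase b s), Finset.insert_erase hb,
        sign_mul_sign hab.symm]
      split_ifs <;> ring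
    · rw [checkSign, checkSign, if_neg hb, if_neg (by simp [hab.symm, hb])]
      ring

lemma wedgeSign_mul_checkSign_self (ha : a ∉ s) :
    wedgeSign s a * checkSign (insert a s) a = 1 := by
  rw [wedgeSign, checkSign, if_neg ha, if_pos (Finset.mem_insert_self a s), card_filter_insert ha]
  simp [← pow_add, Even.neg_one_pow]

end Signs

namespace TangleShadow

open Bord

variable (P : TangleShadow) (χ : Coloring P) (k : Type*) [CommRing k]

/-- A family of morphisms between the smoothings. -/
abbrev Family : Type _ := ∀ σ τ : P.Crossing → Smoothing,
  (P.smoothed χ σ).obj k ⟶ (P.smoothed χ τ).obj k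

/-- The products with `[0,1]` and saddles. -/
noncomputable def saddles : P.Family χ k := fun σ τ => (P.saddle χ σ τ).mor k

/-- The morphism which maps the summand `s` to the summand `φ s`. -/
noncomputable def term (κ κ' : P.Crossing → Kind) (i j : ℤ)
    (φ : Finset P.Crossing → Finset P.Crossing) (w : Finset P.Crossing → ℤ)
    (B : P.Family χ k) : P.bracketX χ k κ i ⟶ P.bracketX χ k κ' j :=
  fun s t => if t.1 = φ s.1 then w s.1 • B (P.res κ s.1) (P.res κ' t.1) else 0

variable {P χ k} {κ κ' κ'' : P.Crossing → Kind} {i j l : ℤ}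
  {φ ψ : Finset P.Crossing → Finset P.Crossing} {w v : Finset P.Crossing → ℤ}
  {B C D : P.Family χ k}

lemma sum_hom_apply {ι : Type*} {M N : Mat_ (KCob k (P.bottom χ) (P.top χ))} (A : Finset ι)
    (f : ι → (M ⟶ N)) (s t) : (∑ a ∈ A, f a) s t = ∑ a ∈ A, f a s t := by
  classical
  induction A using Finset.induction_on with
  | empty => rfl
  | insert a A ha ih =>
    rw [Finset.sum_insert ha, Finset.sum_insert ha, ← ih]
    rfl

/-- Since `wedgeSign` kills the crossings already in `s`, the sum may run over all crossings, and
its index set no longer depends on `s`. -/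
lemma bracketD_eq_sum : P.bracketD χ k κ i j =
    ∑ a ∈ P.crossings κ, P.term χ k κ κ i j (insert a) (wedgeSign · a) (P.saddles χ k) := by
  ext s t
  rw [sum_hom_apply]
  refine Finset.sum_subset Finset.sdiff_subset fun a ha has => ?_
  have : a ∈ s.1 := by
    by_contra h
    exact has (Finset.mem_sdiff.2 ⟨ha, h⟩)
  simp only [term, wedgeSign_of_mem this, zero_smul, ite_self]

/-- In the matrix product only the intermediate summand `φ s` contributes. The geometric identity
and the existence of that summand are needed only where both weights are non-zero and the final
state exists; elsewhere both sides are zero. -/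
lemma term_comp
    (h : ∀ s : P.State κ i, ψ (φ s.1) ⊆ P.crossings κ'' → w s.1 ≠ 0 → v (φ s.1) ≠ 0 →
      (φ s.1 ⊆ P.crossings κ' ∧ ((φ s.1).card : ℤ) = j) ∧
        B (P.res κ s.1) (P.res κ' (φ s.1)) ≫
            C (P.res κ' (φ s.1)) (P.res κ'' (ψ (φ s.1))) =
          D (P.res κ s.1) (P.res κ'' (ψ (φ s.1)))) :
    P.term χ k κ κ' i j φ w B ≫ P.term χ k κ' κ'' j l ψ v C =
      P.term χ k κ κ'' i l (fun s => ψ (φ s)) (fun s => w s * v (φ s)) D := by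
  ext s ⟨u, hu⟩
  change ∑ t : P.State κ' j, (if t.1 = φ s.1 then w s.1 • B (P.res κ s.1) (P.res κ' t.1) else 0) ≫
    (if u = ψ t.1 then v t.1 • C (P.res κ' t.1) (P.res κ'' u) else 0) =
    if u = ψ (φ s.1) then (w s.1 * v (φ s.1)) • D (P.res κ s.1) (P.res κ'' u) else 0
  have zero : (u ≠ ψ (φ s.1) ∨ w s.1 = 0 ∨ v (φ s.1) = 0) → ∀ t : P.State κ' j,
      (if t.1 = φ s.1 then w s.1 • B (P.res κ s.1) (P.res κ' t.1) else 0) ≫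
        (if u = ψ t.1 then v t.1 • C (P.res κ' t.1) (P.res κ'' u) else 0) = 0 := by
    intro h t
    split_ifs with h1 h2
    · rw [h1] at h2
      rcases h with h | h | h
      · exact absurd h2 h
      · rw [h, zero_smul, Limits.zero_comp]
      · rw [h1, h, zero_smul, Limits.comp_zero]
    all_goals first | exact Limits.comp_zero | exact Limits.zero_comp
  by_cases hu' : u = ψ (φ s.1)
  · by_cases hw : w s.1 = 0
    · rw [Finset.sum_eq_zero fun t _ => zero (Or.inr (Or.inl hw)) t]
      simp [hw]
    · by_cases hv : v (φ s.1) = 0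
      · rw [Finset.sum_eq_zero fun t _ => zero (Or.inr (Or.inr hv)) t]
        simp [hv]
      · subst hu'
        obtain ⟨h1, h2⟩ := h s hu.1 hw hv
        rw [Finset.sum_eq_single (⟨φ s.1, h1⟩ : P.State κ' j)]
        · rw [if_pos rfl, if_pos rfl, if_pos rfl, Preadditive.zsmul_comp, Preadditive.comp_zsmul,
            h2, smul_smul]
        · intro t _ ht
          rw [if_neg fun h => ht (Subtype.ext h), Limits.zero_comp]
        · exact fun h => absurd (Finset.mem_univ _) h
  · rw [Finset.sum_eq_zero fun t _ => zero (Or.inl hu') t, if_neg hu']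

lemma term_congr (h : ∀ s : P.State κ i, (w s.1 = 0 ∧ v s.1 = 0) ∨
    (φ s.1 = ψ s.1 ∧ w s.1 = v s.1 ∧
      (φ s.1 ⊆ P.crossings κ' → B (P.res κ s.1) (P.res κ' (φ s.1)) =
        C (P.res κ s.1) (P.res κ' (φ s.1))))) :
    P.term χ k κ κ' i j φ w B = P.term χ k κ κ' i j ψ v C := by
  ext s ⟨u, hu⟩
  change (if u = φ s.1 then w s.1 • B (P.res κ s.1) (P.res κ' u) else 0) =
    (if u = ψ s.1 then v s.1 • C (P.res κ s.1) (P.res κ' u) else 0)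
  rcases h s with ⟨h1, h2⟩ | ⟨h1, h2, h3⟩
  · simp [h1, h2]
  · rw [← h1, ← h2]
    split_ifs with h4
    · subst h4
      rw [h3 hu.1]
    · rfl

lemma term_eq_zero (h : ∀ s : P.State κ i, φ s.1 ⊆ P.crossings κ' → w s.1 ≠ 0 →
    B (P.res κ s.1) (P.res κ' (φ s.1)) = 0) : P.term χ k κ κ' i j φ w B = 0 := by
  ext s ⟨u, hu⟩
  change (if u = φ s.1 then w s.1 • B (P.res κ s.1) (P.res κ' u) else 0) = 0
  split_ifs with h1
  · subst h1
    by_cases hw : w s.1 = 0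
    · rw [hw, zero_smul]
    · rw [h s hu.1 hw, smul_zero]
  · rfl

lemma neg_term : -P.term χ k κ κ' i j φ w B = P.term χ k κ κ' i j φ (fun s => -w s) B := by
  ext s u
  change -(if u.1 = φ s.1 then w s.1 • B (P.res κ s.1) (P.res κ' u.1) else 0) =
    (if u.1 = φ s.1 then (-w s.1) • B (P.res κ s.1) (P.res κ' u.1) else 0)
  split_ifs
  · rw [neg_smul]
  · rw [neg_zero]

lemma saddleMap_eq_term : P.saddleMap χ k κ κ' i j =
    P.term χ k κ κ' i j (fun s => s) (fun _ => 1) (P.saddles χ k) := by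
  ext s t
  simp only [saddleMap, term, one_smul]
  rfl

lemma phiMap_eq_term {c : P.Crossing} : P.phiMap χ k κ c i j =
    P.term χ k κ κ i j (fun s => s) (fun _ => 1) (fun σ τ => P.phi χ k σ τ c) := by
  ext s t
  simp only [phiMap, term, one_smul]
  rfl

lemma phiHatMap_eq_term {c : P.Crossing} : P.phiHatMap χ k κ κ' c i j =
    P.term χ k κ κ' i j (fun s => s.erase c) (checkSign · c) (fun σ τ => P.phi χ k σ τ c) := by
  ext s t
  simp only [phiHatMap, term, phi, smul_sub]

lemma wedgeMap_eq_term {c : P.Crossing} : P.wedgeMap χ k κ κ' c i j =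
    P.term χ k κ κ' i j (insert c) (wedgeSign · c) (P.saddles χ k) := rfl

lemma res_congr {x : P.Crossing} {s t : Finset P.Crossing} (hκ : κ x = κ' x)
    (h : x ∈ s ↔ x ∈ t) : P.res κ s x = P.res κ' t x := by
  simp only [res, hκ, h]

lemma card_insert_state {a : P.Crossing} {s : Finset P.Crossing} (h : a ∉ s) :
    ((insert a s).card : ℤ) = s.card + 1 := by
  rw [Finset.card_insert_of_notMem h]
  push_cast
  ring

-- The square of the differential is a sum over ordered pairs of crossings. Exchanging the pair
-- gives the same double saddle with the opposite sign, and the diagonal terms are zero.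
variable (χ k κ) in
theorem isComplex : P.IsComplex χ k κ := by
  intro i j l
  -- The intermediate states must have exactly `i + 1` elements for `term_comp`; in other degrees
  -- the first differential is already zero.
  by_cases hij : i + 1 = j
  swap
  · rw [P.bracketD_shape χ k κ i j hij, Limits.zero_comp]
  subst hij
  set T : P.Crossing × P.Crossing → (P.bracketX χ k κ i ⟶ P.bracketX χ k κ l) := fun p =>
    P.term χ k κ κ i l (fun s => insert p.2 (insert p.1 s))
      (fun s => wedgeSign s p.1 * wedgeSign (insert p.1 s) p.2) (P.saddles χ k) with hT
  have comp : ∀ a ∈ P.crossings κ, ∀ b ∈ P.crossings κ,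
      P.term χ k κ κ i (i + 1) (insert a) (wedgeSign · a) (P.saddles χ k) ≫
        P.term χ k κ κ (i + 1) l (insert b) (wedgeSign · b) (P.saddles χ k) = T (a, b) := by
    intro a ha b hb
    refine term_comp fun s hs h1 h2 => ⟨⟨(Finset.subset_insert _ _).trans hs, ?_⟩, ?_⟩
    · rw [card_insert_state (notMem_of_wedgeSign_ne h1), s.2.2]
    · refine P.saddle_comp χ k fun x => ?_
      have hab : b ∉ insert a s.1 := notMem_of_wedgeSign_ne h2
      by_cases hx : x = a
      · subst hx
        exact Or.inr (res_congr rfl (by simp))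
      · exact Or.inl (res_congr rfl (by simp [hx]))
  rw [bracketD_eq_sum, bracketD_eq_sum, Preadditive.sum_comp]
  simp only [Preadditive.comp_sum]
  rw [Finset.sum_congr rfl fun a ha => Finset.sum_congr rfl fun b hb => comp a ha b hb,
    ← Finset.sum_product']
  have anti : ∀ a b, a ≠ b → T (a, b) = -T (b, a) := fun a b hab => by
    simp only [hT]
    rw [neg_term]
    exact term_congr fun s => Or.inr
      ⟨Finset.insert_comm _ _ _, wedgeSign_mul_wedgeSign hab, fun _ => rfl⟩
  have diag : ∀ a, T (a, a) = 0 := fun a => term_eq_zero fun s _ h =>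
    absurd (by rw [wedgeSign_of_mem (Finset.mem_insert_self a s.1), mul_zero]) h
  refine Finset.sum_involution (fun p _ => (p.2, p.1)) ?_ ?_ ?_ ?_
  · rintro ⟨a, b⟩ _
    by_cases hab : a = b
    · subst hab
      simp only [diag, add_zero]
    · rw [anti a b hab]
      exact neg_add_cancel _
  · rintro ⟨a, b⟩ _ h h'
    obtain rfl : b = a := (Prod.mk.inj h').1
    exact h (diag b)
  · rintro ⟨a, b⟩ h
    exact Finset.mem_product.2 ⟨(Finset.mem_product.1 h).2, (Finset.mem_product.1 h).1⟩
  · rintro ⟨a, b⟩ _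
    rfl

end TangleShadow

end GenusOne

/-! ### Chain maps and the bidegree. -/

namespace GenusOne

namespace TangleShadow

open Bord

variable {P : TangleShadow} {χ : Coloring P} {k : Type*} [CommRing k]
  {κ κ' : P.Crossing → Kind} {c : P.Crossing} {i j : ℤ}

lemma mem_crossings {x : P.Crossing} : x ∈ P.crossings κ ↔ (κ x).isCrossing = true := by
  simp [crossings]

/-- Only an inclusion of crossings is assumed, so that the lemma also covers the projection from
`pos` to `V`. The surplus terms of the first differential lead to states containing a crossing that
`κ'` lacks, and hence contribute nothing. -/
lemma saddleMap_comm (hsub : P.crossings κ' ⊆ P.crossings κ)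
    (hκ : ∀ a ∈ P.crossings κ', κ a = κ' a) (hij : i + 1 = j) :
    P.saddleMap χ k κ κ' i i ≫ P.bracketD χ k κ' i j =
      P.bracketD χ k κ i j ≫ P.saddleMap χ k κ κ' j j := by
  subst hij
  set T : P.Crossing → (P.bracketX χ k κ i ⟶ P.bracketX χ k κ' (i + 1)) := fun a =>
    P.term χ k κ κ' i (i + 1) (insert a) (wedgeSign · a) (P.saddles χ k) with hT
  have h1 : ∀ a ∈ P.crossings κ', P.term χ k κ κ' i i (fun s => s) (fun _ => 1) (P.saddles χ k) ≫
      P.term χ k κ' κ' i (i + 1) (insert a) (wedgeSign · a) (P.saddles χ k) = T a := by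
    intro a ha
    refine (term_comp (D := P.saddles χ k) fun s hs _ h2 =>
      ⟨⟨(Finset.subset_insert _ _).trans hs, s.2.2⟩, ?_⟩).trans (term_congr fun s =>
        Or.inr ⟨rfl, one_mul _, fun _ => rfl⟩)
    refine P.saddle_comp χ k fun x => ?_
    by_cases hx : x = a
    · subst hx
      exact Or.inl (res_congr (hκ x ha) Iff.rfl)
    · exact Or.inr (res_congr rfl (by simp [hx]))
  have h2 : ∀ a ∈ P.crossings κ, P.term χ k κ κ i (i + 1) (insert a) (wedgeSign · a)
      (P.saddles χ k) ≫ P.term χ k κ κ' (i + 1) (i + 1) (fun s => s) (fun _ => 1) (P.saddles χ k) =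
      T a := by
    intro a ha
    refine (term_comp (D := P.saddles χ k) fun s hs h2 _ =>
      ⟨⟨hs.trans hsub, by rw [card_insert_state (notMem_of_wedgeSign_ne h2), s.2.2]⟩, ?_⟩).trans
        (term_congr fun s => Or.inr ⟨rfl, mul_one _, fun _ => rfl⟩)
    refine P.saddle_comp χ k fun x => ?_
    by_cases hx : x = a
    · subst hx
      exact Or.inr (res_congr (hκ x (hs (Finset.mem_insert_self _ _))) Iff.rfl)
    · exact Or.inl (res_congr rfl (by simp [hx]))
  rw [bracketD_eq_sum, bracketD_eq_sum, saddleMap_eq_term, saddleMap_eq_term,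
    Preadditive.sum_comp, Preadditive.comp_sum, Finset.sum_congr rfl h1, Finset.sum_congr rfl h2]
  refine Finset.sum_subset hsub fun a _ ha => term_eq_zero fun s hs _ => ?_
  exact absurd (hs (Finset.mem_insert_self _ _)) ha

/-- As `c` is smoothed, every saddle of the differential is elsewhere and slides past the tube and
the handle. -/
lemma phiMap_comm (hκ : κ c = .smooth .V) (hij : i + 1 = j) :
    P.phiMap χ k κ c i i ≫ P.bracketD χ k κ i j = P.bracketD χ k κ i j ≫ P.phiMap χ k κ c j j := by
  subst hij
  have hV : ∀ s, P.res κ s c = .V := fun s => by rw [res, hκ]; rfl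
  set T : P.Crossing → (P.bracketX χ k κ i ⟶ P.bracketX χ k κ (i + 1)) := fun a =>
    P.term χ k κ κ i (i + 1) (insert a) (wedgeSign · a) (fun σ τ => P.phi χ k σ τ c) with hT
  have h1 : ∀ a ∈ P.crossings κ, P.term χ k κ κ i i (fun s => s) (fun _ => 1)
      (fun σ τ => P.phi χ k σ τ c) ≫
      P.term χ k κ κ i (i + 1) (insert a) (wedgeSign · a) (P.saddles χ k) = T a := by
    intro a ha
    refine (term_comp (D := fun σ τ => P.phi χ k σ τ c) fun s hs _ h2 =>
      ⟨s.2, P.phi_comp_saddle χ k (hV _) (hV _)⟩).trans (term_congr fun s =>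
        Or.inr ⟨rfl, one_mul _, fun _ => rfl⟩)
  have h2 : ∀ a ∈ P.crossings κ, P.term χ k κ κ i (i + 1) (insert a) (wedgeSign · a)
      (P.saddles χ k) ≫ P.term χ k κ κ (i + 1) (i + 1) (fun s => s) (fun _ => 1)
        (fun σ τ => P.phi χ k σ τ c) = T a := by
    intro a ha
    refine (term_comp (D := fun σ τ => P.phi χ k σ τ c) fun s hs h2 _ =>
      ⟨⟨hs, by rw [card_insert_state (notMem_of_wedgeSign_ne h2), s.2.2]⟩,
        P.saddle_comp_phi χ k (hV _) (hV _)⟩).trans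
        (term_congr fun s => Or.inr ⟨rfl, mul_one _, fun _ => rfl⟩)
  rw [bracketD_eq_sum, phiMap_eq_term, phiMap_eq_term,
    Preadditive.sum_comp, Preadditive.comp_sum, Finset.sum_congr rfl h1, Finset.sum_congr rfl h2]

lemma saddleMap_comp_phiMap (h : κ c = .smooth .H) (h' : κ' c = .smooth .V)
    (hcr : P.crossings κ ⊆ P.crossings κ') :
    P.saddleMap χ k κ κ' i i ≫ P.phiMap χ k κ' c i i = 0 := by
  rw [saddleMap_eq_term, phiMap_eq_term]
  refine (term_comp (D := fun _ _ => 0) fun s hs _ _ => ⟨⟨s.2.1.trans hcr, s.2.2⟩,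
    P.saddle_comp_phi_of_H χ k ?_ ?_⟩).trans (term_eq_zero fun _ _ _ => rfl)
  · rw [res, h]; rfl
  · rw [res, h']; rfl

lemma phiMap_comp_saddleMap (h : κ c = .smooth .V) (h' : κ' c = .smooth .H) :
    P.phiMap χ k κ c i i ≫ P.saddleMap χ k κ κ' i i = 0 := by
  rw [saddleMap_eq_term, phiMap_eq_term]
  refine (term_comp (D := fun _ _ => 0) fun s hs _ _ => ⟨s.2,
    P.phi_comp_saddle_of_H χ k ?_ ?_⟩).trans (term_eq_zero fun _ _ _ => rfl)
  · rw [res, h]; rfl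
  · rw [res, h']; rfl

section Crossing

variable {V neg pos : P.Crossing → Kind} {s t : Finset P.Crossing}

lemma res_smooth (hV : V c = .smooth .V) : P.res V s c = .V := by rw [res, hV]; rfl

lemma res_eq_neg (hV : V c = .smooth .V) (hn : neg c = .neg) (hVn : ∀ x, x ≠ c → V x = neg x)
    (hc : c ∈ t) (h : ∀ x, x ≠ c → (x ∈ s ↔ x ∈ t)) : P.res V s = P.res neg t := by
  funext x
  by_cases hx : x = c
  · subst hx
    rw [res_smooth hV, res, hn, decide_eq_true hc]
    rfl
  · exact res_congr (hVn x hx) (h x hx)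

lemma res_eq_pos (hV : V c = .smooth .V) (hp : pos c = .pos) (hVp : ∀ x, x ≠ c → V x = pos x)
    (hc : c ∉ t) (h : ∀ x, x ≠ c → (x ∈ s ↔ x ∈ t)) : P.res V s = P.res pos t := by
  funext x
  by_cases hx : x = c
  · subst hx
    rw [res_smooth hV, res, hp, decide_eq_false hc]
    rfl
  · exact res_congr (hVp x hx) (h x hx)

lemma notMem_crossings (hV : V c = .smooth .V) : c ∉ P.crossings V := by
  simp [mem_crossings, hV, Kind.isCrossing]

lemma crossings_eq_insert (hV : V c = .smooth .V) (hn : (neg c).isCrossing = true)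
    (hVn : ∀ x, x ≠ c → V x = neg x) : P.crossings neg = insert c (P.crossings V) := by
  ext x
  by_cases hx : x = c
  · subst hx
    simp [mem_crossings, hn]
  · simp [mem_crossings, hx, hVn x hx]

/-- The sign arises from exchanging `∧ c` with `∧ a`. The term at `c` in the differential of `neg`
vanishes because `c` is already in the state. -/
lemma wedgeMap_comm {i' j' : ℤ} (hV : V c = .smooth .V) (hn : neg c = .neg)
    (hVn : ∀ x, x ≠ c → V x = neg x) (hi : i' + 1 = i) (hj : j' + 1 = j) (hij : i + 1 = j) :
    P.wedgeMap χ k V neg c i' i ≫ P.bracketD χ k neg i j =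
      -(P.bracketD χ k V i' j' ≫ P.wedgeMap χ k V neg c j' j) := by
  obtain rfl : i = j' := by omega
  subst hi hj
  have hc := notMem_crossings hV
  have hcr := crossings_eq_insert hV (hn ▸ rfl) hVn
  set T : P.Crossing → (P.bracketX χ k V i' ⟶ P.bracketX χ k neg (i' + 1 + 1)) := fun a =>
    P.term χ k V neg i' (i' + 1 + 1) (fun s => insert c (insert a s))
      (fun s => wedgeSign s a * wedgeSign (insert a s) c) (P.saddles χ k) with hT
  have h1 : ∀ a, P.term χ k V neg i' (i' + 1) (insert c) (wedgeSign · c) (P.saddles χ k) ≫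
      P.term χ k neg neg (i' + 1) (i' + 1 + 1) (insert a) (wedgeSign · a) (P.saddles χ k) =
        P.term χ k V neg i' (i' + 1 + 1) (fun s => insert a (insert c s))
          (fun s => wedgeSign s c * wedgeSign (insert c s) a) (P.saddles χ k) := by
    intro a
    refine term_comp fun s hs h1 _ => ⟨⟨(Finset.subset_insert _ _).trans hs, ?_⟩, ?_⟩
    · rw [card_insert_state (notMem_of_wedgeSign_ne h1), s.2.2]
    · refine P.saddle_comp χ k fun x => Or.inl ?_
      exact congrFun (res_eq_neg hV hn hVn (Finset.mem_insert_self _ _) fun x hx => by simp [hx]) x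
  have h1' : ∀ a ∈ P.crossings V,
      P.term χ k V neg i' (i' + 1) (insert c) (wedgeSign · c) (P.saddles χ k) ≫
        P.term χ k neg neg (i' + 1) (i' + 1 + 1) (insert a) (wedgeSign · a) (P.saddles χ k) =
      -T a := by
    intro a ha
    rw [h1, hT, neg_term]
    exact term_congr fun s => Or.inr ⟨Finset.insert_comm _ _ _,
      wedgeSign_mul_wedgeSign fun h => hc (h ▸ ha), fun _ => rfl⟩
  have h2 : ∀ a ∈ P.crossings V, P.term χ k V V i' (i' + 1) (insert a) (wedgeSign · a)
      (P.saddles χ k) ≫ P.term χ k V neg (i' + 1) (i' + 1 + 1) (insert c) (wedgeSign · c)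
        (P.saddles χ k) = T a := by
    intro a ha
    refine term_comp fun s hs h1 _ => ⟨⟨Finset.insert_subset ha s.2.1, ?_⟩, ?_⟩
    · rw [card_insert_state (notMem_of_wedgeSign_ne h1), s.2.2]
    · refine P.saddle_comp χ k fun x => Or.inr ?_
      exact congrFun (res_eq_neg hV hn hVn (Finset.mem_insert_self _ _) fun x hx => by simp [hx]) x
  have h3 : P.term χ k V neg i' (i' + 1) (insert c) (wedgeSign · c) (P.saddles χ k) ≫
      P.term χ k neg neg (i' + 1) (i' + 1 + 1) (insert c) (wedgeSign · c) (P.saddles χ k) = 0 := by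
    rw [h1]
    refine term_eq_zero fun s _ h => absurd ?_ h
    rw [wedgeSign_of_mem (Finset.mem_insert_self _ _), mul_zero]
  rw [bracketD_eq_sum, bracketD_eq_sum, wedgeMap_eq_term, wedgeMap_eq_term,
    Preadditive.sum_comp, Preadditive.comp_sum, hcr, Finset.sum_insert hc, h3, zero_add,
    Finset.sum_congr rfl h1', Finset.sum_congr rfl h2, Finset.sum_neg_distrib]

/-- At a crossing `a ≠ c` the composites agree up to sign, because the saddle slides past the tube
and the handle and the signs anticommute. At `a = c` they have no reason to match, but each one
vanishes: the first ends with a saddle from `V` to `H`, the second begins with one from `H` to `V`.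
-/
lemma phiHatMap_comm {i' j' : ℤ} (hV : V c = .smooth .V) (hn : neg c = .neg) (hp : pos c = .pos)
    (hVn : ∀ x, x ≠ c → V x = neg x) (hVp : ∀ x, x ≠ c → V x = pos x)
    (hi : i' + 1 = i) (hj : j' + 1 = j) (hij : i + 1 = j) :
    P.phiHatMap χ k neg pos c i i' ≫ P.bracketD χ k pos i' j' =
      -(P.bracketD χ k neg i j ≫ P.phiHatMap χ k neg pos c j j') := by
  obtain rfl : i = j' := by omega
  subst hi hj
  have hcr : P.crossings pos = P.crossings neg := by
    rw [crossings_eq_insert hV (hn ▸ rfl) hVn, crossings_eq_insert hV (hp ▸ rfl) hVp]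
  have hpV : ∀ s, c ∉ s → P.res pos s c = .V := fun s hs => by
    rw [res, hp, decide_eq_false hs]; rfl
  have hpH : ∀ s, c ∈ s → P.res pos s c = .H := fun s hs => by
    rw [res, hp, decide_eq_true hs]; rfl
  have hnV : ∀ s, c ∈ s → P.res neg s c = .V := fun s hs => by
    rw [res, hn, decide_eq_true hs]; rfl
  have hnH : ∀ s, c ∉ s → P.res neg s c = .H := fun s hs => by
    rw [res, hn, decide_eq_false hs]; rfl
  -- Removing `c` from the state while changing the sign of the crossing leaves the smoothing
  -- unchanged, so each nonzero component of the genus-one morphism is `phi` on a product.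
  have hnp : ∀ s, c ∈ s → P.res neg s = P.res pos (s.erase c) := fun s hs =>
    (res_eq_neg (s := s) hV hn hVn hs fun x _ => Iff.rfl).symm.trans
      (res_eq_pos hV hp hVp (Finset.notMem_erase _ _) fun x hx => by simp [hx])
  have hcard : ∀ (i : ℤ) (s : P.State neg (i + 1)), c ∈ s.1 → ((s.1.erase c).card : ℤ) = i := by
    intro i s hs
    have h := card_insert_state (Finset.notMem_erase c s.1)
    rw [Finset.insert_erase hs, s.2.2] at h
    omega
  set Φ : P.Family χ k := fun σ τ => P.phi χ k σ τ c with hΦ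
  have key : ∀ a ∈ P.crossings neg,
      P.term χ k neg pos (i' + 1) i' (fun s => s.erase c) (checkSign · c) Φ ≫
        P.term χ k pos pos i' (i' + 1) (insert a) (wedgeSign · a) (P.saddles χ k) =
      -(P.term χ k neg neg (i' + 1) (i' + 1 + 1) (insert a) (wedgeSign · a) (P.saddles χ k) ≫
        P.term χ k neg pos (i' + 1 + 1) (i' + 1) (fun s => s.erase c) (checkSign · c) Φ) := by
    intro a ha
    by_cases hac : a = c
    · subst hac
      rw [term_comp (D := fun _ _ => 0), term_comp (D := fun _ _ => 0), term_eq_zero,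
        term_eq_zero, neg_zero]
      · exact fun _ _ _ => rfl
      · exact fun _ _ _ => rfl
      · intro s _ h1 _
        have hs := notMem_of_wedgeSign_ne h1
        exact ⟨⟨Finset.insert_subset ha s.2.1, by rw [card_insert_state hs, s.2.2]⟩, by
          rw [← hnp _ (Finset.mem_insert_self _ _)]
          exact P.saddle_comp_phi_of_H χ k (hnH _ hs) (hnV _ (Finset.mem_insert_self _ _))⟩
      · intro s _ h1 _
        have hs := mem_of_checkSign_ne h1
        exact ⟨⟨((Finset.erase_subset _ _).trans s.2.1).trans hcr.ge, hcard _ s hs⟩, by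
          rw [hnp _ hs]
          exact P.phi_comp_saddle_of_H χ k (hpV _ (Finset.notMem_erase _ _))
            (hpH _ (Finset.mem_insert_self _ _))⟩
    · rw [term_comp (D := Φ), term_comp (D := Φ), neg_term]
      · refine term_congr fun s => Or.inr ⟨(Finset.erase_insert_of_ne hac).symm, ?_, fun _ => rfl⟩
        exact neg_eq_iff_eq_neg.1 (wedgeSign_mul_checkSign hac).symm
      · intro s _ h1 h2
        have hs := mem_of_checkSign_ne h2
        refine ⟨⟨Finset.insert_subset ha s.2.1, ?_⟩, ?_⟩
        · rw [card_insert_state (notMem_of_wedgeSign_ne h1), s.2.2]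
        · rw [← hnp _ hs]
          exact P.saddle_comp_phi χ k
            (hnV _ ((Finset.mem_insert.1 hs).resolve_left (Ne.symm hac))) (hnV _ hs)
      · intro s _ h1 _
        have hs := mem_of_checkSign_ne h1
        refine ⟨⟨((Finset.erase_subset _ _).trans s.2.1).trans hcr.ge, hcard _ s hs⟩, ?_⟩
        rw [hnp _ hs]
        exact P.phi_comp_saddle χ k (hpV _ (Finset.notMem_erase _ _))
          (hpV _ (by simp [Ne.symm hac]))
  rw [bracketD_eq_sum, bracketD_eq_sum, phiHatMap_eq_term, phiHatMap_eq_term,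
    Preadditive.sum_comp, Preadditive.comp_sum, hcr, Finset.sum_congr rfl key,
    Finset.sum_neg_distrib]

/-- On the relevant summands the inclusion and the projection join equal smoothings, so their
bordisms are products, that is identities. The signs of `∧ c` and of the contraction cancel. -/
lemma wedgeMap_comp_phiHatMap_comp_saddleMap {i' : ℤ} (hV : V c = .smooth .V) (hn : neg c = .neg)
    (hp : pos c = .pos) (hVn : ∀ x, x ≠ c → V x = neg x) (hVp : ∀ x, x ≠ c → V x = pos x)
    (hi : i' + 1 = i) :
    P.wedgeMap χ k V neg c i' i ≫ P.phiHatMap χ k neg pos c i i' ≫ P.saddleMap χ k pos V i' i' =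
      P.phiMap χ k V c i' i' := by
  subst hi
  have hc := notMem_crossings hV
  have hcn := crossings_eq_insert hV (hn ▸ rfl) hVn
  have hcp := crossings_eq_insert hV (hp ▸ rfl) hVp
  set Φ : P.Family χ k := fun σ τ => P.phi χ k σ τ c with hΦ
  have hself : ∀ σ, P.saddles χ k σ σ = 𝟙 _ := P.saddle_self χ k
  rw [wedgeMap_eq_term, phiHatMap_eq_term, saddleMap_eq_term, phiMap_eq_term,
    term_comp (D := Φ), term_comp (D := Φ)]
  · refine term_congr fun s => Or.inr ?_
    have hs : c ∉ s.1 := fun h => hc (s.2.1 h)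
    exact ⟨Finset.erase_insert hs, by rw [mul_one, wedgeSign_mul_checkSign_self hs],
      fun _ => rfl⟩
  · intro s _ h1 _
    have hs := notMem_of_wedgeSign_ne h1
    refine ⟨⟨hcn ▸ Finset.insert_subset_insert _ s.2.1, by rw [card_insert_state hs, s.2.2]⟩, ?_⟩
    rw [← res_eq_neg (s := s.1) hV hn hVn (Finset.mem_insert_self c s.1) fun x hx => by simp [hx],
      hself, Category.id_comp]
  · intro s hs' h1 _
    have hs := mem_of_checkSign_ne h1
    refine ⟨⟨hs'.trans (hcp ▸ Finset.subset_insert _ _), ?_⟩, ?_⟩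
    · have h := card_insert_state (Finset.notMem_erase c s.1)
      rw [Finset.insert_erase hs, s.2.2] at h
      omega
    · rw [← res_eq_pos (s := s.1.erase c) hV hp hVp (Finset.notMem_erase c s.1)
        fun x _ => Iff.rfl, hself, Category.comp_id]

lemma isHomogeneous_mor {Y₀ Y₁ : OrientedPoints} {W₀ W₁ : OneCob Y₀ Y₁} {S : Bord W₀ W₁} {q : ℚ}
    (h : S.degree = q) : IsHomogeneous (S.mor k) q := Submodule.subset_span ⟨S, h, rfl⟩

lemma card_kind_eq_add_one {κ₀ : Kind} (h : κ c = κ₀) (h' : κ' c ≠ κ₀)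
    (hκ : ∀ x, x ≠ c → κ x = κ' x) :
    Nat.card {x // κ x = κ₀} = Nat.card {x // κ' x = κ₀} + 1 := by
  have hs : {x | κ x = κ₀} = insert c {x | κ' x = κ₀} := by
    ext x
    by_cases hx : x = c
    · subst hx
      simp [h]
    · simp [hx, hκ x hx]
  exact (congrArg Set.ncard hs).trans
    (Set.ncard_insert_of_notMem (s := {x | κ' x = κ₀}) h' (Set.toFinite _))

/-- The genus-one morphism has bidegree `(0, 0)`. -/
theorem hasBidegree_phiHatMap (hV : V c = .smooth .V) (hn : neg c = .neg) (hp : pos c = .pos)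
    (hVn : ∀ x, x ≠ c → V x = neg x) (hVp : ∀ x, x ≠ c → V x = pos x) :
    P.HasBidegree χ k neg pos (P.phiHatMap χ k neg pos c i (i + -1)) 0 0 := by
  have hnp : ∀ x, x ≠ c → neg x = pos x := fun x hx => (hVn x hx).symm.trans (hVp x hx)
  have hneg : P.numNeg neg = P.numNeg pos + 1 :=
    card_kind_eq_add_one hn (by rw [hp]; nofun) hnp
  have hpos : P.numPos pos = P.numPos neg + 1 :=
    card_kind_eq_add_one hp (by rw [hn]; nofun) fun x hx => (hnp x hx).symm
  intro s t
  constructor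
  · intro h
    refine absurd ?_ h
    rw [homDegree, homDegree, s.2.2, t.2.2, hneg]
    push_cast
    ring
  · have hq : (((0 : ℤ) : ℚ) - ((P.quantumDegree pos t.1 : ℚ) - (P.quantumDegree neg s.1 : ℚ))) =
        -2 := by
      rw [quantumDegree, quantumDegree, s.2.2, t.2.2, hneg, hpos]
      push_cast
      ring
    rw [hq]
    have main : P.phiHatMap χ k neg pos c i (i + -1) s t ∈ Submodule.span k
        {g | ∃ S : Bord (P.smoothed χ (P.res neg s.1)) (P.smoothed χ (P.res pos t.1)),
          S.degree = -2 ∧ g = S.mor k} := by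
      simp only [phiHatMap]
      split_ifs with ht
      · by_cases hs : c ∈ s.1
        · have hres : P.res neg s.1 = P.res pos t.1 :=
            (res_eq_neg (s := s.1) hV hn hVn hs fun x _ => Iff.rfl).symm.trans
              (res_eq_pos hV hp hVp (ht ▸ Finset.notMem_erase _ _) fun x hx => by simp [ht, hx])
          have hc : P.res neg s.1 c = .V := by
            rw [res, hn, decide_eq_true hs]; rfl
          exact sub_mem
            (zsmul_mem (isHomogeneous_mor (P.degree_tubeBord χ hres hc)) _)
            (zsmul_mem (isHomogeneous_mor (P.degree_handleBord χ hres)) _)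
        · rw [checkSign, if_neg hs, zero_smul, zero_smul, sub_zero]
          exact Submodule.zero_mem _
      · exact Submodule.zero_mem _
    exact main

end Crossing

end TangleShadow

end GenusOne

/-! ### Assembly of the chain maps. -/

theorem proposition3p2 {k : Type*} [CommRing k] (P : TangleShadow) (χ : Coloring P)
    (κ : P.Crossing → Kind) (c : P.Crossing) :
    -- the brackets of all diagrams on the given shadow are complexes
    ∃ h : ∀ κ' : P.Crossing → Kind, P.IsComplex χ k κ',
    let neg : P.Crossing → Kind := Function.update κ c Kind.neg
    let pos : P.Crossing → Kind := Function.update κ c Kind.pos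
    let H : P.Crossing → Kind := Function.update κ c (Kind.smooth Smoothing.H)
    let V : P.Crossing → Kind := Function.update κ c (Kind.smooth Smoothing.V)
    ∃ (δm : P.bracket χ k H (h H) ⟶ P.bracket χ k V (h V))
      (Φ : P.bracket χ k V (h V) ⟶ P.bracket χ k V (h V))
      (δp : P.bracket χ k V (h V) ⟶ P.bracket χ k H (h H)),
      (∀ i, δm.f i = P.saddleMap χ k H V i i) ∧
      (∀ i, Φ.f i = P.phiMap χ k V c i i) ∧
      (∀ i, δp.f i = P.saddleMap χ k V H i i) ∧
      δm ≫ Φ = 0 ∧ Φ ≫ δp = 0 ∧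
      ∃ (ι : (P.bracket χ k V (h V))⟦(-1 : ℤ)⟧ ⟶ P.bracket χ k neg (h neg))
        (π : P.bracket χ k pos (h pos) ⟶ P.bracket χ k V (h V))
        (Φhat : P.bracket χ k neg (h neg) ⟶ (P.bracket χ k pos (h pos))⟦(-1 : ℤ)⟧),
        (∀ i, ι.f i = P.wedgeMap χ k V neg c (i + -1) i) ∧
        (∀ i, π.f i = P.saddleMap χ k pos V i i) ∧
        (∀ i, Φhat.f i = P.phiHatMap χ k neg pos c i (i + -1)) ∧
        ι ≫ Φhat ≫ π⟦(-1 : ℤ)⟧' = Φ⟦(-1 : ℤ)⟧' ∧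
        (∀ i, P.HasBidegree χ k neg pos (P.phiHatMap χ k neg pos c i (i + -1)) 0 0) := by
  have nV : Function.update κ c (Kind.smooth Smoothing.V) c = .smooth .V := Function.update_self ..
  have nH : Function.update κ c (Kind.smooth Smoothing.H) c = .smooth .H := Function.update_self ..
  have nn : Function.update κ c Kind.neg c = .neg := Function.update_self ..
  have np : Function.update κ c Kind.pos c = .pos := Function.update_self ..
  have hne : ∀ r r' x, x ≠ c → Function.update κ c r x = Function.update κ c r' x :=
    fun r r' x hx => by rw [Function.update_of_ne hx, Function.update_of_ne hx]
  have hHV : P.crossings (Function.update κ c (Kind.smooth Smoothing.H)) =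
      P.crossings (Function.update κ c (Kind.smooth Smoothing.V)) := by
    ext x
    rw [TangleShadow.mem_crossings, TangleShadow.mem_crossings]
    by_cases hx : x = c
    · subst hx
      rw [nV, nH]
      rfl
    · rw [hne _ _ x hx]
  have hmem : ∀ {r} {a}, a ∈ P.crossings (Function.update κ c (Kind.smooth r)) → a ≠ c := by
    rintro r a ha rfl
    rw [TangleShadow.mem_crossings, Function.update_self] at ha
    cases ha
  have hVp := TangleShadow.crossings_eq_insert nV (by rw [np]; rfl) (hne _ Kind.pos)
  -- The complex `W[1]` of the statement, with `W[1]^i = W^{i-1}`, is the shift by `-1` in the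
  -- convention used here; this is the sign of its differential.
  have sgn : (-1 : ℤ).negOnePow = -1 := by decide
  refine ⟨fun κ' => TangleShadow.isComplex χ k κ',
    { f := fun i => P.saddleMap χ k _ _ i i
      comm' := fun i j hij => TangleShadow.saddleMap_comm hHV.ge
        (fun a ha => hne _ _ a (hmem ha)) hij },
    { f := fun i => P.phiMap χ k _ c i i
      comm' := fun i j hij => TangleShadow.phiMap_comm nV hij },
    { f := fun i => P.saddleMap χ k _ _ i i
      comm' := fun i j hij => TangleShadow.saddleMap_comm hHV.le
        (fun a ha => hne _ _ a (hmem ha)) hij },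
    fun _ => rfl, fun _ => rfl, fun _ => rfl, ?_, ?_,
    { f := fun i => P.wedgeMap χ k _ _ c (i + -1) i
      comm' := fun i j hij => ?_ },
    { f := fun i => P.saddleMap χ k _ _ i i
      comm' := fun i j hij => TangleShadow.saddleMap_comm (hVp ▸ Finset.subset_insert _ _)
        (fun a ha => hne _ _ a (hmem ha)) hij },
    { f := fun i => P.phiHatMap χ k _ _ c i (i + -1)
      comm' := fun i j hij => ?_ },
    fun _ => rfl, fun _ => rfl, fun _ => rfl, ?_, ?_⟩
  · ext1 i
    exact TangleShadow.saddleMap_comp_phiMap nH nV hHV.le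
  · ext1 i
    exact TangleShadow.phiMap_comp_saddleMap nV nH
  -- The minus sign in `wedgeMap_comm` is the one carried by the differential of the shifted source.
  · have hij' : i + 1 = j := hij
    refine (TangleShadow.wedgeMap_comm nV nn (hne _ _) (neg_add_cancel_right i 1)
      (neg_add_cancel_right j 1) hij').trans ?_
    rw [CochainComplex.shiftFunctor_obj_d', sgn, Units.neg_smul, one_smul]
    exact (Preadditive.neg_comp _ _).symm
  -- Here it is the target that is shifted, and its differential absorbs the sign of
  -- `phiHatMap_comm`.
  · have hij' : i + 1 = j := hij
    rw [CochainComplex.shiftFunctor_obj_d', sgn, Units.neg_smul, one_smul]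
    refine (Preadditive.comp_neg (P.phiHatMap χ k _ _ c i (i + -1))
      (P.bracketD χ k _ (i + -1) (j + -1))).trans ?_
    exact neg_eq_iff_eq_neg.2 (TangleShadow.phiHatMap_comm nV nn np (hne _ _) (hne _ _)
      (neg_add_cancel_right i 1)
      (neg_add_cancel_right j 1) hij')
  · ext1 i
    exact TangleShadow.wedgeMap_comp_phiHatMap_comp_saddleMap nV nn np (hne _ _) (hne _ _)
      (neg_add_cancel_right i 1)
  · exact fun i => TangleShadow.hasBidegree_phiHatMap nV nn np (hne _ _) (hne _ _)
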